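/- Let $n\ge 1$ and $l=2n+1$. **The discrete system.** Let $\mathcal K_l$ be the skew field over $\mathbb C$ (the skew field of fractions of the Ore domain) with generators $f_i,\alpha_i$ ($i\in\mathbb Z/(l+1)\mathbb Z$), $h$ and relations: $[f_i,f_{i+1}]=h$; $[f_i,f_j]=0$ for $j\ne i\pm1$; the $\alpha_i$ and $h$ are central; and the normalization $f_0+f_2+\cdots+f_{2n}=1$, $f_1+f_3+\cdots+f_{2n+1}=1$. Let $s_i$ ($i\in\mathbb Z/(l+1)\mathbb Z$) and $\pi$ be the automorphisms of $\mathcal K_l$ with $$s_i(f_j)=f_j+\frac{\alpha_i}{f_i}u_{ij},\quad s_i(\alpha_j)=\alpha_j-\alpha_i a_{ij},\quad s_i(h)=h,\qquad \pi(f_j)=f_{j+1},\quad \pi(\alpha_j)=\alpha_{j+1},\quad \pi(h)=h,$$ where $u_{i,i\pm1}=\pm1$, $a_{ii}=2$, $a_{i,i\pm1}=-1$ and all other $u_{ij},a_{ij}$ are $0$. Put $T_1=\pi s_ls_{l-1}\cdots s_1$, $r_0=s_0s_1s_0$ and $r_i=s_{i+1}$ for $1\le i\le l-1$. **The limit field.**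 Let $\mathcal F_l$ be the skew field over $\mathbb C$ (again a skew field of fractions of an Ore domain) with generators $\varphi_i,\beta_i$ ($i\in\mathbb Z/(l+1)\mathbb Z$), $t$, $h'$ and relations: $[\varphi_i,\varphi_{i+1}]=h'$; $[\varphi_i,\varphi_j]=0$ for $j\neq i\pm1$; the $\beta_i$, $t$, $h'$ are central; $\varphi_0+\varphi_2+\cdots+\varphi_{2n}=0$, $\varphi_1+\varphi_3+\cdots+\varphi_{2n+1}=0$ and $\beta_0+\cdots+\beta_l=1$. Set $$\psi_0=\varphi_0+\varphi_1+t,\quad \psi_i=\varphi_{i+1},\qquad \gamma_0=\beta_0+\beta_1,\quad\gamma_i=\beta_{i+1}\qquad(1\le i\le l-1),$$ with the indices of $\psi,\gamma$ read in $\mathbb Z/l\mathbb Z$. Let $\epsilon$ be a central indeterminate, and regard $\mathcal F_l[[\epsilon]]$ and the skew field of fractions $\mathcal F_l(\epsilon)$ of $\mathcal F_l[\epsilon]$ as subrings of the skew field $\mathcal F_l((\epsilon))$ of Laurent series. **The theorem.** There are automorphisms $s_i,\pi$ of $\mathcal K_l$ as above. There is a $\mathbb C$-algebra homomorphism $\Psi$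 from $\mathcal K_l$ to $\mathcal F_l((\epsilon))$ (its image lies in $\mathcal F_l(\epsilon)$, since the values on generators do) with $$\Psi(f_0)=1+\epsilon\varphi_0,\quad\Psi(f_1)=1+\epsilon\varphi_1,\quad\Psi(f_i)=\epsilon\varphi_i\ (2\le i\le l),$$ $$\Psi(\alpha_0)=-1+\epsilon t+\epsilon^2\beta_0,\quad \Psi(\alpha_1)=1-\epsilon t+\epsilon^2\beta_1,\quad\Psi(\alpha_i)=\epsilon^2\beta_i\ (2\le i\le l),\quad\Psi(h)=\epsilon^2h'.$$ There are $\mathbb C$-algebra automorphisms of $\mathcal F_l[[\epsilon]]$, again denoted $T_1$ and $r_i$ ($i\in\mathbb Z/l\mathbb Z$), with $$T_1(\epsilon)=\epsilon,\quad T_1(t)=t+\epsilon,\quad T_1(\beta_i)=\beta_i,\quad T_1(h')=h',\quad T_1(\psi_j)=\frac{\Psi(T_1(f_{j+1}))}{\epsilon}\ (1\le j\le l-1),$$ $$r_i(\epsilon)=\epsilon,\quad r_i(t)=t,\quad r_i(h')=h',\quad r_i(\gamma_j)=\gamma_j-\gamma_ia_{ij},\quad r_i(\psi_j)=\frac{\Psi(r_i(f_{j+1}))}{\epsilon}\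 (1\le j\le l-1),$$ $$r_0(\beta_0)=-\beta_1,\quad r_{l-1}(\beta_0)=\beta_0+\beta_l,\quad r_i(\beta_0)=\beta_0\ (1\le i\le l-2),$$ where, in the formula for $r_i(\gamma_j)$, $(a_{ij})_{i,j\in\mathbb Z/l\mathbb Z}$ is the generalized Cartan matrix of type $A^{(1)}_{l-1}$ ($a_{ii}=2$, $a_{i,i\pm1}=-1$, all others $0$). These maps are determined by their values on generators. Moreover, for all $\phi\in\mathcal F_l$ one has $T_1(\phi)-\phi\in\epsilon\,\mathcal F_l[[\epsilon]]$, and $$\partial\phi=\left.\frac{T_1(\phi)-\phi}{\epsilon}\right|_{\epsilon=0}$$ defines a $\mathbb C$-derivation $\partial$ of $\mathcal F_l$; and each $r_i$ induces an automorphism, also denoted $r_i$, of $\mathcal F_l=\mathcal F_l[[\epsilon]]/\epsilon\mathcal F_l[[\epsilon]]$. They satisfy the following. (1) For all $i\in\mathbb Z/l\mathbb Z$, $$\partial\psi_i=\psi_i\Bigl(\sum_{r=1}^n\psi_{i+2r-1}\Bigr)-\Bigl(\sum_{r=1}^n\psi_{i+2r}\Bigr)\psi_i+\gamma_i.$$ (2)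 The automorphisms $r_0,\dots,r_{l-1}$ of $\mathcal F_l$ commute with $\partial$. -/

import Mathlib

noncomputable section

namespace QPainleve

/-! ## Skew fields of fractions

Each of the two algebras below is an iterated Ore extension of a commutative polynomial ring over
`ℂ` (adjoin first the even-indexed, then the odd-indexed noncentral generators), hence an Ore
domain. The ring obtained from an Ore domain by universally inverting all of its nonzero elements
is its quotient skew field. -/

section SkewFrac

variable (A : Type) [Ring A] [Algebra ℂ A]

/-- Generators: the elements of `A`, and a formal inverse of each nonzero element of `A`. -/
inductive FracGen : Type
  | of (a : A)
  | inv (a : A) (ha : a ≠ 0)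

/-- Relations: those of the `ℂ`-algebra `A`, and `a * a⁻¹ = a⁻¹ * a = 1` for `a ≠ 0`. -/
inductive FracRel : FreeAlgebra ℂ (FracGen A) → FreeAlgebra ℂ (FracGen A) → Prop
  | add (a b : A) : FracRel (FreeAlgebra.ι ℂ (.of (a + b)))
      (FreeAlgebra.ι ℂ (.of a) + FreeAlgebra.ι ℂ (.of b))
  | mul (a b : A) : FracRel (FreeAlgebra.ι ℂ (.of (a * b)))
      (FreeAlgebra.ι ℂ (.of a) * FreeAlgebra.ι ℂ (.of b))
  | scalar (c : ℂ) : FracRel (FreeAlgebra.ι ℂ (.of (algebraMap ℂ A c)))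
      (algebraMap ℂ (FreeAlgebra ℂ (FracGen A)) c)
  | mul_inv (a : A) (ha : a ≠ 0) :
      FracRel (FreeAlgebra.ι ℂ (.of a) * FreeAlgebra.ι ℂ (.inv a ha)) 1
  | inv_mul (a : A) (ha : a ≠ 0) :
      FracRel (FreeAlgebra.ι ℂ (.inv a ha) * FreeAlgebra.ι ℂ (.of a)) 1

/-- The universal `ℂ`-algebra under `A` in which all nonzero elements of `A` are invertible.
For an Ore domain `A` this is the skew field of fractions of `A`. -/
def SkewFrac : Type := RingQuot (FracRel A)

instance : Ring (SkewFrac A) := inferInstanceAs (Ring (RingQuot (FracRel A)))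

instance : Algebra ℂ (SkewFrac A) := inferInstanceAs (Algebra ℂ (RingQuot (FracRel A)))

variable {A}

/-- The canonical map from `A` to its skew field of fractions. -/
def SkewFrac.of (a : A) : SkewFrac A :=
  RingQuot.mkAlgHom ℂ (FracRel A) (FreeAlgebra.ι ℂ (.of a))

end SkewFrac

/-! ## The skew field `K` for `l = 2 n + 1`

Indices of `f`, `α` are in `ℤ/(l+1)ℤ`. -/

/-- Generators `f i`, `α i`, `h`. -/
inductive KGen (n : ℕ) : Type
  | f (i : ZMod (2 * n + 2))
  | α (i : ZMod (2 * n + 2))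
  | h

/-- The defining relations, together with the normalization
`f 0 + f 2 + ⋯ + f (2 n) = 1`, `f 1 + f 3 + ⋯ + f (2 n + 1) = 1` of the two central elements
under which the continuous limit is taken. -/
inductive KRel (n : ℕ) : FreeAlgebra ℂ (KGen n) → FreeAlgebra ℂ (KGen n) → Prop
  | f_f_succ (i : ZMod (2 * n + 2)) :
      KRel n (FreeAlgebra.ι ℂ (.f i) * FreeAlgebra.ι ℂ (.f (i + 1))
        - FreeAlgebra.ι ℂ (.f (i + 1)) * FreeAlgebra.ι ℂ (.f i)) (FreeAlgebra.ι ℂ .h)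
  | f_f (i j : ZMod (2 * n + 2)) (h₁ : j ≠ i + 1) (h₂ : j ≠ i - 1) :
      KRel n (FreeAlgebra.ι ℂ (.f i) * FreeAlgebra.ι ℂ (.f j))
        (FreeAlgebra.ι ℂ (.f j) * FreeAlgebra.ι ℂ (.f i))
  | f_α (i j : ZMod (2 * n + 2)) :
      KRel n (FreeAlgebra.ι ℂ (.f i) * FreeAlgebra.ι ℂ (.α j))
        (FreeAlgebra.ι ℂ (.α j) * FreeAlgebra.ι ℂ (.f i))
  | α_α (i j : ZMod (2 * n + 2)) :
      KRel n (FreeAlgebra.ι ℂ (.α i) * FreeAlgebra.ι ℂ (.α j))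
        (FreeAlgebra.ι ℂ (.α j) * FreeAlgebra.ι ℂ (.α i))
  | h_f (i : ZMod (2 * n + 2)) :
      KRel n (FreeAlgebra.ι ℂ .h * FreeAlgebra.ι ℂ (.f i))
        (FreeAlgebra.ι ℂ (.f i) * FreeAlgebra.ι ℂ .h)
  | h_α (i : ZMod (2 * n + 2)) :
      KRel n (FreeAlgebra.ι ℂ .h * FreeAlgebra.ι ℂ (.α i))
        (FreeAlgebra.ι ℂ (.α i) * FreeAlgebra.ι ℂ .h)
  | sum_even :
      KRel n (∑ m ∈ Finset.range (n + 1),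
        FreeAlgebra.ι ℂ (.f ((2 * m : ℕ) : ZMod (2 * n + 2)))) 1
  | sum_odd :
      KRel n (∑ m ∈ Finset.range (n + 1),
        FreeAlgebra.ι ℂ (.f ((2 * m + 1 : ℕ) : ZMod (2 * n + 2)))) 1

/-- The associative `ℂ`-algebra with these generators and relations. -/
abbrev KAlg (n : ℕ) : Type := RingQuot (KRel n)

/-- The skew field `K` with these generators and relations. -/
abbrev K (n : ℕ) : Type := SkewFrac (KAlg n)

/-- A generator, as an element of `K`. -/
def K.gen {n : ℕ} (x : KGen n) : K n :=
  SkewFrac.of (RingQuot.mkAlgHom ℂ (KRel n) (FreeAlgebra.ι ℂ x))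

/-- The element `f i` of `K`. -/
def f {n : ℕ} (i : ZMod (2 * n + 2)) : K n := K.gen (.f i)

/-- The element `α i` of `K`. -/
def α {n : ℕ} (i : ZMod (2 * n + 2)) : K n := K.gen (.α i)

/-- The element `h` of `K`. -/
def h {n : ℕ} : K n := K.gen .h

/-! ## The skew field `F` -/

/-- Generators `φ i`, `β i`, `t`, `h'`. -/
inductive FGen (n : ℕ) : Type
  | φ (i : ZMod (2 * n + 2))
  | β (i : ZMod (2 * n + 2))
  | t
  | h'

/-- The defining relations. -/
inductive FRel (n : ℕ) : FreeAlgebra ℂ (FGen n) → FreeAlgebra ℂ (FGen n) → Prop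
  | φ_φ_succ (i : ZMod (2 * n + 2)) :
      FRel n (FreeAlgebra.ι ℂ (.φ i) * FreeAlgebra.ι ℂ (.φ (i + 1))
        - FreeAlgebra.ι ℂ (.φ (i + 1)) * FreeAlgebra.ι ℂ (.φ i)) (FreeAlgebra.ι ℂ .h')
  | φ_φ (i j : ZMod (2 * n + 2)) (h₁ : j ≠ i + 1) (h₂ : j ≠ i - 1) :
      FRel n (FreeAlgebra.ι ℂ (.φ i) * FreeAlgebra.ι ℂ (.φ j))
        (FreeAlgebra.ι ℂ (.φ j) * FreeAlgebra.ι ℂ (.φ i))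
  | φ_β (i j : ZMod (2 * n + 2)) :
      FRel n (FreeAlgebra.ι ℂ (.φ i) * FreeAlgebra.ι ℂ (.β j))
        (FreeAlgebra.ι ℂ (.β j) * FreeAlgebra.ι ℂ (.φ i))
  | β_β (i j : ZMod (2 * n + 2)) :
      FRel n (FreeAlgebra.ι ℂ (.β i) * FreeAlgebra.ι ℂ (.β j))
        (FreeAlgebra.ι ℂ (.β j) * FreeAlgebra.ι ℂ (.β i))
  | φ_t (i : ZMod (2 * n + 2)) :
      FRel n (FreeAlgebra.ι ℂ (.φ i) * FreeAlgebra.ι ℂ .t)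
        (FreeAlgebra.ι ℂ .t * FreeAlgebra.ι ℂ (.φ i))
  | β_t (i : ZMod (2 * n + 2)) :
      FRel n (FreeAlgebra.ι ℂ (.β i) * FreeAlgebra.ι ℂ .t)
        (FreeAlgebra.ι ℂ .t * FreeAlgebra.ι ℂ (.β i))
  | φ_h' (i : ZMod (2 * n + 2)) :
      FRel n (FreeAlgebra.ι ℂ (.φ i) * FreeAlgebra.ι ℂ .h')
        (FreeAlgebra.ι ℂ .h' * FreeAlgebra.ι ℂ (.φ i))
  | β_h' (i : ZMod (2 * n + 2)) :
      FRel n (FreeAlgebra.ι ℂ (.β i) * FreeAlgebra.ι ℂ .h')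
        (FreeAlgebra.ι ℂ .h' * FreeAlgebra.ι ℂ (.β i))
  | t_h' :
      FRel n (FreeAlgebra.ι ℂ .t * FreeAlgebra.ι ℂ .h')
        (FreeAlgebra.ι ℂ .h' * FreeAlgebra.ι ℂ .t)
  | sum_even :
      FRel n (∑ m ∈ Finset.range (n + 1),
        FreeAlgebra.ι ℂ (.φ ((2 * m : ℕ) : ZMod (2 * n + 2)))) 0
  | sum_odd :
      FRel n (∑ m ∈ Finset.range (n + 1),
        FreeAlgebra.ι ℂ (.φ ((2 * m + 1 : ℕ) : ZMod (2 * n + 2)))) 0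
  | sum_β :
      FRel n (∑ m ∈ Finset.range (2 * n + 2),
        FreeAlgebra.ι ℂ (.β (m : ZMod (2 * n + 2)))) 1

/-- The associative `ℂ`-algebra with these generators and relations. -/
abbrev FAlg (n : ℕ) : Type := RingQuot (FRel n)

/-- The skew field `F` with these generators and relations. -/
abbrev F (n : ℕ) : Type := SkewFrac (FAlg n)

/-- A generator, as an element of `F`. -/
def F.gen {n : ℕ} (x : FGen n) : F n :=
  SkewFrac.of (RingQuot.mkAlgHom ℂ (FRel n) (FreeAlgebra.ι ℂ x))

/-- The element `φ i` of `F`. -/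
def φ {n : ℕ} (i : ZMod (2 * n + 2)) : F n := F.gen (.φ i)

/-- The element `β i` of `F`. -/
def β {n : ℕ} (i : ZMod (2 * n + 2)) : F n := F.gen (.β i)

/-- The element `t` of `F`. -/
def t {n : ℕ} : F n := F.gen .t

/-- The element `h'` of `F`. -/
def h' {n : ℕ} : F n := F.gen .h'

/-- The index `i + 1 ∈ {1, …, l}` in `ℤ/(l+1)ℤ` of an index `i ∈ {0, …, l - 1}` in `ℤ/lℤ`. -/
def shift {n : ℕ} (i : ZMod (2 * n + 1)) : ZMod (2 * n + 2) := ((i.val + 1 : ℕ) : ZMod (2 * n + 2))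

/-- `ψ 0 = φ 0 + φ 1 + t` and `ψ i = φ (i + 1)` for `1 ≤ i ≤ l - 1`; indices in `ℤ/lℤ`. -/
def ψ {n : ℕ} (i : ZMod (2 * n + 1)) : F n :=
  if i = 0 then φ 0 + φ 1 + t else φ (shift i)

/-- `γ 0 = β 0 + β 1` and `γ i = β (i + 1)` for `1 ≤ i ≤ l - 1`; indices in `ℤ/lℤ`. -/
def γ {n : ℕ} (i : ZMod (2 * n + 1)) : F n :=
  if i = 0 then β 0 + β 1 else β (shift i)

/-! ## The discrete system -/

/-- The generalized Cartan matrix of type `A_{N-1}^{(1)}`, for `N ≥ 3`. -/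
def cartan {N : ℕ} (i j : ZMod N) : ℤ :=
  if j = i then 2 else if j = i + 1 ∨ j = i - 1 then -1 else 0

/-- The skew-symmetric matrix with `u i (i + 1) = 1`, `u i (i - 1) = -1`. -/
def orient {N : ℕ} (i j : ZMod N) : ℤ :=
  if j = i + 1 then 1 else if j = i - 1 then -1 else 0

/-- The automorphisms `s i` and `π` of `K`, given by their values on the generators. -/
structure WeylAction (n : ℕ) where
  s : ZMod (2 * n + 2) → (K n ≃ₐ[ℂ] K n)
  π : K n ≃ₐ[ℂ] K n
  s_f : ∀ i j, s i (f j) = f j + orient i j • (α i * Ring.inverse (f i))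
  s_α : ∀ i j, s i (α j) = α j - cartan i j • α i
  s_h : ∀ i, s i h = h
  π_f : ∀ j, π (f j) = f (j + 1)
  π_α : ∀ j, π (α j) = α (j + 1)
  π_h : π h = h

/-- The shift operator `T₁ = π s_l s_{l-1} ⋯ s_1`, `l = 2 n + 1` (product = composition). -/
def WeylAction.T₁ {n : ℕ} (W : WeylAction n) : K n ≃ₐ[ℂ] K n :=
  W.π * ((List.range (2 * n + 1)).map
    fun m => W.s ((2 * n + 1 - m : ℕ) : ZMod (2 * n + 2))).prod

/-- `r 0 = s 0 s 1 s 0` and `r i = s (i + 1)` for `1 ≤ i ≤ l - 1`. -/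
def WeylAction.r {n : ℕ} (W : WeylAction n) (i : ZMod (2 * n + 1)) : K n ≃ₐ[ℂ] K n :=
  if i = 0 then W.s 0 * W.s 1 * W.s 0 else W.s (shift i)

/-! ## The continuous limit

`F[[ε]]` and `F(ε)` are both regarded as subrings of the ring `F((ε))` of Laurent series. -/

/-- `ε ^ m` in `F((ε))`. -/
def epow (n : ℕ) (m : ℤ) : LaurentSeries (F n) := HahnSeries.single m 1

/-- A constant `x ∈ F` in `F((ε))`. -/
def const {n : ℕ} (x : F n) : LaurentSeries (F n) := HahnSeries.C x

/-- The homomorphism `Ψ`, given by its values on the generators. -/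
structure IsPsi {n : ℕ} (Ψ : K n →ₐ[ℂ] LaurentSeries (F n)) : Prop where
  f_zero : Ψ (f 0) = 1 + epow n 1 * const (φ 0)
  f_one : Ψ (f 1) = 1 + epow n 1 * const (φ 1)
  f_other : ∀ i : ZMod (2 * n + 2), i ≠ 0 → i ≠ 1 → Ψ (f i) = epow n 1 * const (φ i)
  α_zero : Ψ (α 0) = -1 + epow n 1 * const t + epow n 2 * const (β 0)
  α_one : Ψ (α 1) = 1 - epow n 1 * const t + epow n 2 * const (β 1)
  α_other : ∀ i : ZMod (2 * n + 2), i ≠ 0 → i ≠ 1 → Ψ (α i) = epow n 2 * const (β i)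
  map_h : Ψ h = epow n 2 * const h'

/-- The action `T` of `T₁` on `F[[ε]]`, given by its values on generators. -/
structure IsShift {n : ℕ} (W : WeylAction n) (Ψ : K n →ₐ[ℂ] LaurentSeries (F n))
    (T : PowerSeries (F n) ≃ₐ[ℂ] PowerSeries (F n)) : Prop where
  map_ε : T PowerSeries.X = PowerSeries.X
  map_t : T (PowerSeries.C t) = PowerSeries.C t + PowerSeries.X
  map_β : ∀ i, T (PowerSeries.C (β i)) = PowerSeries.C (β i)
  map_h' : T (PowerSeries.C h') = PowerSeries.C h'
  map_ψ : ∀ i : ZMod (2 * n + 1), i ≠ 0 →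
    HahnSeries.ofPowerSeries ℤ (F n) (T (PowerSeries.C (ψ i)))
      = epow n (-1) * Ψ (W.T₁ (f (shift i)))

/-- The action `R i` of `r i` on `F[[ε]]`, given by its values on generators. -/
structure IsReflection {n : ℕ} (W : WeylAction n) (Ψ : K n →ₐ[ℂ] LaurentSeries (F n))
    (R : ZMod (2 * n + 1) → (PowerSeries (F n) ≃ₐ[ℂ] PowerSeries (F n))) : Prop where
  map_ε : ∀ i, R i PowerSeries.X = PowerSeries.X
  map_t : ∀ i, R i (PowerSeries.C t) = PowerSeries.C t
  map_γ : ∀ i j, R i (PowerSeries.C (γ j)) = PowerSeries.C (γ j - cartan i j • γ i)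
  map_β_zero : ∀ i, R i (PowerSeries.C (β 0)) = PowerSeries.C
    (if i = 0 then -β 1 else if i = -1 then β 0 + β (-1) else β 0)
  map_h' : ∀ i, R i (PowerSeries.C h') = PowerSeries.C h'
  map_ψ : ∀ i j : ZMod (2 * n + 1), j ≠ 0 →
    HahnSeries.ofPowerSeries ℤ (F n) (R i (PowerSeries.C (ψ j)))
      = epow n (-1) * Ψ (W.r i (f (shift j)))

/-- All the data from which the continuous limit is formed; each component is pinned by its
values on generators. -/
structure ContinuousLimit (n : ℕ) where
  W : WeylAction n
  Ψ : K n →ₐ[ℂ] LaurentSeries (F n)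
  T : PowerSeries (F n) ≃ₐ[ℂ] PowerSeries (F n)
  R : ZMod (2 * n + 1) → (PowerSeries (F n) ≃ₐ[ℂ] PowerSeries (F n))
  isPsi : IsPsi Ψ
  isShift : IsShift W Ψ T
  isReflection : IsReflection W Ψ R

/-- `D` is a `ℂ`-derivation of the (noncommutative) `ℂ`-algebra `A`. -/
def IsDerivation {A : Type} [Ring A] [Algebra ℂ A] (D : A →ₗ[ℂ] A) : Prop :=
  ∀ a b, D (a * b) = D a * b + a * D b

/-- `D x = (T x - x) / ε |_{ε = 0}` for all `x ∈ F`; in particular `ε` divides `T x - x`. -/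
def ContinuousLimit.IsLimit {n : ℕ} (L : ContinuousLimit n) (D : F n →ₗ[ℂ] F n) : Prop :=
  ∀ x : F n, ∃ ρ : PowerSeries (F n),
    L.T (PowerSeries.C x) - PowerSeries.C x = PowerSeries.X * ρ ∧
      PowerSeries.constantCoeff ρ = D x

/-- `r i` is the automorphism of `F = F[[ε]] / ε F[[ε]]` induced by `R i`. -/
def ContinuousLimit.IsInduced {n : ℕ} (L : ContinuousLimit n)
    (r : ZMod (2 * n + 1) → (F n ≃ₐ[ℂ] F n)) : Prop :=
  ∀ (i : ZMod (2 * n + 1)) (x : PowerSeries (F n)),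
    PowerSeries.constantCoeff (L.R i x) = r i (PowerSeries.constantCoeff x)

end QPainleve

end

/-! Both algebras are of Weyl type. Once `f 0, f 1` (or `φ 0, φ 1, β 0`) are eliminated by the
normalizations, the remaining generators have commutators that are constant multiples of one central
variable. Such an algebra acts on polynomials by symmetrically ordered multiplication. Comparing
leading forms shows that it is a domain (`WeylPresentation.isDomain`), and the polynomial growth of
its degree filtration gives the Ore condition (`WeylPresentation.leftOre`). Hence `K n` and `F n`
are skew fields that contain the algebras they are built from.

A homomorphism extends to the skew field as soon as it sends nonzero elements of the algebra to
units, and for skew-field targets this means injectivity. The commutation matrix of the noncentral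
generators is nondegenerate, so repeated commutators move any nonzero element of a kernel to a
nonzero polynomial in the central generators (`injective_of_central`). Only the algebraic
independence of the images of the parameters remains to be checked. This produces `s i`, `π` and
`Ψ`. For `T₁` and `r i` on power series the relations are inherited from `K n` through `Ψ ∘ T₁` and
`Ψ ∘ r i`, and a power series is a unit when its constant term is.

For the limit, let `g k` be the image of `f (l - k)` under `Ψ π s_l ⋯ s_{l-k+1}`. Then `g (k+1) = Ψ
f (l - k) - A k / g k` and `Ψ (T₁ f (l - k)) = g k + A (k+1) / g (k+1)`, where `A k = -1 + ε t + ε²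
(β 0 + β l + ⋯)` is a partial sum of the `Ψ α`. Write `g k = 1 + ε c k + ⋯`. The second-order terms
of the `g k` cancel, and the coefficient of `ε²` in the image of `f (l - k)` is `c k φ - φ c (k+1) +
β` with `φ = φ (l - k)`, `β = β (l - k)` (`coeff_translateSeries`). Finally `-c k` is the sum of
every second `ψ` (`evenSum_eq`), which is formula (1) for nonzero indices. Index zero follows from
`∑ ψ = t`.

Modulo `ε` the reflections become `r i (ψ j) = ψ j + u i j κ` with `κ = γ i ψ i⁻¹`
(`IsPsi.exists_r_f`). Commutation with `∂` then reduces to the Riccati equation for `κ`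
(`map_γ_mul_inverse`) and a check at `j = i, i ± 1` (`IsReflectionOn.comm_ψ`). The limit data are
arbitrary, but the prescribed values together with the linear relations fix the constant terms of
`T` and `R i` on constants and the `ε`-coefficient of `T`. -/

noncomputable section
namespace QPainleve

/-! ### Skew fields of fractions of Ore domains -/

namespace SkewFrac

variable {A : Type} [Ring A] [Algebra ℂ A]

/-- The quotient map from the free algebra. -/
def mk (A : Type) [Ring A] [Algebra ℂ A] : FreeAlgebra ℂ (FracGen A) →ₐ[ℂ] SkewFrac A :=
  RingQuot.mkAlgHom ℂ (FracRel A)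

lemma mk_surjective : Function.Surjective (mk A) := RingQuot.mkAlgHom_surjective ℂ (FracRel A)

lemma mk_rel {x y : FreeAlgebra ℂ (FracGen A)} (h : FracRel A x y) : mk A x = mk A y :=
  RingQuot.mkAlgHom_rel ℂ h

/-- The canonical map as an algebra homomorphism. -/
def ofHom (A : Type) [Ring A] [Algebra ℂ A] : A →ₐ[ℂ] SkewFrac A where
  toFun := SkewFrac.of
  map_add' a b := (mk_rel (FracRel.add a b)).trans (map_add (mk A) _ _)
  map_mul' a b := (mk_rel (FracRel.mul a b)).trans (map_mul (mk A) _ _)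
  map_one' := by
    have := mk_rel (FracRel.scalar (A := A) 1)
    rwa [map_one, map_one, map_one] at this
  map_zero' := by
    have := mk_rel (FracRel.scalar (A := A) 0)
    rwa [map_zero, map_zero, map_zero] at this
  commutes' c := (mk_rel (FracRel.scalar (A := A) c)).trans (AlgHom.commutes (mk A) _)

@[simp] lemma ofHom_apply (a : A) : ofHom A a = SkewFrac.of a := rfl

/-- The formal inverse of a nonzero element. -/
def inv (a : A) (ha : a ≠ 0) : SkewFrac A := mk A (FreeAlgebra.ι ℂ (.inv a ha))

lemma of_mul_inv (a : A) (ha : a ≠ 0) : SkewFrac.of a * inv a ha = 1 := by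
  have := mk_rel (FracRel.mul_inv a ha)
  rwa [map_mul, map_one] at this

lemma inv_mul_of (a : A) (ha : a ≠ 0) : inv a ha * SkewFrac.of a = 1 := by
  have := mk_rel (FracRel.inv_mul a ha)
  rwa [map_mul, map_one] at this

lemma isUnit_of (a : A) (ha : a ≠ 0) : IsUnit (SkewFrac.of a) :=
  ⟨⟨_, inv a ha, of_mul_inv a ha, inv_mul_of a ha⟩, rfl⟩

lemma induction {p : SkewFrac A → Prop} (hof : ∀ a, p (SkewFrac.of a))
    (hinv : ∀ a (ha : a ≠ 0), p (SkewFrac.of a) → p (inv a ha))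
    (hadd : ∀ x y, p x → p y → p (x + y)) (hmul : ∀ x y, p x → p y → p (x * y))
    (x : SkewFrac A) : p x := by
  obtain ⟨x, rfl⟩ := mk_surjective x
  induction x using FreeAlgebra.induction with
  | grade0 c =>
    have := hof (algebraMap ℂ A c)
    rw [← ofHom_apply, AlgHom.commutes] at this
    rwa [AlgHom.commutes]
  | grade1 x =>
    cases x with
    | of a => exact hof a
    | inv a ha => exact hinv a ha (hof a)
  | mul a b ha hb => rw [map_mul]; exact hmul _ _ ha hb
  | add a b ha hb => rw [map_add]; exact hadd _ _ ha hb

lemma hom_ext {B : Type*} [Ring B] [Algebra ℂ B] {g₁ g₂ : SkewFrac A →ₐ[ℂ] B}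
    (h : ∀ a, g₁ (SkewFrac.of a) = g₂ (SkewFrac.of a)) : g₁ = g₂ := by
  ext x
  induction x using SkewFrac.induction with
  | hof a => exact h a
  | hadd x y hx hy => rw [map_add, map_add, hx, hy]
  | hmul x y hx hy => rw [map_mul, map_mul, hx, hy]
  | hinv a ha hx =>
    have h1 : g₁ (inv a ha) * g₁ (SkewFrac.of a) = 1 := by rw [← map_mul, inv_mul_of, map_one]
    have h2 : g₂ (SkewFrac.of a) * g₂ (inv a ha) = 1 := by rw [← map_mul, of_mul_inv, map_one]
    rw [hx] at h1
    exact left_inv_eq_right_inv h1 h2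

section Lift

variable {B : Type*} [Ring B] [Algebra ℂ B] (g : A →ₐ[ℂ] B) (hg : ∀ a, a ≠ 0 → IsUnit (g a))

/-- The value of the extension of `g` on a generator. -/
def liftFun : FracGen A → B
  | .of a => g a
  | .inv a ha => ((hg a ha).unit⁻¹ : Bˣ)

/-- The extension to the skew field of fractions of a homomorphism that maps nonzero elements to
units. -/
def lift : SkewFrac A →ₐ[ℂ] B :=
  RingQuot.liftAlgHom ℂ ⟨FreeAlgebra.lift ℂ (liftFun g hg), by
    intro x y hxy
    cases hxy with
    | add a b => simp [liftFun]
    | mul a b => simp [liftFun]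
    | scalar c => simp [liftFun]
    | mul_inv a ha => simp [liftFun]
    | inv_mul a ha => simp [liftFun]⟩

@[simp] lemma lift_of (a : A) : lift g hg (SkewFrac.of a) = g a := by
  change RingQuot.liftAlgHom ℂ _ (RingQuot.mkAlgHom ℂ (FracRel A) _) = _
  rw [RingQuot.liftAlgHom_mkAlgHom_apply]
  simp [liftFun]

end Lift

/-- The left Ore condition for domains. -/
def LeftOre (A : Type) [Ring A] : Prop :=
  ∀ a b : A, a ≠ 0 → b ≠ 0 → ∃ c d : A, c * a = d * b ∧ c * a ≠ 0

section Ore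

variable [IsDomain A]

omit [Algebra ℂ A] in
lemma LeftOre.exists_of_ne_zero (hA : LeftOre A) (r : A) {s : A} (hs : s ≠ 0) :
    ∃ c d : A, c ≠ 0 ∧ c * r = d * s := by
  by_cases hr : r = 0
  · exact ⟨1, 0, one_ne_zero, by simp [hr]⟩
  · obtain ⟨c, d, h, h0⟩ := hA r s hr hs
    exact ⟨c, d, left_ne_zero_of_mul h0, h⟩

/-- The left Ore condition in the form used by Mathlib. -/
@[reducible] def LeftOre.oreSet (hA : LeftOre A) : OreLocalization.OreSet (nonZeroDivisors A) where
  ore_right_cancel r₁ r₂ s h := ⟨1, by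
    rw [mul_cancel_right_mem_nonZeroDivisors s.2] at h
    rw [h]⟩
  oreNum r s := (hA.exists_of_ne_zero r (nonZeroDivisors.ne_zero s.2)).choose_spec.choose
  oreDenom r s := ⟨(hA.exists_of_ne_zero r (nonZeroDivisors.ne_zero s.2)).choose,
    mem_nonZeroDivisors_of_ne_zero
      (hA.exists_of_ne_zero r (nonZeroDivisors.ne_zero s.2)).choose_spec.choose_spec.1⟩
  ore_eq r s := (hA.exists_of_ne_zero r (nonZeroDivisors.ne_zero s.2)).choose_spec.choose_spec.2

/-- The Ore localization contains `A` and makes its nonzero elements invertible. The universal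
algebra maps to it, so nothing in `A` can collapse. -/
lemma of_injective (hA : LeftOre A) : Function.Injective (SkewFrac.of : A → SkewFrac A) := by
  let _ := hA.oreSet
  let N := OreLocalization.numeratorHom (R := A) (S := nonZeroDivisors A)
  have hN : Function.Injective N := OreLocalization.numeratorHom_inj inf_le_left
  let g : A →ₐ[ℂ] OreLocalization (nonZeroDivisors A) A :=
    { toFun := N
      map_one' := map_one N
      map_mul' := map_mul N
      map_zero' := OreLocalization.zero_oreDiv 1
      map_add' := fun a b => (OreLocalization.add_oreDiv (r := a) (r' := b) (s := 1)).symm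
      commutes' := fun c => rfl }
  have hg : ∀ a, a ≠ 0 → IsUnit (g a) := fun a ha => by
    refine IsUnit.mk0 _ fun h => ha (hN ?_)
    rw [show N a = 0 from h]
    exact (map_zero g).symm
  intro a b hab
  apply hN
  have := congrArg (lift g hg) hab
  rwa [lift_of, lift_of] at this

/-- Left fractions `s⁻¹ a` include the formal inverses, and the Ore condition supplies common
denominators for sums and moves denominators to the left in products. -/
lemma exists_fraction (hA : LeftOre A) (x : SkewFrac A) :
    ∃ (s a : A), s ≠ 0 ∧ SkewFrac.of s * x = SkewFrac.of a := by
  have om : ∀ a b : A, SkewFrac.of (a * b) = SkewFrac.of a * SkewFrac.of b := map_mul (ofHom A)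
  have oa : ∀ a b : A, SkewFrac.of (a + b) = SkewFrac.of a + SkewFrac.of b := map_add (ofHom A)
  have o1 : SkewFrac.of (1 : A) = 1 := map_one (ofHom A)
  induction x using SkewFrac.induction with
  | hof a => exact ⟨1, a, one_ne_zero, by rw [o1, one_mul]⟩
  | hinv a ha _ => exact ⟨a, 1, ha, by rw [o1, of_mul_inv]⟩
  | hmul x y hx hy =>
    obtain ⟨s, a, hs, h1⟩ := hx
    obtain ⟨u, b, hu, h2⟩ := hy
    obtain ⟨c, d, hc, hcd⟩ := hA.exists_of_ne_zero a hu
    refine ⟨c * s, d * b, mul_ne_zero hc hs, ?_⟩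
    rw [om, om, ← h2, mul_assoc, ← mul_assoc (SkewFrac.of s), h1, ← mul_assoc,
      ← om, hcd, om, mul_assoc]
  | hadd x y hx hy =>
    obtain ⟨s, a, hs, h1⟩ := hx
    obtain ⟨u, b, hu, h2⟩ := hy
    obtain ⟨c, d, hc, hcd⟩ := hA.exists_of_ne_zero s hu
    refine ⟨c * s, c * a + d * b, mul_ne_zero hc hs, ?_⟩
    rw [mul_add, oa, om c s, mul_assoc, h1, om c a, ← om c s, hcd, om, mul_assoc, h2, om]

lemma isUnit_of_ne_zero (hA : LeftOre A) {x : SkewFrac A} (hx : x ≠ 0) : IsUnit x := by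
  obtain ⟨s, a, hs, h⟩ := exists_fraction hA x
  have ha : a ≠ 0 := by
    rintro rfl
    apply hx
    have h0 : SkewFrac.of (0 : A) = 0 := map_zero (ofHom A)
    rw [h0] at h
    exact (isUnit_of s hs).mul_right_eq_zero.mp h
  have := isUnit_of a ha
  rw [← h] at this
  exact (isUnit_of s hs).unit.isUnit_units_mul x |>.mp this

end Ore

end SkewFrac
end QPainleve
end

noncomputable section
namespace QPainleve

/-! ### Leading forms and the Weyl representation -/

open MvPolynomial

/-! ### Polynomials of bounded weight. -/

section LowDeg

variable {ι : Type}

/-- The polynomials all of whose monomials have weight less than `d`. -/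
def lowDeg (w : ι → ℕ) (d : ℕ) : Submodule ℂ (MvPolynomial ι ℂ) :=
  restrictSupport ℂ {n | Finsupp.weight w n < d}

lemma mem_lowDeg {w : ι → ℕ} {d : ℕ} {p : MvPolynomial ι ℂ} :
    p ∈ lowDeg w d ↔ ∀ n ∈ p.support, Finsupp.weight w n < d := Iff.rfl

lemma lowDeg_mono (w : ι → ℕ) {d e : ℕ} (h : d ≤ e) : lowDeg w d ≤ lowDeg w e :=
  restrictSupport_mono _ fun _ hn => lt_of_lt_of_le hn h

lemma lowDeg_zero (w : ι → ℕ) {p : MvPolynomial ι ℂ} (hp : p ∈ lowDeg w 0) : p = 0 := by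
  rw [mem_lowDeg] at hp
  rw [← support_eq_empty, Finset.eq_empty_iff_forall_notMem]
  exact fun n hn => absurd (hp n hn) (Nat.not_lt_zero _)

/-- The bounds are strict, hence the `d + 1`: a weight at most `d` plus a weight less than `e` is
less than `d + e`. -/
lemma mul_mem_lowDeg {w : ι → ℕ} {d e : ℕ} {p q : MvPolynomial ι ℂ}
    (hp : p ∈ lowDeg w (d + 1)) (hq : q ∈ lowDeg w e) : p * q ∈ lowDeg w (d + e) := by
  classical
  rw [mem_lowDeg] at *
  intro n hn
  obtain ⟨a, ha, b, hb, rfl⟩ := Finset.mem_add.mp (support_mul p q hn)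
  rw [map_add]
  have := hp a ha
  have := hq b hb
  omega

lemma X_mem_lowDeg (w : ι → ℕ) (i : ι) : (X i : MvPolynomial ι ℂ) ∈ lowDeg w (w i + 1) := by
  rw [mem_lowDeg]
  intro n hn
  rw [support_X, Finset.mem_singleton] at hn
  rw [hn, Finsupp.weight_single]
  simp

lemma C_mem_lowDeg (w : ι → ℕ) (c : ℂ) : (C c : MvPolynomial ι ℂ) ∈ lowDeg w 1 := by
  classical
  rw [mem_lowDeg]
  intro n hn
  rw [mem_support_iff, coeff_C] at hn
  have : n = 0 := by
    by_contra h
    exact hn (if_neg fun h' => h h'.symm)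
  simp [this]

lemma exists_mem_lowDeg (w : ι → ℕ) (p : MvPolynomial ι ℂ) : ∃ d, p ∈ lowDeg w d := by
  refine ⟨p.support.sup (fun n => Finsupp.weight w n) + 1, mem_lowDeg.mpr fun n hn => ?_⟩
  exact Nat.lt_succ_of_le (Finset.le_sup (f := fun n => Finsupp.weight w n) hn)

lemma mem_lowDeg_one_iff {d : ℕ} {p : MvPolynomial ι ℂ} :
    p ∈ lowDeg (1 : ι → ℕ) (d + 1) ↔ p.totalDegree ≤ d := by
  rw [← mem_restrictTotalDegree, mem_lowDeg, restrictTotalDegree, mem_restrictSupport_iff]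
  refine forall₂_congr fun n _ => ?_
  have : Finsupp.weight (1 : ι → ℕ) n = n.degree := by
    rw [Finsupp.degree_eq_weight_one]; rfl
  rw [this, Nat.lt_succ_iff]
  rfl

lemma totalDegree_lt_of_mem_lowDeg {d : ℕ} {p : MvPolynomial ι ℂ} (hp : p ∈ lowDeg (1 : ι → ℕ) d)
    (h0 : p ≠ 0) : p.totalDegree < d := by
  cases d with
  | zero => exact absurd (lowDeg_zero _ hp) h0
  | succ d => exact Nat.lt_succ_of_le (mem_lowDeg_one_iff.mp hp)

end LowDeg

/-! ### Left and right multiplication operators on symmetric symbols. -/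

section Operators

variable {ι : Type} (ω : ι → ι → ℂ) (z : ι)

/-- The constant coefficient derivation `∑ k, ω i k ∂ k`. -/
def diffOp (i : ι) : Derivation ℂ (MvPolynomial ι ℂ) (MvPolynomial ι ℂ) :=
  mkDerivation ℂ fun k => C (ω i k)

/-- The operator `X i + (1/2) X z ∑ k, ω i k ∂ k`. -/
def weylOp (i : ι) : Module.End ℂ (MvPolynomial ι ℂ) :=
  LinearMap.mulLeft ℂ (X i) + LinearMap.mulLeft ℂ (C (1 / 2) * X z) ∘ₗ (diffOp ω i : _ →ₗ[ℂ] _)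

/-- The operator `X i - (1/2) X z ∑ k, ω i k ∂ k`. -/
def weylOpRight (i : ι) : Module.End ℂ (MvPolynomial ι ℂ) :=
  LinearMap.mulLeft ℂ (X i) - LinearMap.mulLeft ℂ (C (1 / 2) * X z) ∘ₗ (diffOp ω i : _ →ₗ[ℂ] _)

variable {ω z}

@[simp] lemma diffOp_X (i k : ι) : diffOp ω i (X k) = C (ω i k) := mkDerivation_X ..

lemma weylOp_apply (i : ι) (p : MvPolynomial ι ℂ) :
    weylOp ω z i p = X i * p + C (1 / 2) * X z * diffOp ω i p := rfl

lemma weylOpRight_apply (i : ι) (p : MvPolynomial ι ℂ) :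
    weylOpRight ω z i p = X i * p - C (1 / 2) * X z * diffOp ω i p := rfl

lemma diffOp_comm (i j : ι) (p : MvPolynomial ι ℂ) :
    diffOp ω i (diffOp ω j p) = diffOp ω j (diffOp ω i p) := by
  have : ⁅diffOp ω i, diffOp ω j⁆ = 0 := derivation_ext fun k => by
    simp [Derivation.commutator_apply]
  have := congrArg (fun D => D p) this
  simpa [Derivation.commutator_apply, sub_eq_zero] using this

/-- Only the cross terms, where a derivation hits a variable, survive. Antisymmetry makes the two
halves add up. The variable `X z` is killed by every derivation, and its own operator is plain
multiplication. -/
lemma weylOp_commutator (hω : ∀ i j, ω i j = - ω j i) (hz : ∀ i, ω i z = 0) (i j : ι) :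
    weylOp ω z i * weylOp ω z j - weylOp ω z j * weylOp ω z i = ω i j • weylOp ω z z := by
  have hz' : diffOp ω z = 0 := derivation_ext fun k => by
    rw [diffOp_X, hω, hz]; simp
  refine LinearMap.ext fun p => ?_
  simp only [LinearMap.sub_apply, Module.End.mul_apply, LinearMap.smul_apply, weylOp_apply, map_add,
    Derivation.leibniz, diffOp_X, hz, smul_eq_mul, hz', diffOp_comm i j, smul_eq_C_mul,
    Derivation.coe_zero, Pi.zero_apply, derivation_C, C_0]
  have h2 : C (1 / 2) + C (1 / 2) = (1 : MvPolynomial ι ℂ) := by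
    rw [← C_add, ← C_1]; norm_num
  rw [hω j i, C_neg]
  linear_combination (C (ω i j) * X z * p) * h2

/-- With opposite signs in front of the derivations, both orders produce the same cross term. The
right operators will represent multiplication from the right. -/
lemma weylOp_weylOpRight (hω : ∀ i j, ω i j = - ω j i) (hz : ∀ i, ω i z = 0) (i j : ι) :
    weylOp ω z i * weylOpRight ω z j = weylOpRight ω z j * weylOp ω z i := by
  refine LinearMap.ext fun p => ?_
  simp only [Module.End.mul_apply, weylOp_apply, weylOpRight_apply, map_add, map_sub,
    Derivation.leibniz, diffOp_X, hz, smul_eq_mul, diffOp_comm i j, derivation_C, C_0]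
  rw [hω j i, C_neg]
  ring

/-- Variables of weight zero are allowed, provided that no derivation acts on them. Giving `z`
weight zero is what makes commutators lower the weight. -/
lemma diffOp_mem_lowDeg {w : ι → ℕ} (hw : ∀ i k, ω i k ≠ 0 → 1 ≤ w k) (i : ι) {d : ℕ}
    {p : MvPolynomial ι ℂ} (hp : p ∈ lowDeg w (d + 1)) : diffOp ω i p ∈ lowDeg w d := by
  rw [mem_lowDeg] at hp
  rw [p.as_sum, map_sum]
  refine Submodule.sum_mem _ fun n hn => ?_
  rw [diffOp, mkDerivation_monomial]
  refine Submodule.smul_mem _ _ (Submodule.sum_mem _ fun k hk => ?_)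
  by_cases h : ω i k = 0
  · simp [h]
  · beta_reduce
    rw [smul_eq_mul, mul_comm, ← smul_eq_C_mul]
    refine Submodule.smul_mem _ _ ?_
    rw [lowDeg, monomial_mem_restrictSupport]
    left
    have hk1 : 1 ≤ n k := Nat.one_le_iff_ne_zero.mpr (Finsupp.mem_support_iff.mp hk)
    have hn' : n = (n - Finsupp.single k 1) + Finsupp.single k 1 :=
      (tsub_add_cancel_of_le (by simpa using hk1)).symm
    have h1 := hp n hn
    rw [hn', map_add, Finsupp.weight_single] at h1
    have := hw i k h
    simp only [smul_eq_mul, one_mul] at h1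
    change Finsupp.weight w (n - Finsupp.single k 1) < d
    omega

/-- Differentiation loses one degree and the factor `X z` restores it, so the correction stays below
the degree of `X i * p`. -/
lemma weylOp_sub_mem_lowDeg (i : ι) {d : ℕ} {p : MvPolynomial ι ℂ}
    (hp : p ∈ lowDeg (1 : ι → ℕ) d) : weylOp ω z i p - X i * p ∈ lowDeg (1 : ι → ℕ) d := by
  rw [weylOp_apply, add_sub_cancel_left, mul_assoc]
  cases d with
  | zero => rw [lowDeg_zero _ hp]; simp
  | succ d =>
    have h1 : diffOp ω i p ∈ lowDeg (1 : ι → ℕ) d :=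
      diffOp_mem_lowDeg (fun _ _ _ => le_rfl) i hp
    have h2 := mul_mem_lowDeg (X_mem_lowDeg 1 z) h1
    have h3 := mul_mem_lowDeg (d := 0) (C_mem_lowDeg 1 (1 / 2)) h2
    rwa [Pi.one_apply, zero_add, add_comm] at h3

end Operators

/-- The dimension of the space of polynomials of total degree at most `d` grows polynomially. -/
lemma finrank_restrictTotalDegree_le (ι : Type) [Fintype ι] [DecidableEq ι] (d : ℕ) :
    Module.finrank ℂ (restrictTotalDegree ι ℂ d) ≤ (d + 1) ^ Fintype.card ι := by
  let L : restrictTotalDegree ι ℂ d →ₗ[ℂ] ((ι → Fin (d + 1)) → ℂ) :=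
    { toFun := fun p n => coeff (Finsupp.equivFunOnFinite.symm fun i => (n i : ℕ)) p.1
      map_add' := fun p q => by ext; simp
      map_smul' := fun c p => by ext; simp }
  have hL : Function.Injective L := by
    rw [← LinearMap.ker_eq_bot, LinearMap.ker_eq_bot']
    rintro ⟨p, hp⟩ h
    refine Subtype.ext (MvPolynomial.ext _ _ fun n => ?_)
    rw [ZeroMemClass.coe_zero, coeff_zero]
    by_contra hn
    have hb := (mem_restrictDegree _ _ _).mp (restrictTotalDegree_le_restrictDegree _ _ _ hp) n
      (mem_support_iff.mpr hn)
    have := congrFun h fun i => ⟨n i, Nat.lt_succ_of_le (hb i)⟩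
    have e : (Finsupp.equivFunOnFinite.symm fun i => n i) = n := by ext; simp
    rw [← e] at hn
    exact hn this
  have := LinearMap.finrank_le_finrank_of_injective hL
  simpa using this

end QPainleve
end

noncomputable section
namespace QPainleve

/-! ### Algebras presented by Weyl relations -/

open MvPolynomial

/-- A presentation of the `ℂ`-algebra `A` by generators `y i` with `y i * y j - y j * y i = ω i j y z`,
together with its representation on polynomials by symmetrically ordered left multiplication. -/
structure WeylPresentation (A : Type) [Ring A] [Algebra ℂ A] {ι : Type} (ω : ι → ι → ℂ) (z : ι) where
  y : ι → A
  adjoin_eq_top : Algebra.adjoin ℂ (Set.range y) = ⊤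
  comm : ∀ i j, y i * y j - y j * y i = ω i j • y z
  antisymm : ∀ i j, ω i j = - ω j i
  central : ∀ i, ω i z = 0
  ρ : A →ₐ[ℂ] Module.End ℂ (MvPolynomial ι ℂ)
  ρ_y : ∀ i, ρ (y i) = weylOp ω z i

namespace WeylPresentation

variable {A : Type} [Ring A] [Algebra ℂ A] {ι : Type} {ω : ι → ι → ℂ} {z : ι}
  (H : WeylPresentation A ω z)

/-- The symbol of an element. -/
def ev : A →ₗ[ℂ] MvPolynomial ι ℂ :=
  (LinearMap.applyₗ (1 : MvPolynomial ι ℂ)) ∘ₗ H.ρ.toLinearMap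

lemma ev_apply (a : A) : H.ev a = H.ρ a 1 := rfl

lemma ev_mul (a b : A) : H.ev (a * b) = H.ρ a (H.ev b) := by
  rw [ev_apply, map_mul]; rfl

/-- The product of a list of generators. -/
def word (L : List ι) : A := (L.map H.y).prod

lemma word_cons (i : ι) (L : List ι) : H.word (i :: L) = H.y i * H.word L := by
  simp [word]

/-- The span of the words of length less than `d`. -/
def shortWords (d : ℕ) : Submodule ℂ A := Submodule.span ℂ (H.word '' {L | L.length < d})

lemma word_mem_shortWords {d : ℕ} {L : List ι} (hL : L.length < d) : H.word L ∈ H.shortWords d :=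
  Submodule.subset_span ⟨L, hL, rfl⟩

lemma y_mul_mem_shortWords (i : ι) {d : ℕ} {a : A} (ha : a ∈ H.shortWords d) :
    H.y i * a ∈ H.shortWords (d + 1) := by
  induction ha using Submodule.span_induction with
  | mem x hx =>
    obtain ⟨L, hL, rfl⟩ := hx
    rw [← word_cons]
    exact H.word_mem_shortWords (Nat.succ_lt_succ hL)
  | zero => rw [mul_zero]; exact Submodule.zero_mem _
  | add a b _ _ ha hb => rw [mul_add]; exact Submodule.add_mem _ ha hb
  | smul c a _ ha => rw [mul_smul_comm]; exact Submodule.smul_mem _ c ha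

/-- Exchanging two neighbouring letters costs a multiple of `y z`, which replaces two letters by
one. -/
lemma word_perm {L M : List ι} (h : L.Perm M) : H.word L - H.word M ∈ H.shortWords L.length := by
  induction h with
  | nil => rw [sub_self]; exact Submodule.zero_mem _
  | cons i _ ih =>
    rw [word_cons, word_cons, ← mul_sub]
    exact H.y_mul_mem_shortWords i ih
  | swap i j L =>
    rw [word_cons, word_cons, word_cons, word_cons, ← mul_assoc, ← mul_assoc, ← sub_mul, H.comm,
      smul_mul_assoc, ← word_cons]
    exact Submodule.smul_mem _ _ (H.word_mem_shortWords (by simp))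
  | trans h1 _ ih1 ih2 =>
    rw [← h1.length_eq] at ih2
    have := Submodule.add_mem _ ih1 ih2
    rwa [sub_add_sub_cancel] at this

lemma span_words : Submodule.span ℂ (Set.range H.word) = ⊤ := by
  rw [eq_top_iff]
  intro a _
  have ha : a ∈ Algebra.adjoin ℂ (Set.range H.y) := by rw [H.adjoin_eq_top]; trivial
  rw [← Subalgebra.mem_toSubmodule, Algebra.adjoin_eq_span] at ha
  refine Submodule.span_mono ?_ ha
  intro x hx
  induction hx using Submonoid.closure_induction with
  | mem x hx =>
    obtain ⟨i, rfl⟩ := hx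
    exact ⟨[i], by simp [word]⟩
  | one => exact ⟨[], by simp [word]⟩
  | mul x y _ _ hx hy =>
    obtain ⟨L, rfl⟩ := hx
    obtain ⟨M, rfl⟩ := hy
    exact ⟨L ++ M, by simp [word]⟩

/-- The linear map sending a monomial to an ordered product of generators. -/
def quant : MvPolynomial ι ℂ →ₗ[ℂ] A :=
  (basisMonomials ι ℂ).constr ℂ fun n => H.word (Finsupp.toMultiset n).toList

lemma quant_monomial (n : ι →₀ ℕ) (c : ℂ) :
    H.quant (monomial n c) = c • H.word (Finsupp.toMultiset n).toList := by
  have : monomial n c = c • (basisMonomials ι ℂ n) := by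
    rw [coe_basisMonomials, smul_monomial, smul_eq_mul, mul_one]
  rw [this, map_smul, quant, Module.Basis.constr_basis]

lemma length_toList (n : ι →₀ ℕ) :
    (Finsupp.toMultiset n).toList.length = Finsupp.weight (1 : ι → ℕ) n := by
  rw [Multiset.length_toList, Finsupp.card_toMultiset, Finsupp.weight_apply]
  exact Finsupp.sum_congr fun _ _ => by simp

/-- Sorting a word changes it by shorter words, so strong induction on the length brings every word
to ordered form. -/
lemma word_mem_map_quant (L : List ι) :
    H.word L ∈ (lowDeg (1 : ι → ℕ) (L.length + 1)).map H.quant := by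
  classical
  induction hd : L.length using Nat.strong_induction_on generalizing L with
  | _ d ih =>
    have hle : H.shortWords d ≤ (lowDeg (1 : ι → ℕ) (d + 1)).map H.quant := by
      rw [shortWords, Submodule.span_le]
      rintro _ ⟨M, hM, rfl⟩
      exact Submodule.map_mono (lowDeg_mono _ (Nat.succ_le_succ hM.le)) (ih _ hM M rfl)
    let n := Multiset.toFinsupp (L : Multiset ι)
    have hn : Finsupp.toMultiset n = (L : Multiset ι) := Multiset.toFinsupp_toMultiset _
    have hperm : (Finsupp.toMultiset n).toList.Perm L := by
      rw [← Multiset.coe_eq_coe, Multiset.coe_toList, hn]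
    have hp := H.word_perm hperm
    rw [hperm.length_eq, hd] at hp
    have hmem : H.word (Finsupp.toMultiset n).toList ∈
        (lowDeg (1 : ι → ℕ) (d + 1)).map H.quant := by
      refine ⟨monomial n 1, ?_, by rw [quant_monomial, one_smul]⟩
      refine (monomial_mem_restrictSupport ℂ).mpr (Or.inl ?_)
      change Finsupp.weight (1 : ι → ℕ) n < d + 1
      rw [← length_toList, hperm.length_eq, hd]
      exact Nat.lt_succ_self d
    have := Submodule.sub_mem _ hmem (hle hp)
    rwa [sub_sub_cancel] at this

lemma quant_surjective : Function.Surjective H.quant := by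
  rw [← LinearMap.range_eq_top, eq_top_iff, ← H.span_words, Submodule.span_le]
  rintro _ ⟨L, rfl⟩
  obtain ⟨p, -, hp⟩ := H.word_mem_map_quant L
  exact ⟨p, hp⟩

/-- Each letter acts as multiplication by its variable up to terms that do not raise the degree, so
the leading form of a word is the product of its variables. -/
lemma ρ_word_sub_mem (L : List ι) {k : ℕ} {p : MvPolynomial ι ℂ}
    (hp : p ∈ lowDeg (1 : ι → ℕ) (k + 1)) :
    H.ρ (H.word L) p - (L.map X).prod * p ∈ lowDeg (1 : ι → ℕ) (L.length + k) := by
  induction L with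
  | nil => simp [word]
  | cons i L ih =>
    have hprod : (L.map X).prod ∈ lowDeg (1 : ι → ℕ) (L.length + 1) := by
      rw [mem_lowDeg_one_iff]
      refine (totalDegree_list_prod _).trans ?_
      simp [Function.comp_def]
    have hq : H.ρ (H.word L) p ∈ lowDeg (1 : ι → ℕ) (L.length + k + 1) := by
      have h1 := mul_mem_lowDeg hprod hp
      rw [← add_assoc] at h1
      have := Submodule.add_mem _ (lowDeg_mono _ (Nat.le_succ _) ih) h1
      rwa [sub_add_cancel] at this
    rw [word_cons, map_mul, Module.End.mul_apply, H.ρ_y]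
    have h1 := weylOp_sub_mem_lowDeg (ω := ω) (z := z) i hq
    have h2 := mul_mem_lowDeg (X_mem_lowDeg 1 i) ih
    rw [Pi.one_apply, add_comm] at h2
    have := Submodule.add_mem _ h1 h2
    rw [mul_sub, ← mul_assoc, sub_add_sub_cancel] at this
    rw [List.map_cons, List.prod_cons, List.length_cons, add_right_comm]
    exact this

lemma ρ_quant_sub_mem {m k : ℕ} {q p : MvPolynomial ι ℂ} (hq : q ∈ lowDeg (1 : ι → ℕ) (m + 1))
    (hp : p ∈ lowDeg (1 : ι → ℕ) (k + 1)) :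
    H.ρ (H.quant q) p - q * p ∈ lowDeg (1 : ι → ℕ) (m + k) := by
  have key : ∀ n ∈ q.support, H.ρ (H.quant (monomial n (coeff n q))) p -
      monomial n (coeff n q) * p ∈ lowDeg (1 : ι → ℕ) (m + k) := by
    intro n hn
    have h1 := H.ρ_word_sub_mem (Finsupp.toMultiset n).toList hp
    have h2 : ((Finsupp.toMultiset n).toList.map X).prod = monomial n (1 : ℂ) := by
      rw [← Multiset.prod_coe, ← Multiset.map_coe, Multiset.coe_toList, Finsupp.toMultiset_map,
        Finsupp.prod_toMultiset, monomial_eq, C_1, one_mul,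
        Finsupp.prod_mapDomain_index (fun _ => pow_zero _) (fun _ _ _ => pow_add _ _ _)]
    rw [h2, length_toList] at h1
    have h3 := Submodule.smul_mem _ (coeff n q) (lowDeg_mono _
      (Nat.add_le_add_right (Nat.lt_succ_iff.mp (mem_lowDeg.mp hq n hn)) k) h1)
    rw [smul_sub, ← smul_mul_assoc, smul_monomial, smul_eq_mul, mul_one] at h3
    rwa [quant_monomial, map_smul, LinearMap.smul_apply]
  have := Submodule.sum_mem _ key
  rwa [Finset.sum_sub_distrib, ← Finset.sum_mul, ← q.as_sum, ← LinearMap.sum_apply, ← map_sum,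
    ← map_sum, ← q.as_sum] at this

lemma ev_quant_sub_mem {m : ℕ} {q : MvPolynomial ι ℂ} (hq : q ∈ lowDeg (1 : ι → ℕ) (m + 1)) :
    H.ev (H.quant q) - q ∈ lowDeg (1 : ι → ℕ) m := by
  have h := H.ρ_quant_sub_mem (k := 0) (p := 1) hq (C_mem_lowDeg 1 1)
  rwa [mul_one] at h

/-- Since `ev ∘ quant` preserves the leading form, no cancellation can make the symbol smaller than
`q`. -/
lemma quant_symbol {m : ℕ} {q : MvPolynomial ι ℂ}
    (hq : H.ev (H.quant q) ∈ lowDeg (1 : ι → ℕ) (m + 1)) : q ∈ lowDeg (1 : ι → ℕ) (m + 1) := by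
  rw [mem_lowDeg_one_iff]
  by_contra! hlt
  have h1 := H.ev_quant_sub_mem (mem_lowDeg_one_iff.mpr (le_refl q.totalDegree))
  have h2 := Submodule.sub_mem _ (lowDeg_mono _ hlt hq) h1
  rw [sub_sub_cancel] at h2
  have h0 : q ≠ 0 := by rintro rfl; simp at hlt
  exact lt_irrefl _ (totalDegree_lt_of_mem_lowDeg h2 h0)

/-- This is the Poincaré–Birkhoff–Witt statement. If the symbol of `quant q` vanishes then `q` is
constant, and for a constant the error `ev (quant q) - q` is already zero. -/
lemma ev_injective : Function.Injective H.ev := by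
  rw [← LinearMap.ker_eq_bot, LinearMap.ker_eq_bot']
  intro a ha
  obtain ⟨q, rfl⟩ := H.quant_surjective a
  have h1 : q ∈ lowDeg (1 : ι → ℕ) (0 + 1) := H.quant_symbol (by
    rw [ha]; exact Submodule.zero_mem _)
  have h2 := lowDeg_zero _ (H.ev_quant_sub_mem h1)
  rw [ha, zero_sub, neg_eq_zero] at h2
  rw [h2, map_zero]

/-- The associated graded product is the commutative one. Both the domain property and the
multiplicativity of the filtration rest on this. -/
lemma ev_mul_sub_mem {m k : ℕ} {a b : A} (ha : H.ev a ∈ lowDeg (1 : ι → ℕ) (m + 1))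
    (hb : H.ev b ∈ lowDeg (1 : ι → ℕ) (k + 1)) :
    H.ev (a * b) - H.ev a * H.ev b ∈ lowDeg (1 : ι → ℕ) (m + k) := by
  obtain ⟨q, rfl⟩ := H.quant_surjective a
  have hq := H.quant_symbol ha
  have h1 := H.ρ_quant_sub_mem hq hb
  have h2 : (H.ev (H.quant q) - q) * H.ev b ∈ lowDeg (1 : ι → ℕ) (m + k) := by
    rw [mul_comm, add_comm]
    exact mul_mem_lowDeg hb (H.ev_quant_sub_mem hq)
  have := Submodule.sub_mem _ h1 h2
  rw [ev_mul]
  convert this using 1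
  ring

lemma ev_mul_mem {m k : ℕ} {a b : A} (ha : H.ev a ∈ lowDeg (1 : ι → ℕ) (m + 1))
    (hb : H.ev b ∈ lowDeg (1 : ι → ℕ) (k + 1)) :
    H.ev (a * b) ∈ lowDeg (1 : ι → ℕ) (m + k + 1) := by
  have := Submodule.add_mem _ (lowDeg_mono _ (Nat.le_succ _) (H.ev_mul_sub_mem ha hb))
    (mul_mem_lowDeg ha hb)
  rwa [sub_add_cancel] at this

include H in
lemma isDomain : IsDomain A := by
  have hnt : Nontrivial A := by
    by_contra h
    rw [not_nontrivial_iff_subsingleton] at h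
    have : (H.ρ 1) 1 = (1 : MvPolynomial ι ℂ) := by rw [map_one H.ρ]; rfl
    rw [Subsingleton.elim (1 : A) 0, map_zero] at this
    exact zero_ne_one this
  have : NoZeroDivisors A := ⟨fun {a b} hab => by
    by_contra! hne
    have ha : H.ev a ≠ 0 := fun h => hne.1 (H.ev_injective (h.trans (map_zero _).symm))
    have hb : H.ev b ≠ 0 := fun h => hne.2 (H.ev_injective (h.trans (map_zero _).symm))
    -- If `a * b = 0`, the product of the symbols equals its own error term and has degree less than
    -- itself.
    have h := H.ev_mul_sub_mem (mem_lowDeg_one_iff.mpr (le_refl (H.ev a).totalDegree))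
      (mem_lowDeg_one_iff.mpr (le_refl (H.ev b).totalDegree))
    rw [hab, map_zero, zero_sub, Submodule.neg_mem_iff] at h
    have := totalDegree_lt_of_mem_lowDeg h (mul_ne_zero ha hb)
    rw [totalDegree_mul_of_isDomain ha hb] at this
    exact lt_irrefl _ this⟩
  exact NoZeroDivisors.to_isDomain A

end WeylPresentation
end QPainleve
end

noncomputable section
namespace QPainleve

/-! ### Growth and the Ore condition -/

open MvPolynomial

/-- An exponential lower bound contradicts a polynomial upper bound. -/
lemma not_exponential_growth (N d : ℕ) : ¬ ∀ k : ℕ, 2 ^ k ≤ (k * d + 1) ^ N := by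
  intro h
  have h1 : (fun k : ℕ => ((k : ℝ) ^ N)) =o[Filter.atTop] fun k : ℕ => (2 : ℝ) ^ k :=
    isLittleO_pow_const_const_pow_of_one_lt N one_lt_two
  have hpos : (0 : ℝ) < 1 / (2 * ((d : ℝ) + 1) ^ N) := by positivity
  obtain ⟨k, hk, hk1⟩ := ((h1.def hpos).and (Filter.eventually_ge_atTop 1)).exists
  rw [Real.norm_of_nonneg (by positivity), Real.norm_of_nonneg (by positivity)] at hk
  have h2 : ((2 : ℝ) ^ k) ≤ ((k : ℝ) * d + 1) ^ N := by exact_mod_cast h k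
  have h3 : ((k : ℝ) * d + 1) ^ N ≤ ((k : ℝ) * (d + 1)) ^ N := by
    gcongr
    have : (1 : ℝ) ≤ k := by exact_mod_cast hk1
    nlinarith
  rw [mul_pow] at h3
  have h4 : (k : ℝ) ^ N * ((d : ℝ) + 1) ^ N ≤ (1 / 2) * 2 ^ k := by
    calc (k : ℝ) ^ N * ((d : ℝ) + 1) ^ N
        ≤ (1 / (2 * ((d : ℝ) + 1) ^ N) * 2 ^ k) * ((d : ℝ) + 1) ^ N := by gcongr
      _ = (1 / 2) * 2 ^ k := by field_simp
  have : (0 : ℝ) < 2 ^ k := by positivity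
  linarith

namespace WeylPresentation

variable {A : Type} [Ring A] [Algebra ℂ A] {ι : Type} {ω : ι → ι → ℂ} {z : ι}
  (H : WeylPresentation A ω z)

/-- The elements whose symbol has total degree at most `d`. -/
def filtration (d : ℕ) : Submodule ℂ A := (restrictTotalDegree ι ℂ d).comap H.ev

lemma mem_filtration {d : ℕ} {a : A} :
    a ∈ H.filtration d ↔ H.ev a ∈ lowDeg (1 : ι → ℕ) (d + 1) := by
  rw [mem_lowDeg_one_iff, filtration, Submodule.mem_comap, mem_restrictTotalDegree]

/-- The symbol map on a step of the filtration. -/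
def evRestrict (d : ℕ) : H.filtration d →ₗ[ℂ] restrictTotalDegree ι ℂ d :=
  H.ev.restrict fun _ ha => ha

lemma evRestrict_injective (d : ℕ) : Function.Injective (H.evRestrict d) := fun _ _ hab =>
  Subtype.ext (H.ev_injective (congrArg Subtype.val hab))

variable [Fintype ι]

lemma finite_filtration (d : ℕ) : Module.Finite ℂ (H.filtration d) :=
  Module.Finite.of_injective _ (H.evRestrict_injective d)

lemma finrank_filtration_le (d : ℕ) :
    Module.finrank ℂ (H.filtration d) ≤ (d + 1) ^ Fintype.card ι := by
  classical
  exact (LinearMap.finrank_le_finrank_of_injective (H.evRestrict_injective d)).trans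
    (finrank_restrictTotalDegree_le ι d)

include H in
/-- An algebra with a Weyl presentation is an Ore domain, by polynomial growth. -/
lemma leftOre : SkewFrac.LeftOre A := by
  have hdom := H.isDomain
  intro a b ha hb
  by_contra! hab
  obtain ⟨d, had, hbd⟩ : ∃ d, a ∈ H.filtration d ∧ b ∈ H.filtration d := by
    refine ⟨max (H.ev a).totalDegree (H.ev b).totalDegree, ?_, ?_⟩ <;>
    rw [mem_filtration, mem_lowDeg_one_iff]
    exacts [le_max_left _ _, le_max_right _ _]
  -- If `A a` and `A b` meet only in zero, then `(c, e) ↦ c a - e b` is injective, and the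
  -- filtration at least doubles in dimension every `d` steps.
  have step : ∀ m, 2 * Module.finrank ℂ (H.filtration m) ≤
      Module.finrank ℂ (H.filtration (m + d)) := by
    intro m
    have := H.finite_filtration m
    have := H.finite_filtration (m + d)
    have hmul : ∀ x ∈ H.filtration d, ∀ c ∈ H.filtration m, c * x ∈ H.filtration (m + d) := by
      intro x hx c hc
      rw [mem_filtration] at *
      exact H.ev_mul_mem hc hx
    let L : (H.filtration m × H.filtration m) →ₗ[ℂ] H.filtration (m + d) :=
      { toFun := fun c => ⟨c.1 * a - c.2 * b,
          Submodule.sub_mem _ (hmul a had _ c.1.2) (hmul b hbd _ c.2.2)⟩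
        map_add' := fun c e => Subtype.ext (by simp; noncomm_ring)
        map_smul' := fun r c => Subtype.ext (by simp [smul_sub]) }
    have hL : Function.Injective L := by
      rw [← LinearMap.ker_eq_bot, LinearMap.ker_eq_bot']
      rintro ⟨⟨c, hc⟩, ⟨e, he⟩⟩ h
      have h1 : c * a = e * b := sub_eq_zero.mp (congrArg Subtype.val h)
      have h2 := hab c e h1
      have h3 : c = 0 := (mul_eq_zero.mp h2).resolve_right ha
      have h4 : e = 0 := (mul_eq_zero.mp (h1.symm.trans h2)).resolve_right hb
      subst h3 h4
      rfl
    have := LinearMap.finrank_le_finrank_of_injective hL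
    rwa [Module.finrank_prod, ← two_mul] at this
  have grow : ∀ k, 2 ^ k ≤ Module.finrank ℂ (H.filtration (k * d)) := by
    intro k
    induction k with
    | zero =>
      have := H.finite_filtration (0 * d)
      have h1 : (1 : A) ∈ H.filtration (0 * d) := by
        rw [mem_filtration]
        have : H.ev 1 = C 1 := by rw [ev_apply, map_one H.ρ]; rfl
        rw [this]
        exact lowDeg_mono _ (by omega) (C_mem_lowDeg 1 1)
      have : Nontrivial (H.filtration (0 * d)) :=
        ⟨⟨⟨1, h1⟩, 0, fun h => one_ne_zero (congrArg Subtype.val h)⟩⟩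
      exact Module.finrank_pos
    | succ k ih =>
      rw [pow_succ, mul_comm, add_mul, one_mul]
      exact (Nat.mul_le_mul_left 2 ih).trans (step _)
  exact not_exponential_growth (Fintype.card ι) d fun k => (grow k).trans (H.finrank_filtration_le _)

omit [Fintype ι]

/-- The right operator of `i` commutes with all of `ρ` and agrees with the left one at `1`, so it
computes the symbol of `a * y i`. The left and right operators differ by `X z * diffOp ω i`. -/
lemma ev_commutator (i : ι) (a : A) :
    H.ev (H.y i * a - a * H.y i) = X z * diffOp ω i (H.ev a) := by
  have hcomm : H.ρ a * weylOpRight ω z i = weylOpRight ω z i * H.ρ a := by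
    have ha : a ∈ Algebra.adjoin ℂ (Set.range H.y) := by rw [H.adjoin_eq_top]; trivial
    induction ha using Algebra.adjoin_induction with
    | mem x hx =>
      obtain ⟨j, rfl⟩ := hx
      rw [H.ρ_y]
      exact weylOp_weylOpRight H.antisymm H.central j i
    | algebraMap c => rw [AlgHom.commutes]; exact Algebra.commutes _ _
    | add x y _ _ hx hy => rw [map_add, add_mul, mul_add, hx, hy]
    | mul x y _ _ hx hy => rw [map_mul, mul_assoc, hy, ← mul_assoc, hx, mul_assoc]
  have h1 : H.ev (a * H.y i) = weylOpRight ω z i (H.ev a) := by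
    have h2 : H.ev (H.y i) = weylOpRight ω z i 1 := by
      rw [ev_apply, H.ρ_y, weylOp_apply, weylOpRight_apply]
      simp
    rw [ev_mul, h2, ← Module.End.mul_apply, hcomm, Module.End.mul_apply, ev_apply]
  rw [map_sub, h1, ev_mul, H.ρ_y, weylOp_apply, weylOpRight_apply]
  have h2 : C (1 / 2) + C (1 / 2) = (1 : MvPolynomial ι ℂ) := by
    rw [← C_add, ← C_1]; norm_num
  linear_combination (X z * diffOp ω i (H.ev a)) * h2

/-- A nonzero element of an ideal can be moved to a nonzero element of the ideal that commutes with
all generators. -/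
lemma exists_central_of_mem {B : Type*} [Ring B] [Algebra ℂ B] (g : A →ₐ[ℂ] B) {a : A} (ha : a ≠ 0)
    (hga : g a = 0) : ∃ b : A, b ≠ 0 ∧ g b = 0 ∧ ∀ i, diffOp ω i (H.ev b) = 0 := by
  classical
  -- With `z` of weight zero, the factor `X z` in a commutator does not give back the weight lost to
  -- differentiation, so the descent terminates.
  let w : ι → ℕ := fun i => if i = z then 0 else 1
  have hw : ∀ i k, ω i k ≠ 0 → 1 ≤ w k := fun i k h => by
    have : k ≠ z := fun h' => h (by rw [h']; exact H.central i)
    simp [w, this]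
  obtain ⟨d, hd⟩ := exists_mem_lowDeg w (H.ev a)
  induction d generalizing a with
  | zero => exact absurd (H.ev_injective ((lowDeg_zero _ hd).trans (map_zero _).symm)) ha
  | succ d ih =>
    by_cases h : ∀ i, diffOp ω i (H.ev a) = 0
    · exact ⟨a, ha, hga, h⟩
    · push Not at h
      obtain ⟨i, hi⟩ := h
      have hev := H.ev_commutator i a
      -- A commutator stays in the kernel, and it is nonzero because its symbol is `X z` times a
      -- nonzero polynomial.
      refine ih (a := H.y i * a - a * H.y i) ?_ ?_ ?_
      · intro h0
        rw [h0, map_zero] at hev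
        exact mul_ne_zero (X_ne_zero z) hi hev.symm
      · rw [map_sub, map_mul, map_mul, hga, mul_zero, zero_mul, sub_zero]
      · rw [hev]
        have h1 := mul_mem_lowDeg (X_mem_lowDeg w z) (diffOp_mem_lowDeg hw i hd)
        simpa [w] using h1

/-- A homomorphism that is injective on the central polynomial subalgebra is injective. -/
lemma injective_of_central [Fintype ι] {ζ : Type} {c : ζ → ι} (hc : Function.Injective c)
    (hω : ∀ j i, ω i (c j) = 0)
    (nondeg : ∀ v : ι → MvPolynomial ι ℂ, (∀ i, ∑ k, C (ω i k) * v k = 0) →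
      ∀ k, k ∉ Set.range c → v k = 0)
    {B : Type*} [Ring B] [Algebra ℂ B] (g : A →ₐ[ℂ] B) {R : Type*} [CommRing R] [Algebra ℂ R]
    (θ : R →ₐ[ℂ] B) (hθ : Function.Injective θ) (η : ζ → R)
    (hg : ∀ j, g (H.y (c j)) = θ (η j)) (hη : AlgebraicIndependent ℂ η) :
    Function.Injective g := by
  classical
  rw [injective_iff_map_eq_zero]
  intro a hga
  by_contra ha
  obtain ⟨b, hb, hgb, hD⟩ := H.exists_central_of_mem g ha hga
  have hexp : ∀ i p, ∑ k, C (ω i k) * pderiv k p = diffOp ω i p := by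
    intro i p
    have h : diffOp ω i = ∑ k, (C (ω i k) : MvPolynomial ι ℂ) • pderiv (R := ℂ) k := by
      refine derivation_ext fun j => ?_
      rw [diffOp_X, ← Derivation.coeFnAddMonoidHom_apply, map_sum, Finset.sum_apply,
        Finset.sum_eq_single j]
      · simp [Derivation.coeFnAddMonoidHom_apply]
      · intro k _ hkj
        simp [Derivation.coeFnAddMonoidHom_apply, pderiv_X_of_ne hkj.symm]
      · exact fun hj => absurd (Finset.mem_univ j) hj
    rw [h, ← Derivation.coeFnAddMonoidHom_apply, map_sum, Finset.sum_apply]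
    rfl
  -- The vanishing of all `diffOp` is a linear system for the partial derivatives. Nondegeneracy
  -- kills those in noncentral directions, so by characteristic zero the symbol involves central
  -- variables only.
  have hvars : ∀ k ∉ Set.range c, pderiv k (H.ev b) = 0 := nondeg (fun k => pderiv k (H.ev b))
    fun i => by rw [hexp, hD]
  obtain ⟨q, hq⟩ := exists_rename_eq_of_vars_subset_range (H.ev b) c hc (by
    intro k hk
    by_contra hkc
    have h0 := hvars k hkc
    rw [Finset.mem_coe, mem_vars_iff_mem_support] at hk
    obtain ⟨n, hn, hkn⟩ := hk
    have h1 := congrArg (coeff (n - Finsupp.single k 1)) h0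
    have hk1 : 1 ≤ n k := Nat.one_le_iff_ne_zero.mpr (Finsupp.mem_support_iff.mp hkn)
    rw [coeff_pderiv, tsub_add_cancel_of_le (by simpa using hk1), coeff_zero] at h1
    rcases mul_eq_zero.mp h1 with h | h
    · exact mem_support_iff.mp hn h
    · norm_cast at h)
  -- A polynomial in the central variables is the symbol of the same polynomial in the central
  -- generators, because these act by plain multiplication.
  have hlift : ∀ q : MvPolynomial ζ ℂ, ∃ e : A, H.ev e = rename c q ∧ g e = θ (aeval η q) := by
    intro q
    induction q using MvPolynomial.induction_on with
    | C r =>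
      refine ⟨algebraMap ℂ A r, ?_, ?_⟩
      · rw [ev_apply, AlgHom.commutes, rename_C, Module.algebraMap_end_apply, smul_eq_C_mul, mul_one]
      · rw [AlgHom.commutes, ← algebraMap_eq, AlgHom.commutes, AlgHom.commutes]
    | add p q hp hq =>
      obtain ⟨e, he, he'⟩ := hp
      obtain ⟨f, hf, hf'⟩ := hq
      exact ⟨e + f, by rw [map_add, map_add, he, hf], by rw [map_add, map_add, map_add, he', hf']⟩
    | mul_X p j hp =>
      obtain ⟨e, he, he'⟩ := hp
      refine ⟨H.y (c j) * e, ?_, ?_⟩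
      · have : diffOp ω (c j) = 0 := derivation_ext fun k => by
          rw [diffOp_X, H.antisymm, hω]; simp
        rw [ev_mul, H.ρ_y, weylOp_apply, he, this, map_mul, rename_X, mul_comm]
        simp
      · rw [map_mul, map_mul, map_mul, he', hg, aeval_X, ← map_mul, ← map_mul, mul_comm]
  obtain ⟨e, he, he'⟩ := hlift q
  have heb : e = b := H.ev_injective (he.trans hq)
  rw [heb, hgb] at he'
  have hq0 : q = 0 := hη ((hθ (he'.symm.trans (map_zero θ).symm)).trans (map_zero _).symm)
  apply hb
  apply H.ev_injective
  rw [← hq, hq0, map_zero, map_zero]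

/-- The symbol of a polynomial in central generators. -/
lemma algebraicIndependent_central {ζ : Type} {c : ζ → ι} (hc : Function.Injective c)
    (hω : ∀ j i, ω i (c j) = 0) {R : Type*} [CommRing R] [Algebra ℂ R] (θ : R →ₐ[ℂ] A)
    (η : ζ → R) (hη : ∀ j, θ (η j) = H.y (c j)) : AlgebraicIndependent ℂ η := by
  have key : ∀ q : MvPolynomial ζ ℂ, H.ev (θ (aeval η q)) = rename c q := by
    intro q
    induction q using MvPolynomial.induction_on with
    | C r =>
      rw [← algebraMap_eq, AlgHom.commutes, AlgHom.commutes, ev_apply, AlgHom.commutes,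
        algebraMap_eq, rename_C, Module.algebraMap_end_apply, smul_eq_C_mul, mul_one]
    | add p q hp hq => rw [map_add, map_add, map_add, map_add, hp, hq]
    | mul_X p j hp =>
      have : diffOp ω (c j) = 0 := derivation_ext fun k => by
        rw [diffOp_X, H.antisymm, hω]; simp
      rw [mul_comm, map_mul, map_mul, aeval_X, hη, ev_mul, H.ρ_y, weylOp_apply, hp, this, map_mul,
        rename_X]
      simp
  intro p q hpq
  exact rename_injective c hc (by rw [← key, ← key, hpq])

end WeylPresentation
end QPainleve
end

noncomputable section
namespace QPainleve

/-! ### Automorphisms of power series over a noncommutative ring -/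

section PowerSeriesExtension

open PowerSeries Finset.HasAntidiagonal

variable {A : Type*} [Ring A]

lemma isUnit_of_constantCoeff {f : PowerSeries A} (hf : IsUnit (constantCoeff f)) : IsUnit f :=
  ⟨⟨f, invOfUnit f hf.unit, mul_invOfUnit f hf.unit rfl, invOfUnit_mul f hf.unit rfl⟩, rfl⟩

lemma eq_C_add_X_mul (f : PowerSeries A) :
    f = C (constantCoeff f) + X * mk fun p => coeff (p + 1) f := by
  rw [add_comm, ← eq_X_mul_shift_add_const]

variable [Algebra ℂ A] (τ : A →ₐ[ℂ] PowerSeries A)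

/-- The `X`-linear extension of `τ` to power series, as a linear map. -/
def extendLin : PowerSeries A →ₗ[ℂ] PowerSeries A where
  toFun f := mk fun n => ∑ p ∈ antidiagonal n, coeff p.2 (τ (coeff p.1 f))
  map_add' f g := by
    ext n
    simp [Finset.sum_add_distrib]
  map_smul' c f := by
    ext n
    have h : ∀ k (x : PowerSeries A), coeff k (c • x) = c • coeff k x := fun k x => rfl
    simp only [coeff_mk, RingHom.id_apply, h, Finset.smul_sum, map_smul]

lemma coeff_extendLin (n : ℕ) (f : PowerSeries A) : coeff n (extendLin τ f) =
    ∑ p ∈ antidiagonal n, coeff p.2 (τ (coeff p.1 f)) := by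
  exact coeff_mk n fun n => ∑ p ∈ antidiagonal n, coeff p.2 (τ (coeff p.1 f))

lemma extendLin_C_mul (a : A) (f : PowerSeries A) :
    extendLin τ (C a * f) = τ a * extendLin τ f := by
  ext n
  rw [coeff_extendLin, coeff_mul]
  simp only [coeff_extendLin, coeff_C_mul, map_mul]
  simp only [coeff_mul, Finset.mul_sum]
  rw [Finset.sum_sigma', Finset.sum_sigma']
  -- In the triple convolution the degree taken from `τ a` and the degree of the coefficient of `f`
  -- change places. The remaining index is untouched.
  refine Finset.sum_nbij' (fun s => ⟨(s.2.1, s.1.1 + s.2.2), (s.1.1, s.2.2)⟩)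
    (fun s => ⟨(s.2.1, s.1.1 + s.2.2), (s.1.1, s.2.2)⟩) ?_ ?_ ?_ ?_ ?_
  · rintro ⟨⟨a, b⟩, ⟨c, d⟩⟩ h
    simp only [Finset.mem_sigma, mem_antidiagonal] at h ⊢
    obtain ⟨rfl, rfl⟩ := h
    exact ⟨by ring, trivial⟩
  · rintro ⟨⟨a, b⟩, ⟨c, d⟩⟩ h
    simp only [Finset.mem_sigma, mem_antidiagonal] at h ⊢
    obtain ⟨rfl, rfl⟩ := h
    exact ⟨by ring, trivial⟩
  · rintro ⟨⟨a, b⟩, ⟨c, d⟩⟩ h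
    simp only [Finset.mem_sigma, mem_antidiagonal] at h
    obtain ⟨-, rfl⟩ := h
    rfl
  · rintro ⟨⟨a, b⟩, ⟨c, d⟩⟩ h
    simp only [Finset.mem_sigma, mem_antidiagonal] at h
    obtain ⟨-, rfl⟩ := h
    rfl
  · intro s _
    rfl

lemma extendLin_X_mul (f : PowerSeries A) : extendLin τ (X * f) = X * extendLin τ f := by
  ext n
  cases n with
  | zero => simp [coeff_extendLin]
  | succ n => simp [coeff_extendLin, Finset.Nat.antidiagonal_succ, coeff_succ_X_mul]

lemma extendLin_one : extendLin τ 1 = 1 := by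
  ext n
  rw [coeff_extendLin, Finset.sum_eq_single_of_mem (0, n) (by simp)]
  · simp
  · rintro ⟨a, b⟩ _ h
    have ha : a ≠ 0 := by
      rintro rfl
      simp_all
    simp [coeff_one, ha]

/-- The `X`-linear extension of `τ` to power series. -/
def extend : PowerSeries A →ₐ[ℂ] PowerSeries A :=
  AlgHom.ofLinearMap (extendLin τ) (extendLin_one τ) fun f g => by
    ext n
    -- Multiplicativity is proved coefficient by coefficient: the constant term of `f` is covered by
    -- `extendLin_C_mul`, and the rest carries a factor `X` that lowers the degree.
    induction n using Nat.strong_induction_on generalizing f with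
    | _ n ih =>
    have hC : extendLin τ (C (constantCoeff f)) = τ (constantCoeff f) := by
      rw [← mul_one (C _), extendLin_C_mul, extendLin_one, mul_one]
    conv_lhs => rw [eq_C_add_X_mul f]
    conv_rhs => rw [eq_C_add_X_mul f]
    rw [add_mul, map_add, map_add, map_add, add_mul, mul_assoc, extendLin_C_mul, extendLin_X_mul,
      extendLin_X_mul, hC, map_add, mul_assoc]
    cases n with
    | zero => simp
    | succ n => rw [coeff_succ_X_mul, coeff_succ_X_mul, ih n n.lt_succ_self]

lemma extend_C (a : A) : extend τ (C a) = τ a := by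
  change extendLin τ (C a) = τ a
  rw [← mul_one (C a), extendLin_C_mul, extendLin_one, mul_one]

lemma extend_X_mul (f : PowerSeries A) : extend τ (X * f) = X * extend τ f :=
  extendLin_X_mul τ f

lemma extend_X : extend τ X = X := by
  rw [← mul_one X, extend_X_mul, map_one]

lemma constantCoeff_extend (f : PowerSeries A) :
    constantCoeff (extend τ f) = constantCoeff (τ (constantCoeff f)) := by
  conv_lhs => rw [eq_C_add_X_mul f]
  rw [map_add, extend_C, extend_X_mul]
  simp

/-- A series in the kernel has zero constant term. Dividing by `X` leaves a series in the kernel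
again. -/
lemma extend_injective (h : Function.Injective fun a => constantCoeff (τ a)) :
    Function.Injective (extend τ) := by
  rw [injective_iff_map_eq_zero]
  intro f hf
  ext n
  induction n generalizing f with
  | zero =>
    have h1 := constantCoeff_extend τ f
    rw [hf, map_zero] at h1
    rw [map_zero, coeff_zero_eq_constantCoeff_apply]
    apply h
    simp only [← h1, map_zero]
  | succ n ih =>
    have h0 : constantCoeff f = 0 := by
      have h1 := constantCoeff_extend τ f
      rw [hf, map_zero] at h1
      apply h
      simp only [← h1, map_zero]
    rw [eq_C_add_X_mul f, h0, map_zero, zero_add, extend_X_mul] at hf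
    have := ih (f := mk fun p => coeff (p + 1) f) (by
      ext m
      have := congrArg (coeff (m + 1)) hf
      rwa [coeff_succ_X_mul, map_zero] at this)
    rwa [coeff_mk, map_zero] at this

/-- The successive remainders when solving `extend τ f = g`. -/
def remainder (σ : A → A) (g : PowerSeries A) : ℕ → PowerSeries A
  | 0 => g
  | n + 1 => mk fun p => coeff (p + 1)
      (remainder σ g n - τ (σ (constantCoeff (remainder σ g n))))

/-- Successive approximation: solve for the constant term with a right inverse `σ`, subtract, divide
by `X` and repeat. -/
lemma extend_surjective (h : Function.Surjective fun a => constantCoeff (τ a)) :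
    Function.Surjective (extend τ) := by
  obtain ⟨σ, hσ⟩ := h.hasRightInverse
  intro g
  let r := remainder τ σ g
  have hr : ∀ n, r n = τ (σ (constantCoeff (r n))) + X * r (n + 1) := by
    intro n
    have h1 := eq_C_add_X_mul (r n - τ (σ (constantCoeff (r n))))
    have h2 : constantCoeff (r n - τ (σ (constantCoeff (r n)))) = 0 := by
      rw [map_sub, sub_eq_zero]
      exact (hσ _).symm
    rw [h2, map_zero, zero_add] at h1
    rw [← sub_eq_iff_eq_add', h1]
    rfl
  -- All tails of the solution are considered at once, so that the induction on the coefficient may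
  -- pass from the tail `n` to the tail `n + 1`.
  let f : ℕ → PowerSeries A := fun n => mk fun p => σ (constantCoeff (r (n + p)))
  have hf : ∀ n, f n = C (σ (constantCoeff (r n))) + X * f (n + 1) := by
    intro n
    rw [eq_C_add_X_mul (f n)]
    congr 2
    · ext p
      simp only [f, coeff_mk]
      rw [add_assoc, add_comm 1 p]
  refine ⟨f 0, ?_⟩
  have key : ∀ m n, coeff m (extend τ (f n)) = coeff m (r n) := by
    intro m
    induction m with
    | zero =>
      intro n
      conv_lhs => rw [hf]
      conv_rhs => rw [hr n]
      rw [map_add, extend_C, extend_X_mul]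
      simp
    | succ m ih =>
      intro n
      conv_lhs => rw [hf]
      conv_rhs => rw [hr n]
      rw [map_add, extend_C, extend_X_mul, map_add, map_add, coeff_succ_X_mul, coeff_succ_X_mul, ih]
  ext m
  exact key m 0

/-- The automorphism of power series extending `τ`. -/
def extendEquiv (h : Function.Bijective fun a => constantCoeff (τ a)) :
    PowerSeries A ≃ₐ[ℂ] PowerSeries A :=
  AlgEquiv.ofBijective (extend τ) ⟨extend_injective τ h.1, extend_surjective τ h.2⟩

omit [Algebra ℂ A] in
lemma laurentSeries_isUnit (hA : ∀ a : A, a ≠ 0 → IsUnit a) {f : LaurentSeries A} (hf : f ≠ 0) :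
    IsUnit f := by
  have h1 : IsUnit (HahnSeries.ofPowerSeries ℤ A f.powerSeriesPart) := by
    refine (isUnit_of_constantCoeff (hA _ ?_)).map _
    rw [← coeff_zero_eq_constantCoeff_apply, LaurentSeries.powerSeriesPart_coeff]
    simpa using HahnSeries.coeff_order_eq_zero.not.mpr hf
  have h2 : IsUnit (HahnSeries.single f.order (1 : A)) :=
    ⟨⟨HahnSeries.single f.order 1, HahnSeries.single (-f.order) 1, by simp, by simp⟩, rfl⟩
  rw [← LaurentSeries.single_order_mul_powerSeriesPart f]
  exact h2.mul h1

end PowerSeriesExtension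

end QPainleve
end

noncomputable section
namespace QPainleve

/-! ### Relations and universal properties -/

/-! ### Arithmetic of the cyclic indices and of the orientation matrix. -/

section Indices

variable {n : ℕ}

lemma two_ne_zero_zmod (hn : 1 ≤ n) : (2 : ZMod (2 * n + 2)) ≠ 0 := by
  intro h
  have h2 : ((2 : ℕ) : ZMod (2 * n + 2)) = 0 := by exact_mod_cast h
  rw [ZMod.natCast_eq_zero_iff] at h2
  have := Nat.le_of_dvd two_pos h2
  omega

lemma one_ne_zero_zmod : (1 : ZMod (2 * n + 2)) ≠ 0 := by
  have : Fact (1 < 2 * n + 2) := ⟨by omega⟩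
  exact one_ne_zero

lemma add_one_ne_sub_one (hn : 1 ≤ n) (i : ZMod (2 * n + 2)) : i + 1 ≠ i - 1 := by
  intro h
  apply two_ne_zero_zmod hn
  linear_combination h

lemma natCast_ne_zero_zmod {m : ℕ} (h0 : 0 < m) (h : m < 2 * n + 2) :
    ((m : ℕ) : ZMod (2 * n + 2)) ≠ 0 := by
  rw [Ne, ZMod.natCast_eq_zero_iff]
  exact Nat.not_dvd_of_pos_of_lt h0 h

lemma natCast_ne_one_zmod {m : ℕ} (h0 : 1 < m) (h : m < 2 * n + 2) :
    ((m : ℕ) : ZMod (2 * n + 2)) ≠ 1 := by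
  intro h1
  refine natCast_ne_zero_zmod (n := n) (m := m - 1) (by omega) (by omega) ?_
  rw [Nat.cast_sub h0.le, h1]
  simp

lemma two_mul_add_two_eq_zero : ((2 * n + 2 : ℕ) : ZMod (2 * n + 2)) = 0 := ZMod.natCast_self _

lemma orient_eq (hn : 1 ≤ n) (i j : ZMod (2 * n + 2)) :
    orient i j = (if j = i + 1 then 1 else 0) - (if j = i - 1 then 1 else 0) := by
  unfold orient
  have := add_one_ne_sub_one hn i
  split_ifs <;> simp_all

lemma orient_antisymm (hn : 1 ≤ n) (i j : ZMod (2 * n + 2)) : orient i j = - orient j i := by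
  rw [orient_eq hn, orient_eq hn]
  have h1 : i = j + 1 ↔ j = i - 1 := by rw [eq_sub_iff_add_eq]; exact eq_comm
  have h2 : i = j - 1 ↔ j = i + 1 := by rw [eq_sub_iff_add_eq]; exact eq_comm
  simp only [h1, h2]
  ring

lemma orient_self (hn : 1 ≤ n) (i : ZMod (2 * n + 2)) : orient i i = 0 := by
  have := orient_antisymm hn i i
  omega

lemma orient_succ (i : ZMod (2 * n + 2)) : orient i (i + 1) = 1 := by simp [orient]

lemma orient_pred (hn : 1 ≤ n) (i : ZMod (2 * n + 2)) : orient i (i - 1) = -1 := by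
  simp [orient, (add_one_ne_sub_one hn i).symm]

lemma orient_of_ne {i j : ZMod (2 * n + 2)} (h1 : j ≠ i + 1) (h2 : j ≠ i - 1) : orient i j = 0 := by
  simp [orient, h1, h2]

/-- The sum telescopes around the even-length cycle. This is why the alternating sums of the
noncentral generators are central and may be normalized. -/
lemma sum_orient_even (hn : 1 ≤ n) (j : ZMod (2 * n + 2)) :
    ∑ m ∈ Finset.range (n + 1), orient ((2 * m : ℕ) : ZMod (2 * n + 2)) j = 0 := by
  let q : ℕ → ℤ := fun m => if j = ((2 * m : ℕ) : ZMod (2 * n + 2)) - 1 then 1 else 0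
  have h : ∀ m, orient ((2 * m : ℕ) : ZMod (2 * n + 2)) j = q (m + 1) - q m := by
    intro m
    rw [orient_eq hn]
    have : ((2 * (m + 1) : ℕ) : ZMod (2 * n + 2)) - 1 = ((2 * m : ℕ) : ZMod (2 * n + 2)) + 1 := by
      push_cast; ring
    simp only [q, this]
  simp only [h]
  rw [Finset.sum_range_sub]
  have : ((2 * (n + 1) : ℕ) : ZMod (2 * n + 2)) = 0 := two_mul_add_two_eq_zero
  have h0 : q (n + 1) = q 0 := by
    simp only [q]
    rw [this, mul_zero, Nat.cast_zero]
  rw [h0, sub_self]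

lemma sum_orient_odd (hn : 1 ≤ n) (j : ZMod (2 * n + 2)) :
    ∑ m ∈ Finset.range (n + 1), orient ((2 * m + 1 : ℕ) : ZMod (2 * n + 2)) j = 0 := by
  rw [← sum_orient_even hn (j - 1)]
  refine Finset.sum_congr rfl fun m _ => ?_
  rw [orient_eq hn, orient_eq hn]
  congr 2
  · rw [sub_eq_iff_eq_add]; push_cast; rfl
  · rw [sub_eq_iff_eq_add, sub_add_cancel]
    push_cast
    rw [add_sub_cancel_right]

/-- Every index is reached from `1` by steps of `2` upward or from `0` by steps of `2` downward,
which is the route taken in `genOmega_nondeg`. -/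
lemma eq_odd_or_neg_even (j : ZMod (2 * n + 2)) :
    ∃ m ≤ n, j = ((2 * m + 1 : ℕ) : ZMod (2 * n + 2)) ∨ j = - ((2 * m : ℕ) : ZMod (2 * n + 2)) := by
  have hj := ZMod.val_lt j
  have hc : ((j.val : ℕ) : ZMod (2 * n + 2)) = j := ZMod.natCast_zmod_val j
  rcases Nat.even_or_odd' j.val with ⟨m, hm | hm⟩
  · by_cases h0 : m = 0
    · refine ⟨0, Nat.zero_le _, Or.inr ?_⟩
      rw [← hc, hm, h0]; simp
    · refine ⟨n + 1 - m, by omega, Or.inr ?_⟩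
      rw [← hc, hm, eq_neg_iff_add_eq_zero, ← Nat.cast_add]
      have : 2 * m + 2 * (n + 1 - m) = 2 * n + 2 := by omega
      rw [this, two_mul_add_two_eq_zero]
  · exact ⟨m, by omega, Or.inl (by rw [← hc, hm])⟩

end Indices

/-! ### Families satisfying the defining relations, and the homomorphisms they give. -/

section Relations

variable {n : ℕ} {R : Type*} [Ring R]

/-- The relations shared by the generators of `K` and of `F`. -/
structure CoreRel (p b : ZMod (2 * n + 2) → R) (h : R) : Prop where
  comm : ∀ i j, p i * p j - p j * p i = orient i j • h
  p_b : ∀ i j, p i * b j = b j * p i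
  b_b : ∀ i j, b i * b j = b j * b i
  p_h : ∀ i, h * p i = p i * h
  b_h : ∀ i, h * b i = b i * h

/-- The two partial sums of a family indexed by `ℤ/(2n+2)ℤ`. -/
structure SumRel (p : ZMod (2 * n + 2) → R) (c : R) : Prop where
  even : ∑ m ∈ Finset.range (n + 1), p ((2 * m : ℕ) : ZMod (2 * n + 2)) = c
  odd : ∑ m ∈ Finset.range (n + 1), p ((2 * m + 1 : ℕ) : ZMod (2 * n + 2)) = c

lemma SumRel.zero_eq {p : ZMod (2 * n + 2) → R} {c : R} (h : SumRel p c) :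
    p 0 = c - ∑ m ∈ Finset.range n, p ((2 * m + 2 : ℕ) : ZMod (2 * n + 2)) := by
  rw [← h.even, Finset.sum_range_succ', eq_sub_iff_add_eq, add_comm]
  rw [mul_zero, Nat.cast_zero]
  rfl

lemma SumRel.one_eq {p : ZMod (2 * n + 2) → R} {c : R} (h : SumRel p c) :
    p 1 = c - ∑ m ∈ Finset.range n, p ((2 * m + 3 : ℕ) : ZMod (2 * n + 2)) := by
  rw [← h.odd, Finset.sum_range_succ', eq_sub_iff_add_eq, add_comm]
  rw [mul_zero, zero_add, Nat.cast_one]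
  rfl

lemma sumRel_of_eq {p : ZMod (2 * n + 2) → R} {c : R}
    (h0 : p 0 = c - ∑ m ∈ Finset.range n, p ((2 * m + 2 : ℕ) : ZMod (2 * n + 2)))
    (h1 : p 1 = c - ∑ m ∈ Finset.range n, p ((2 * m + 3 : ℕ) : ZMod (2 * n + 2))) :
    SumRel p c := by
  constructor
  · rw [Finset.sum_range_succ', mul_zero, Nat.cast_zero, h0]
    exact add_sub_cancel _ _
  · rw [Finset.sum_range_succ', mul_zero, zero_add, Nat.cast_one, h1]
    exact add_sub_cancel _ _

lemma CoreRel.p_comm_of_orient {p b : ZMod (2 * n + 2) → R} {h : R} (H : CoreRel p b h)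
    {i j : ZMod (2 * n + 2)} (hij : orient i j = 0) : p i * p j = p j * p i := by
  have := H.comm i j
  rwa [hij, zero_smul, sub_eq_zero] at this

/-- The commutation relations follow from those with adjacent or non-adjacent indices. -/
lemma comm_of_adjacent (hn : 1 ≤ n) {p : ZMod (2 * n + 2) → R} {h : R}
    (h1 : ∀ i, p i * p (i + 1) - p (i + 1) * p i = h)
    (h2 : ∀ i j, j ≠ i + 1 → j ≠ i - 1 → p i * p j = p j * p i) (i j : ZMod (2 * n + 2)) :
    p i * p j - p j * p i = orient i j • h := by
  by_cases hj : j = i + 1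
  · rw [hj, orient_succ, one_smul, h1]
  · by_cases hj' : j = i - 1
    · have := h1 (i - 1)
      rw [sub_add_cancel] at this
      rw [hj', orient_pred hn, neg_smul, one_smul, ← this, neg_sub]
    · rw [orient_of_ne hj hj', zero_smul, sub_eq_zero]
      exact h2 i j hj hj'

variable [Algebra ℂ R]

/-- The homomorphism from `KAlg n` given by a family satisfying its relations. -/
def KAlg.lift {p b : ZMod (2 * n + 2) → R} {h : R} (H : CoreRel p b h) (hs : SumRel p 1) :
    KAlg n →ₐ[ℂ] R :=
  RingQuot.liftAlgHom ℂ ⟨FreeAlgebra.lift ℂ fun x => match x with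
    | .f i => p i
    | .α i => b i
    | .h => h, by
    intro x y hxy
    cases hxy with
    | f_f_succ i => simpa [orient_succ] using H.comm i (i + 1)
    | f_f i j h₁ h₂ => simpa using H.p_comm_of_orient (orient_of_ne h₁ h₂)
    | f_α i j => simpa using H.p_b i j
    | α_α i j => simpa using H.b_b i j
    | h_f i => simpa using H.p_h i
    | h_α i => simpa using H.b_h i
    | sum_even => simpa using hs.even
    | sum_odd => simpa using hs.odd⟩

/-- A generator of `KAlg n`. -/
def KAlg.gen (x : KGen n) : KAlg n := RingQuot.mkAlgHom ℂ (KRel n) (FreeAlgebra.ι ℂ x)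

section
variable {p b : ZMod (2 * n + 2) → R} {h : R} (H : CoreRel p b h) (hs : SumRel p 1)

lemma KAlg.lift_f (i) : KAlg.lift H hs (KAlg.gen (.f i)) = p i := by
  rw [KAlg.lift, KAlg.gen, RingQuot.liftAlgHom_mkAlgHom_apply]; simp

lemma KAlg.lift_α (i) : KAlg.lift H hs (KAlg.gen (.α i)) = b i := by
  rw [KAlg.lift, KAlg.gen, RingQuot.liftAlgHom_mkAlgHom_apply]; simp

lemma KAlg.lift_h : KAlg.lift H hs (KAlg.gen .h) = h := by
  rw [KAlg.lift, KAlg.gen, RingQuot.liftAlgHom_mkAlgHom_apply]; simp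

end

/-- The remaining relations of `F`. -/
structure TimeRel (p b : ZMod (2 * n + 2) → R) (t h : R) : Prop where
  p_t : ∀ i, p i * t = t * p i
  b_t : ∀ i, b i * t = t * b i
  t_h : t * h = h * t
  sum_b : ∑ m ∈ Finset.range (2 * n + 2), b (m : ZMod (2 * n + 2)) = 1

/-- The homomorphism from `FAlg n` given by a family satisfying its relations. -/
def FAlg.lift {p b : ZMod (2 * n + 2) → R} {t h : R} (H : CoreRel p b h) (hs : SumRel p 0)
    (ht : TimeRel p b t h) : FAlg n →ₐ[ℂ] R :=
  RingQuot.liftAlgHom ℂ ⟨FreeAlgebra.lift ℂ fun x => match x with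
    | .φ i => p i
    | .β i => b i
    | .t => t
    | .h' => h, by
    intro x y hxy
    cases hxy with
    | φ_φ_succ i => simpa [orient_succ] using H.comm i (i + 1)
    | φ_φ i j h₁ h₂ => simpa using H.p_comm_of_orient (orient_of_ne h₁ h₂)
    | φ_β i j => simpa using H.p_b i j
    | β_β i j => simpa using H.b_b i j
    | φ_t i => simpa using ht.p_t i
    | β_t i => simpa using ht.b_t i
    | φ_h' i => simpa using (H.p_h i).symm
    | β_h' i => simpa using (H.b_h i).symm
    | t_h' => simpa using ht.t_h
    | sum_even => simpa using hs.even
    | sum_odd => simpa using hs.odd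
    | sum_β => simpa using ht.sum_b⟩

/-- A generator of `FAlg n`. -/
def FAlg.gen (x : FGen n) : FAlg n := RingQuot.mkAlgHom ℂ (FRel n) (FreeAlgebra.ι ℂ x)

section
variable {p b : ZMod (2 * n + 2) → R} {t h : R} (H : CoreRel p b h) (hs : SumRel p 0)
    (ht : TimeRel p b t h)

lemma FAlg.lift_φ (i) : FAlg.lift H hs ht (FAlg.gen (.φ i)) = p i := by
  rw [FAlg.lift, FAlg.gen, RingQuot.liftAlgHom_mkAlgHom_apply]; simp

lemma FAlg.lift_β (i) : FAlg.lift H hs ht (FAlg.gen (.β i)) = b i := by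
  rw [FAlg.lift, FAlg.gen, RingQuot.liftAlgHom_mkAlgHom_apply]; simp

lemma FAlg.lift_t : FAlg.lift H hs ht (FAlg.gen .t) = t := by
  rw [FAlg.lift, FAlg.gen, RingQuot.liftAlgHom_mkAlgHom_apply]; simp

lemma FAlg.lift_h' : FAlg.lift H hs ht (FAlg.gen .h') = h := by
  rw [FAlg.lift, FAlg.gen, RingQuot.liftAlgHom_mkAlgHom_apply]; simp

end

lemma KAlg.coreRel (hn : 1 ≤ n) : CoreRel (n := n) (fun i => KAlg.gen (.f i))
    (fun i => KAlg.gen (.α i)) (KAlg.gen .h) where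
  comm := comm_of_adjacent hn
    (fun i => by simpa [KAlg.gen] using RingQuot.mkAlgHom_rel ℂ (KRel.f_f_succ (n := n) i))
    (fun i j h₁ h₂ => by simpa [KAlg.gen] using RingQuot.mkAlgHom_rel ℂ (KRel.f_f (n := n) i j h₁ h₂))
  p_b i j := by simpa [KAlg.gen] using RingQuot.mkAlgHom_rel ℂ (KRel.f_α (n := n) i j)
  b_b i j := by simpa [KAlg.gen] using RingQuot.mkAlgHom_rel ℂ (KRel.α_α (n := n) i j)
  p_h i := by simpa [KAlg.gen] using RingQuot.mkAlgHom_rel ℂ (KRel.h_f (n := n) i)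
  b_h i := by simpa [KAlg.gen] using RingQuot.mkAlgHom_rel ℂ (KRel.h_α (n := n) i)

lemma KAlg.sumRel : SumRel (n := n) (fun i => KAlg.gen (.f i)) 1 where
  even := by simpa [KAlg.gen] using RingQuot.mkAlgHom_rel ℂ (KRel.sum_even (n := n))
  odd := by simpa [KAlg.gen] using RingQuot.mkAlgHom_rel ℂ (KRel.sum_odd (n := n))

lemma FAlg.coreRel (hn : 1 ≤ n) : CoreRel (n := n) (fun i => FAlg.gen (.φ i))
    (fun i => FAlg.gen (.β i)) (FAlg.gen .h') where
  comm := comm_of_adjacent hn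
    (fun i => by simpa [FAlg.gen] using RingQuot.mkAlgHom_rel ℂ (FRel.φ_φ_succ (n := n) i))
    (fun i j h₁ h₂ => by simpa [FAlg.gen] using RingQuot.mkAlgHom_rel ℂ (FRel.φ_φ (n := n) i j h₁ h₂))
  p_b i j := by simpa [FAlg.gen] using RingQuot.mkAlgHom_rel ℂ (FRel.φ_β (n := n) i j)
  b_b i j := by simpa [FAlg.gen] using RingQuot.mkAlgHom_rel ℂ (FRel.β_β (n := n) i j)
  p_h i := by simpa [FAlg.gen] using (RingQuot.mkAlgHom_rel ℂ (FRel.φ_h' (n := n) i)).symm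
  b_h i := by simpa [FAlg.gen] using (RingQuot.mkAlgHom_rel ℂ (FRel.β_h' (n := n) i)).symm

lemma FAlg.sumRel : SumRel (n := n) (fun i => FAlg.gen (.φ i)) 0 where
  even := by simpa [FAlg.gen] using RingQuot.mkAlgHom_rel ℂ (FRel.sum_even (n := n))
  odd := by simpa [FAlg.gen] using RingQuot.mkAlgHom_rel ℂ (FRel.sum_odd (n := n))

lemma FAlg.timeRel : TimeRel (n := n) (fun i => FAlg.gen (.φ i)) (fun i => FAlg.gen (.β i))
    (FAlg.gen .t) (FAlg.gen .h') where
  p_t i := by simpa [FAlg.gen] using RingQuot.mkAlgHom_rel ℂ (FRel.φ_t (n := n) i)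
  b_t i := by simpa [FAlg.gen] using RingQuot.mkAlgHom_rel ℂ (FRel.β_t (n := n) i)
  t_h := by simpa [FAlg.gen] using RingQuot.mkAlgHom_rel ℂ (FRel.t_h' (n := n))
  sum_b := by simpa [FAlg.gen] using RingQuot.mkAlgHom_rel ℂ (FRel.sum_β (n := n))

lemma KAlg.adjoin_gen : Algebra.adjoin ℂ (Set.range (KAlg.gen (n := n))) = ⊤ := by
  have h := congrArg (Subalgebra.map (RingQuot.mkAlgHom ℂ (KRel n)))
    (FreeAlgebra.adjoin_range_ι (R := ℂ) (X := KGen n))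
  rw [AlgHom.map_adjoin, ← Set.range_comp, Algebra.map_top,
    (AlgHom.range_eq_top _).mpr (RingQuot.mkAlgHom_surjective ℂ (KRel n))] at h
  exact h

lemma FAlg.adjoin_gen : Algebra.adjoin ℂ (Set.range (FAlg.gen (n := n))) = ⊤ := by
  have h := congrArg (Subalgebra.map (RingQuot.mkAlgHom ℂ (FRel n)))
    (FreeAlgebra.adjoin_range_ι (R := ℂ) (X := FGen n))
  rw [AlgHom.map_adjoin, ← Set.range_comp, Algebra.map_top,
    (AlgHom.range_eq_top _).mpr (RingQuot.mkAlgHom_surjective ℂ (FRel n))] at h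
  exact h

end Relations

end QPainleve
end

noncomputable section
namespace QPainleve

/-! ### A faithful model of the relations -/

open MvPolynomial

section Model

variable {n : ℕ}

/-- Indices of a free set of generators: `none` for `h`, `inl j` for the central generators, `inr j`
for the noncentral generators other than those with index `0` and `1`. -/
abbrev GenIndex (n : ℕ) : Type :=
  Option (ZMod (2 * n + 2) ⊕ {j : ZMod (2 * n + 2) // j ≠ 0 ∧ j ≠ 1})

/-- The commutation matrix of the free generators. -/
def genOmega (n : ℕ) : GenIndex n → GenIndex n → ℂ
  | some (.inr i), some (.inr j) => (orient i.1 j.1 : ℤ)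
  | _, _ => 0

/-- The indices of the central generators. -/
def centralIndex (n : ℕ) : Option (ZMod (2 * n + 2)) → GenIndex n := Option.map Sum.inl

lemma centralIndex_injective : Function.Injective (centralIndex n) :=
  Option.map_injective Sum.inl_injective

lemma genOmega_antisymm (hn : 1 ≤ n) (i j : GenIndex n) : genOmega n i j = - genOmega n j i := by
  rcases i with _ | i | i <;> rcases j with _ | j | j <;> simp only [genOmega, neg_zero]
  rw [orient_antisymm hn]
  push_cast; ring

lemma genOmega_central (c : Option (ZMod (2 * n + 2))) (i : GenIndex n) :
    genOmega n i (centralIndex n c) = 0 := by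
  rcases i with _ | i | i <;> rcases c with _ | c <;> rfl

lemma genOmega_none (i : GenIndex n) : genOmega n i none = 0 := genOmega_central none i

/-- Without the indices `0` and `1` the cycle becomes a path with the even number `2 n` of vertices,
whose skew matrix is invertible. Extended by `V 0 = V 1 = 0`, a kernel vector satisfies `V (j + 1) =
V (j - 1)`. So zeros spread from `1` upward through the odd indices and from `0` downward through
the even ones. -/
lemma genOmega_nondeg (hn : 1 ≤ n) (v : GenIndex n → MvPolynomial (GenIndex n) ℂ)
    (hv : ∀ i, ∑ k, C (genOmega n i k) * v k = 0) (k : GenIndex n)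
    (hk : k ∉ Set.range (centralIndex n)) : v k = 0 := by
  classical
  let V : ZMod (2 * n + 2) → MvPolynomial (GenIndex n) ℂ := fun j =>
    if hj : j ≠ 0 ∧ j ≠ 1 then v (some (.inr ⟨j, hj⟩)) else 0
  have hV : ∀ j, j ≠ 0 → j ≠ 1 → V (j + 1) = V (j - 1) := by
    intro j h0 h1
    have h := hv (some (.inr ⟨j, h0, h1⟩))
    rw [Fintype.sum_option, Fintype.sum_sum_type] at h
    have e1 : ∀ k : {j : ZMod (2 * n + 2) // j ≠ 0 ∧ j ≠ 1},
        C (genOmega n (some (.inr ⟨j, h0, h1⟩)) (some (.inr k))) * v (some (.inr k)) =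
        C ((orient j k.1 : ℤ) : ℂ) * V k.1 := by
      intro k
      simp only [V, genOmega]
      rw [dif_pos k.2]
    simp only [e1] at h
    simp only [genOmega, C_0, zero_mul, Finset.sum_const_zero, zero_add] at h
    have e2 : ∑ k : {j : ZMod (2 * n + 2) // j ≠ 0 ∧ j ≠ 1}, C ((orient j k.1 : ℤ) : ℂ) * V k.1 =
        ∑ k : ZMod (2 * n + 2), C ((orient j k : ℤ) : ℂ) * V k := by
      rw [← Finset.sum_subtype (Finset.univ.filter fun j : ZMod (2 * n + 2) => j ≠ 0 ∧ j ≠ 1)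
        (fun x => by simp) (fun k => C ((orient j k : ℤ) : ℂ) * V k)]
      refine Finset.sum_subset (Finset.subset_univ _) fun k _ hk => ?_
      have : V k = 0 := dif_neg fun h => hk (Finset.mem_filter.mpr ⟨Finset.mem_univ _, h⟩)
      rw [this, mul_zero]
    rw [e2] at h
    simp only [orient_eq hn, Int.cast_sub, C_sub, sub_mul, Finset.sum_sub_distrib] at h
    rw [Finset.sum_eq_single (j + 1) (fun k _ hk => by simp [hk]) (by simp),
      Finset.sum_eq_single (j - 1) (fun k _ hk => by simp [hk]) (by simp)] at h
    simpa [sub_eq_zero] using h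
  have hodd : ∀ m ≤ n, V ((2 * m + 1 : ℕ) : ZMod (2 * n + 2)) = 0 := by
    intro m
    induction m with
    | zero => intro _; simp [V]
    | succ m ih =>
      intro hm
      have h := hV ((2 * m + 2 : ℕ) : ZMod (2 * n + 2)) (natCast_ne_zero_zmod (by omega) (by omega))
        (natCast_ne_one_zmod (by omega) (by omega))
      have e1 : ((2 * m + 2 : ℕ) : ZMod (2 * n + 2)) + 1 = ((2 * (m + 1) + 1 : ℕ) : ZMod _) := by
        push_cast; ring
      have e2 : ((2 * m + 2 : ℕ) : ZMod (2 * n + 2)) - 1 = ((2 * m + 1 : ℕ) : ZMod _) := by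
        push_cast; ring
      rw [← e1, h, e2, ih (by omega)]
  have heven : ∀ m ≤ n, V (- ((2 * m : ℕ) : ZMod (2 * n + 2))) = 0 := by
    intro m
    induction m with
    | zero => intro _; simp [V]
    | succ m ih =>
      intro hm
      have h := hV (- ((2 * m + 1 : ℕ) : ZMod (2 * n + 2)))
        (neg_ne_zero.mpr (natCast_ne_zero_zmod (by omega) (by omega)))
        (fun h => natCast_ne_zero_zmod (n := n) (m := 2 * m + 2) (by omega) (by omega) (by
          push_cast at h ⊢; linear_combination -h))
      have e1 : - ((2 * m + 1 : ℕ) : ZMod (2 * n + 2)) + 1 = - ((2 * m : ℕ) : ZMod _) := by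
        push_cast; ring
      have e2 : - ((2 * m + 1 : ℕ) : ZMod (2 * n + 2)) - 1 = - ((2 * (m + 1) : ℕ) : ZMod _) := by
        push_cast; ring
      rw [← e2, ← h, e1, ih (by omega)]
  rcases k with _ | k | ⟨j, hj⟩
  · exact absurd ⟨none, rfl⟩ hk
  · exact absurd ⟨some k, rfl⟩ hk
  · have : V j = 0 := by
      obtain ⟨m, hm, h | h⟩ := eq_odd_or_neg_even j
      · rw [h, hodd m hm]
      · rw [h, heven m hm]
    rwa [show V j = v (some (.inr ⟨j, hj⟩)) from dif_pos hj] at this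

/-- The operator of a free generator. -/
def genOp (i : GenIndex n) : Module.End ℂ (MvPolynomial (GenIndex n) ℂ) :=
  weylOp (genOmega n) none i

lemma genOp_commutator (hn : 1 ≤ n) (i j : GenIndex n) :
    genOp i * genOp j - genOp j * genOp i = genOmega n i j • genOp none :=
  weylOp_commutator (genOmega_antisymm hn) genOmega_none i j

lemma genOp_commute (hn : 1 ≤ n) (c : Option (ZMod (2 * n + 2))) (i : GenIndex n) :
    Commute (genOp i) (genOp (centralIndex n c)) := by
  have := genOp_commutator hn i (centralIndex n c)
  rwa [genOmega_central, zero_smul, sub_eq_zero] at this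

/-- The operators of all noncentral generators, with the sums normalized to `c`. -/
def noncentralOp (c : Module.End ℂ (MvPolynomial (GenIndex n) ℂ)) (j : ZMod (2 * n + 2)) :
    Module.End ℂ (MvPolynomial (GenIndex n) ℂ) :=
  let p : ZMod (2 * n + 2) → Module.End ℂ (MvPolynomial (GenIndex n) ℂ) := fun j =>
    if hj : j ≠ 0 ∧ j ≠ 1 then genOp (some (.inr ⟨j, hj⟩)) else 0
  if j = 0 then c - ∑ m ∈ Finset.range n, p ((2 * m + 2 : ℕ) : ZMod (2 * n + 2))
  else if j = 1 then c - ∑ m ∈ Finset.range n, p ((2 * m + 3 : ℕ) : ZMod (2 * n + 2))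
  else p j

lemma noncentralOp_of_ne (c : Module.End ℂ (MvPolynomial (GenIndex n) ℂ)) {j : ZMod (2 * n + 2)}
    (hj : j ≠ 0 ∧ j ≠ 1) : noncentralOp c j = genOp (some (.inr ⟨j, hj⟩)) := by
  simp only [noncentralOp]
  rw [if_neg hj.1, if_neg hj.2, dif_pos hj]

lemma noncentralOp_sumRel (c : Module.End ℂ (MvPolynomial (GenIndex n) ℂ)) :
    SumRel (noncentralOp c) c := by
  refine sumRel_of_eq ?_ ?_
  · conv_lhs => rw [noncentralOp, if_pos rfl]
    congr 1
    refine Finset.sum_congr rfl fun m hm => ?_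
    rw [Finset.mem_range] at hm
    have hj := natCast_ne_zero_zmod (n := n) (m := 2 * m + 2) (by omega) (by omega)
    have hj' := natCast_ne_one_zmod (n := n) (m := 2 * m + 2) (by omega) (by omega)
    rw [noncentralOp_of_ne c ⟨hj, hj'⟩]
    exact dif_pos ⟨hj, hj'⟩
  · conv_lhs => rw [noncentralOp, if_neg one_ne_zero_zmod, if_pos rfl]
    congr 1
    refine Finset.sum_congr rfl fun m hm => ?_
    rw [Finset.mem_range] at hm
    have hj := natCast_ne_zero_zmod (n := n) (m := 2 * m + 3) (by omega) (by omega)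
    have hj' := natCast_ne_one_zmod (n := n) (m := 2 * m + 3) (by omega) (by omega)
    rw [noncentralOp_of_ne c ⟨hj, hj'⟩]
    exact dif_pos ⟨hj, hj'⟩

/-- A property of the noncentral generators follows from that of the free ones. -/
lemma noncentral_induction {R : Type*} [Ring R] {p : ZMod (2 * n + 2) → R} {c : R}
    (hs : SumRel p c) (S : AddSubgroup R) (hc : c ∈ S) (hp : ∀ j, j ≠ 0 → j ≠ 1 → p j ∈ S) (j) :
    p j ∈ S := by
  by_cases h0 : j = 0
  · rw [h0, hs.zero_eq]
    refine S.sub_mem hc (S.sum_mem fun m hm => ?_)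
    rw [Finset.mem_range] at hm
    exact hp _ (natCast_ne_zero_zmod (by omega) (by omega)) (natCast_ne_one_zmod (by omega) (by omega))
  · by_cases h1 : j = 1
    · rw [h1, hs.one_eq]
      refine S.sub_mem hc (S.sum_mem fun m hm => ?_)
      rw [Finset.mem_range] at hm
      exact hp _ (natCast_ne_zero_zmod (by omega) (by omega))
        (natCast_ne_one_zmod (by omega) (by omega))
    · exact hp j h0 h1

/-- Commutation relations for all noncentral generators follow from those for the free ones. -/
lemma comm_of_free (hn : 1 ≤ n) {R : Type*} [Ring R] {p : ZMod (2 * n + 2) → R} {c h : R}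
    (hs : SumRel p c) (hc : ∀ j, c * p j = p j * c)
    (hp : ∀ i j, i ≠ 0 → i ≠ 1 → j ≠ 0 → j ≠ 1 → p i * p j - p j * p i = orient i j • h)
    (i j : ZMod (2 * n + 2)) : p i * p j - p j * p i = orient i j • h := by
  -- This step enlarges the second index from free generators to all. It is applied first with a
  -- free index `i`, then, after exchanging the indices by antisymmetry, with an arbitrary one.
  have key : ∀ x : R, (∀ j, x * p j = p j * x) → ∀ i : ZMod (2 * n + 2), ∀ q : ZMod (2 * n + 2) → R,
      SumRel q x → (∀ j, j ≠ 0 → j ≠ 1 → p i * q j - q j * p i = orient i j • h) →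
      ∀ j, p i * q j - q j * p i = orient i j • h := by
    intro x hx i q hq hq' j
    have hcast : ∀ s : Finset ℕ, ∀ g : ℕ → ZMod (2 * n + 2),
        (∀ m ∈ s, g m ≠ 0 ∧ g m ≠ 1) →
        p i * (x - ∑ m ∈ s, q (g m)) - (x - ∑ m ∈ s, q (g m)) * p i
          = -((∑ m ∈ s, orient i (g m)) • h) := by
      intro s g hg
      rw [mul_sub, sub_mul, hx, sub_sub_sub_cancel_left, Finset.sum_mul, Finset.mul_sum,
        ← neg_sub, ← Finset.sum_sub_distrib, Finset.sum_smul]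
      congr 1
      exact Finset.sum_congr rfl fun m hm => hq' _ (hg m hm).1 (hg m hm).2
    by_cases h0 : j = 0
    · subst h0
      rw [hq.zero_eq, hcast _ _ fun m hm => ?_, ← neg_smul]
      · congr 1
        have := sum_orient_even hn i
        rw [Finset.sum_range_succ', mul_zero, Nat.cast_zero] at this
        rw [orient_antisymm hn i 0, ← eq_neg_of_add_eq_zero_left this, ← Finset.sum_neg_distrib]
        refine Finset.sum_congr rfl fun m _ => ?_
        rw [orient_antisymm hn i, neg_neg]
        rfl
      · rw [Finset.mem_range] at hm
        exact ⟨natCast_ne_zero_zmod (by omega) (by omega), natCast_ne_one_zmod (by omega) (by omega)⟩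
    · by_cases h1 : j = 1
      · subst h1
        rw [hq.one_eq, hcast _ _ fun m hm => ?_, ← neg_smul]
        · congr 1
          have := sum_orient_odd hn i
          rw [Finset.sum_range_succ', mul_zero, zero_add, Nat.cast_one] at this
          rw [orient_antisymm hn i 1, ← eq_neg_of_add_eq_zero_left this, ← Finset.sum_neg_distrib]
          refine Finset.sum_congr rfl fun m _ => ?_
          rw [orient_antisymm hn i, neg_neg]
          rfl
        · rw [Finset.mem_range] at hm
          exact ⟨natCast_ne_zero_zmod (by omega) (by omega),
            natCast_ne_one_zmod (by omega) (by omega)⟩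
      · exact hq' j h0 h1
  have h1 : ∀ i, i ≠ 0 → i ≠ 1 → ∀ j, p i * p j - p j * p i = orient i j • h :=
    fun i h0 h1 => key c hc i p hs fun j h2 h3 => hp i j h0 h1 h2 h3
  refine key c hc i p hs (fun j h2 h3 => ?_) j
  rw [← neg_sub, h1 j h2 h3, orient_antisymm hn i j, neg_smul]

/-- The constant `c` is `1` for `K` and `0` for `F`. The family `b` may be anything built from
central operators, which leaves room for the dependent generator `β 0`. -/
lemma noncentralOp_coreRel (hn : 1 ≤ n) {c : Module.End ℂ (MvPolynomial (GenIndex n) ℂ)}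
    (hc : ∀ x, c * x = x * c) {b : ZMod (2 * n + 2) → Module.End ℂ (MvPolynomial (GenIndex n) ℂ)}
    (hb : ∀ i, b i ∈ Algebra.adjoin ℂ (Set.range fun c => genOp (centralIndex n c))) :
    CoreRel (noncentralOp c) b (genOp none) := by
  have hcomm : ∀ i : GenIndex n, ∀ x ∈ Algebra.adjoin ℂ (Set.range fun c => genOp (centralIndex n c)),
      genOp i * x = x * genOp i := by
    intro i x hx
    induction hx using Algebra.adjoin_induction with
    | mem x hx => obtain ⟨c, rfl⟩ := hx; exact genOp_commute hn c i
    | algebraMap r => exact (Algebra.commutes r _).symm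
    | add x y _ _ hx hy => rw [mul_add, add_mul, hx, hy]
    | mul x y _ _ hx hy => rw [← mul_assoc, hx, mul_assoc, hy, mul_assoc]
  have hcomm' : ∀ j, ∀ x ∈ Algebra.adjoin ℂ (Set.range fun c => genOp (centralIndex n c)),
      noncentralOp c j * x = x * noncentralOp c j := by
    intro j x hx
    have := noncentral_induction (noncentralOp_sumRel c) (Subring.centralizer {x}).toAddSubgroup
      (Subring.mem_centralizer_iff.mpr fun g hg => (hc g).symm)
      (fun j h0 h1 => Subring.mem_centralizer_iff.mpr fun g hg => by
        rw [Set.mem_singleton_iff] at hg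
        rw [hg, noncentralOp_of_ne c ⟨h0, h1⟩, hcomm _ _ hx]) j
    exact ((Subring.mem_centralizer_iff.mp this) x rfl).symm
  have hmem : genOp (n := n) none ∈
      Algebra.adjoin ℂ (Set.range fun c => genOp (centralIndex n c)) :=
    Algebra.subset_adjoin ⟨none, rfl⟩
  refine ⟨comm_of_free hn (noncentralOp_sumRel c) (fun j => hc _) fun i j h1 h2 h3 h4 => ?_,
    fun i j => hcomm' i _ (hb j), fun i j => ?_, fun i => (hcomm' i _ hmem).symm,
    fun i => hcomm _ _ (hb i)⟩
  · rw [noncentralOp_of_ne c ⟨h1, h2⟩, noncentralOp_of_ne c ⟨h3, h4⟩, genOp_commutator hn]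
    simp only [genOmega]
    exact Int.cast_smul_eq_zsmul ℂ (orient i j) (genOp (n := n) none)
  · have := hb j
    have hbi := hb i
    generalize b i = x at hbi
    induction hbi using Algebra.adjoin_induction with
    | mem x hx => obtain ⟨c, rfl⟩ := hx; exact hcomm _ _ this
    | algebraMap r => exact Algebra.commutes r _
    | add x y _ _ hx hy => rw [mul_add, add_mul, hx, hy]
    | mul x y _ _ hx hy => rw [mul_assoc, hy, ← mul_assoc, hx, mul_assoc]

end Model

end QPainleve
end

noncomputable section
namespace QPainleve

open MvPolynomial

variable {n : ℕ}

/-! ### Generators of `K` and `F` -/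

section Presentations

/-- A free set of generators of `KAlg n`. -/
def KAlg.freeGen : GenIndex n → KAlg n
  | none => KAlg.gen .h
  | some (.inl j) => KAlg.gen (.α j)
  | some (.inr j) => KAlg.gen (.f j)

/-- A free set of generators of `FAlg n`. -/
def FAlg.freeGen : GenIndex n → FAlg n
  | none => FAlg.gen .h'
  | some (.inl j) => if j = 0 then FAlg.gen .t else FAlg.gen (.β j)
  | some (.inr j) => FAlg.gen (.φ j)

/-- The slot of the redundant generator `β 0` is given to `t`, so that both algebras share one index
type and one commutation matrix. -/
lemma FAlg.freeGen_zero : FAlg.freeGen (n := n) (some (.inl 0)) = FAlg.gen .t := by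
  simp [FAlg.freeGen]

lemma genOp_mem_adjoin (c : Option (ZMod (2 * n + 2))) : genOp (centralIndex n c) ∈
    Algebra.adjoin ℂ (Set.range fun c => genOp (centralIndex n c)) :=
  Algebra.subset_adjoin ⟨c, rfl⟩

/-- The defining representation of `KAlg n`. -/
def KAlg.rep (hn : 1 ≤ n) : KAlg n →ₐ[ℂ] Module.End ℂ (MvPolynomial (GenIndex n) ℂ) :=
  KAlg.lift (noncentralOp_coreRel hn (c := 1) (fun _ => by rw [one_mul, mul_one])
    (b := fun j => genOp (centralIndex n (some j))) fun j => genOp_mem_adjoin _)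
    (noncentralOp_sumRel 1)

lemma sum_zmod_range_succ {R : Type*} [AddCommGroup R] (b : ZMod (2 * n + 2) → R) :
    ∑ m ∈ Finset.range (2 * n + 2), b (m : ZMod (2 * n + 2)) =
      b 0 + ∑ m ∈ Finset.range (2 * n + 1), b ((m + 1 : ℕ) : ZMod (2 * n + 2)) := by
  rw [Finset.sum_range_succ', add_comm, Nat.cast_zero]

/-- The operators of the generators `β i`. -/
def betaOp (j : ZMod (2 * n + 2)) : Module.End ℂ (MvPolynomial (GenIndex n) ℂ) :=
  if j = 0 then 1 - ∑ m ∈ Finset.range (2 * n + 1),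
    genOp (centralIndex n (some ((m + 1 : ℕ) : ZMod (2 * n + 2))))
  else genOp (centralIndex n (some j))

lemma betaOp_mem (j : ZMod (2 * n + 2)) : betaOp j ∈
    Algebra.adjoin ℂ (Set.range fun c => genOp (centralIndex n c)) := by
  unfold betaOp
  split_ifs
  · exact Subalgebra.sub_mem _ (Subalgebra.one_mem _)
      (Subalgebra.sum_mem _ fun _ _ => genOp_mem_adjoin _)
  · exact genOp_mem_adjoin _

lemma FAlg.rep_coreRel (hn : 1 ≤ n) : CoreRel (n := n) (noncentralOp 0) betaOp (genOp none) :=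
  noncentralOp_coreRel hn (fun _ => by rw [zero_mul, mul_zero]) betaOp_mem

lemma FAlg.rep_timeRel (hn : 1 ≤ n) : TimeRel (n := n) (noncentralOp 0) betaOp
    (genOp (centralIndex n (some 0))) (genOp none) := by
  -- A family whose values include both `t` and a chosen `β i` yields the commutation relations of
  -- `t` as instances of `CoreRel`.
  have H : ∀ i, CoreRel (n := n) (noncentralOp 0)
      (fun j => if j = 0 then genOp (centralIndex n (some 0)) else betaOp i) (genOp none) := fun i =>
    noncentralOp_coreRel hn (fun _ => by rw [zero_mul, mul_zero]) fun j => by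
      split_ifs
      exacts [genOp_mem_adjoin _, betaOp_mem i]
  have h0 : betaOp (0 : ZMod (2 * n + 2)) = 1 - ∑ m ∈ Finset.range (2 * n + 1),
      genOp (centralIndex n (some ((m + 1 : ℕ) : ZMod (2 * n + 2)))) := if_pos rfl
  refine ⟨fun i => ?_, fun i => ?_, ?_, ?_⟩
  · simpa using (H 0).p_b i 0
  · simpa [one_ne_zero_zmod] using (H i).b_b 1 0
  · simpa using ((H 0).b_h 0).symm
  · rw [sum_zmod_range_succ, h0, sub_add_eq_add_sub, sub_eq_iff_eq_add]
    refine congrArg (1 + ·) (Finset.sum_congr rfl fun m hm => ?_)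
    rw [Finset.mem_range] at hm
    exact if_neg (natCast_ne_zero_zmod (by omega) (by omega))

/-- The defining representation of `FAlg n`. -/
def FAlg.rep (hn : 1 ≤ n) : FAlg n →ₐ[ℂ] Module.End ℂ (MvPolynomial (GenIndex n) ℂ) :=
  FAlg.lift (FAlg.rep_coreRel hn) (noncentralOp_sumRel 0) (FAlg.rep_timeRel hn)

/-- The subalgebra generated by the free generators contains all generators. -/
lemma KAlg.gen_mem (x : KGen n) : KAlg.gen x ∈ Algebra.adjoin ℂ (Set.range KAlg.freeGen) := by
  cases x with
  | α j => exact Algebra.subset_adjoin ⟨some (.inl j), rfl⟩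
  | h => exact Algebra.subset_adjoin ⟨none, rfl⟩
  | f j =>
    exact noncentral_induction KAlg.sumRel
      (Algebra.adjoin ℂ (Set.range KAlg.freeGen)).toSubring.toAddSubgroup
      (Subalgebra.one_mem _)
      (fun j h0 h1 => Algebra.subset_adjoin ⟨some (.inr ⟨j, h0, h1⟩), rfl⟩) j

lemma TimeRel.zero_eq {R : Type*} [Ring R] {p b : ZMod (2 * n + 2) → R} {t h : R}
    (H : TimeRel p b t h) :
    b 0 = 1 - ∑ m ∈ Finset.range (2 * n + 1), b ((m + 1 : ℕ) : ZMod (2 * n + 2)) := by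
  rw [← H.sum_b, sum_zmod_range_succ, add_sub_cancel_right]

lemma FAlg.gen_mem (x : FGen n) : FAlg.gen x ∈ Algebra.adjoin ℂ (Set.range FAlg.freeGen) := by
  have hβ : ∀ j : ZMod (2 * n + 2), j ≠ 0 →
      FAlg.gen (.β j) ∈ Algebra.adjoin ℂ (Set.range FAlg.freeGen) := fun j hj =>
    Algebra.subset_adjoin ⟨some (.inl j), if_neg hj⟩
  cases x with
  | β j =>
    by_cases hj : j = 0
    · subst hj
      rw [FAlg.timeRel.zero_eq]
      refine Subalgebra.sub_mem _ (Subalgebra.one_mem _) (Subalgebra.sum_mem _ fun m hm => ?_)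
      rw [Finset.mem_range] at hm
      exact hβ _ (natCast_ne_zero_zmod (by omega) (by omega))
    · exact hβ j hj
  | h' => exact Algebra.subset_adjoin ⟨none, rfl⟩
  | t => exact Algebra.subset_adjoin ⟨some (.inl 0), FAlg.freeGen_zero⟩
  | φ j =>
    exact noncentral_induction FAlg.sumRel
      (Algebra.adjoin ℂ (Set.range FAlg.freeGen)).toSubring.toAddSubgroup
      (Subalgebra.zero_mem _)
      (fun j h0 h1 => Algebra.subset_adjoin ⟨some (.inr ⟨j, h0, h1⟩), rfl⟩) j

/-- The presentation of `KAlg n` by free generators. -/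
def KAlg.presentation (hn : 1 ≤ n) : WeylPresentation (KAlg n) (genOmega n) none where
  y := KAlg.freeGen
  adjoin_eq_top := by
    rw [eq_top_iff, ← KAlg.adjoin_gen, Algebra.adjoin_le_iff]
    rintro _ ⟨x, rfl⟩
    exact KAlg.gen_mem x
  comm i j := by
    have H := KAlg.coreRel hn
    rcases i with _ | i | i <;> rcases j with _ | j | j <;>
      simp only [KAlg.freeGen, genOmega, zero_smul, sub_eq_zero]
    · exact H.b_h j
    · exact H.p_h j
    · exact (H.b_h i).symm
    · exact H.b_b i j
    · exact (H.p_b j i).symm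
    · exact (H.p_h i).symm
    · exact H.p_b i j
    · exact (H.comm i j).trans (Int.cast_smul_eq_zsmul ℂ (orient i.1 j.1) _).symm
  antisymm := genOmega_antisymm hn
  central := genOmega_none
  ρ := KAlg.rep hn
  ρ_y i := by
    rcases i with _ | i | i
    · exact KAlg.lift_h _ _
    · exact KAlg.lift_α _ _ i
    · exact (KAlg.lift_f _ _ i.1).trans (noncentralOp_of_ne 1 i.2)

/-- The presentation of `FAlg n` by free generators. -/
def FAlg.presentation (hn : 1 ≤ n) : WeylPresentation (FAlg n) (genOmega n) none where
  y := FAlg.freeGen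
  adjoin_eq_top := by
    rw [eq_top_iff, ← FAlg.adjoin_gen, Algebra.adjoin_le_iff]
    rintro _ ⟨x, rfl⟩
    exact FAlg.gen_mem x
  comm i j := by
    have H := FAlg.coreRel hn
    have Ht := FAlg.timeRel (n := n)
    have h1 : ∀ j : ZMod (2 * n + 2), FAlg.gen .h' * (if j = 0 then FAlg.gen .t else FAlg.gen (.β j)) =
        (if j = 0 then FAlg.gen .t else FAlg.gen (.β j)) * FAlg.gen .h' := by
      intro j; split_ifs
      exacts [Ht.t_h.symm, H.b_h j]
    have h2 : ∀ i j : ZMod (2 * n + 2),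
        FAlg.gen (.φ i) * (if j = 0 then FAlg.gen .t else FAlg.gen (.β j)) =
        (if j = 0 then FAlg.gen .t else FAlg.gen (.β j)) * FAlg.gen (.φ i) := by
      intro i j; split_ifs
      exacts [Ht.p_t i, H.p_b i j]
    have h3 : ∀ i j : ZMod (2 * n + 2),
        (if i = 0 then FAlg.gen .t else FAlg.gen (.β i)) *
          (if j = 0 then FAlg.gen .t else FAlg.gen (.β j)) =
        (if j = 0 then FAlg.gen .t else FAlg.gen (.β j)) *
          (if i = 0 then FAlg.gen .t else FAlg.gen (.β i)) := by
      intro i j; split_ifs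
      exacts [rfl, (Ht.b_t j).symm, Ht.b_t i, H.b_b i j]
    rcases i with _ | i | i <;> rcases j with _ | j | j <;>
      simp only [FAlg.freeGen, genOmega, zero_smul, sub_eq_zero]
    · exact h1 j
    · exact H.p_h j
    · exact (h1 i).symm
    · exact h3 i j
    · exact (h2 j i).symm
    · exact (H.p_h i).symm
    · exact h2 i j
    · exact (H.comm i j).trans (Int.cast_smul_eq_zsmul ℂ (orient i.1 j.1) _).symm
  antisymm := genOmega_antisymm hn
  central := genOmega_none
  ρ := FAlg.rep hn
  ρ_y i := by
    rcases i with _ | i | i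
    · exact FAlg.lift_h' _ _ _
    · by_cases hi : i = 0
      · subst hi
        exact (congrArg _ FAlg.freeGen_zero).trans (FAlg.lift_t _ _ _)
      · refine (congrArg _ (if_neg hi)).trans ((FAlg.lift_β _ _ _ i).trans ?_)
        exact if_neg hi
    · exact (FAlg.lift_φ _ _ _ i.1).trans (noncentralOp_of_ne 0 i.2)

end Presentations

/-! ### `K` and `F` are skew fields -/

section SkewFields

lemma KAlg.isDomain (hn : 1 ≤ n) : IsDomain (KAlg n) := (KAlg.presentation hn).isDomain

lemma FAlg.isDomain (hn : 1 ≤ n) : IsDomain (FAlg n) := (FAlg.presentation hn).isDomain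

lemma K.isUnit_of_ne_zero (hn : 1 ≤ n) (x : K n) (hx : x ≠ 0) : IsUnit x :=
  have := KAlg.isDomain hn
  SkewFrac.isUnit_of_ne_zero (KAlg.presentation hn).leftOre hx

lemma F.isUnit_of_ne_zero (hn : 1 ≤ n) (x : F n) (hx : x ≠ 0) : IsUnit x :=
  have := FAlg.isDomain hn
  SkewFrac.isUnit_of_ne_zero (FAlg.presentation hn).leftOre hx

lemma K.ofHom_injective (hn : 1 ≤ n) : Function.Injective (SkewFrac.ofHom (KAlg n)) :=
  have := KAlg.isDomain hn
  SkewFrac.of_injective (KAlg.presentation hn).leftOre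

lemma F.ofHom_injective (hn : 1 ≤ n) : Function.Injective (SkewFrac.ofHom (FAlg n)) :=
  have := FAlg.isDomain hn
  SkewFrac.of_injective (FAlg.presentation hn).leftOre

lemma CoreRel.map {R S : Type*} [Ring R] [Ring S] {p b : ZMod (2 * n + 2) → R} {h : R}
    (H : CoreRel p b h) (g : R →+* S) : CoreRel (fun i => g (p i)) (fun i => g (b i)) (g h) where
  comm i j := by rw [← map_mul, ← map_mul, ← map_sub, H.comm, map_zsmul]
  p_b i j := by rw [← map_mul, H.p_b, map_mul]
  b_b i j := by rw [← map_mul, H.b_b, map_mul]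
  p_h i := by rw [← map_mul, H.p_h, map_mul]
  b_h i := by rw [← map_mul, H.b_h, map_mul]

lemma SumRel.map {R S : Type*} [Ring R] [Ring S] {p : ZMod (2 * n + 2) → R} {c : R}
    (H : SumRel p c) (g : R →+* S) : SumRel (fun i => g (p i)) (g c) where
  even := by rw [← H.even, map_sum]
  odd := by rw [← H.odd, map_sum]

lemma TimeRel.map {R S : Type*} [Ring R] [Ring S] {p b : ZMod (2 * n + 2) → R} {t h : R}
    (H : TimeRel p b t h) (g : R →+* S) :
    TimeRel (fun i => g (p i)) (fun i => g (b i)) (g t) (g h) where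
  p_t i := by rw [← map_mul, H.p_t, map_mul]
  b_t i := by rw [← map_mul, H.b_t, map_mul]
  t_h := by rw [← map_mul, H.t_h, map_mul]
  sum_b := by rw [← map_sum, H.sum_b, map_one]

lemma K.coreRel (hn : 1 ≤ n) : CoreRel (n := n) f α h :=
  (KAlg.coreRel hn).map (SkewFrac.ofHom (KAlg n) : KAlg n →+* K n)

lemma K.sumRel : SumRel (n := n) f 1 := by
  have := (KAlg.sumRel (n := n)).map (SkewFrac.ofHom (KAlg n) : KAlg n →+* K n)
  rwa [map_one] at this

lemma F.coreRel (hn : 1 ≤ n) : CoreRel (n := n) φ β h' :=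
  (FAlg.coreRel hn).map (SkewFrac.ofHom (FAlg n) : FAlg n →+* F n)

lemma F.sumRel : SumRel (n := n) φ 0 := by
  have := (FAlg.sumRel (n := n)).map (SkewFrac.ofHom (FAlg n) : FAlg n →+* F n)
  rwa [map_zero] at this

lemma F.timeRel : TimeRel (n := n) φ β t h' :=
  (FAlg.timeRel).map (SkewFrac.ofHom (FAlg n) : FAlg n →+* F n)

/-- Homomorphisms of `K` are determined by their values on the generators. -/
lemma K.hom_ext {B : Type*} [Ring B] [Algebra ℂ B] {g₁ g₂ : K n →ₐ[ℂ] B}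
    (hf : ∀ i, g₁ (f i) = g₂ (f i)) (hα : ∀ i, g₁ (α i) = g₂ (α i)) (hh : g₁ h = g₂ h) :
    g₁ = g₂ := by
  refine SkewFrac.hom_ext fun a => ?_
  have : g₁.comp (SkewFrac.ofHom (KAlg n)) = g₂.comp (SkewFrac.ofHom (KAlg n)) := by
    refine AlgHom.ext_of_adjoin_eq_top KAlg.adjoin_gen ?_
    rintro _ ⟨x, rfl⟩
    cases x with
    | f i => exact hf i
    | α i => exact hα i
    | h => exact hh
  exact congrArg (fun g => g a) this

/-- A subset of `F` closed under the ring operations and inverses that contains the generators is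
everything. -/
lemma F.induction {p : F n → Prop} (hscal : ∀ c : ℂ, p (algebraMap ℂ (F n) c))
    (hφ : ∀ i, p (φ i)) (hβ : ∀ i, p (β i)) (ht : p t)
    (hh : p h') (hadd : ∀ x y, p x → p y → p (x + y)) (hmul : ∀ x y, p x → p y → p (x * y))
    (hinv : ∀ x y, x * y = 1 → y * x = 1 → p x → p y) (x : F n) : p x := by
  induction x using SkewFrac.induction with
  | hof a =>
    have ha : a ∈ Algebra.adjoin ℂ (Set.range (FAlg.gen (n := n))) := by
      rw [FAlg.adjoin_gen]; trivial
    rw [← SkewFrac.ofHom_apply]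
    induction ha using Algebra.adjoin_induction with
    | mem x hx =>
      obtain ⟨x, rfl⟩ := hx
      cases x with
      | φ i => exact hφ i
      | β i => exact hβ i
      | t => exact ht
      | h' => exact hh
    | algebraMap c => rw [AlgHom.commutes]; exact hscal c
    | add x y _ _ hx hy => rw [map_add]; exact hadd _ _ hx hy
    | mul x y _ _ hx hy => rw [map_mul]; exact hmul _ _ hx hy
  | hinv a ha h => exact hinv _ _ (SkewFrac.of_mul_inv a ha) (SkewFrac.inv_mul_of a ha) h
  | hadd x y hx hy => exact hadd x y hx hy
  | hmul x y hx hy => exact hmul x y hx hy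

lemma F.hom_ext {B : Type*} [Ring B] [Algebra ℂ B] {g₁ g₂ : F n →ₐ[ℂ] B}
    (hφ : ∀ i, g₁ (φ i) = g₂ (φ i)) (hβ : ∀ i, g₁ (β i) = g₂ (β i)) (ht : g₁ t = g₂ t)
    (hh : g₁ h' = g₂ h') : g₁ = g₂ := by
  ext x
  induction x using F.induction with
  | hscal c => rw [AlgHom.commutes, AlgHom.commutes]
  | hφ i => exact hφ i
  | hβ i => exact hβ i
  | ht => exact ht
  | hh => exact hh
  | hadd x y hx hy => rw [map_add, map_add, hx, hy]
  | hmul x y hx hy => rw [map_mul, map_mul, hx, hy]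
  | hinv x y hxy hyx hx =>
    have h1 : g₁ y * g₁ x = 1 := by rw [← map_mul, hyx, map_one]
    have h2 : g₂ x * g₂ y = 1 := by rw [← map_mul, hxy, map_one]
    rw [hx] at h1
    exact left_inv_eq_right_inv h1 h2

/-- The central generators of `KAlg n`. -/
def KAlg.central : Option (ZMod (2 * n + 2)) → KAlg n
  | none => KAlg.gen .h
  | some j => KAlg.gen (.α j)

/-- The central generators of `FAlg n`. -/
def FAlg.central : Option (ZMod (2 * n + 2)) → FAlg n
  | none => FAlg.gen .h'
  | some j => if j = 0 then FAlg.gen .t else FAlg.gen (.β j)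

lemma WeylPresentation.mem_center {A : Type} [Ring A] [Algebra ℂ A] {ι : Type} {ω : ι → ι → ℂ}
    {z : ι} (H : WeylPresentation A ω z) {c : ι} (hc : ∀ i, ω i c = 0) :
    H.y c ∈ Subalgebra.center ℂ A := by
  rw [Subalgebra.mem_center_iff]
  intro a
  have ha : a ∈ Algebra.adjoin ℂ (Set.range H.y) := by rw [H.adjoin_eq_top]; trivial
  induction ha using Algebra.adjoin_induction with
  | mem x hx =>
    obtain ⟨i, rfl⟩ := hx
    have := H.comm i c
    rwa [hc, zero_smul, sub_eq_zero] at this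
  | algebraMap r => exact Algebra.commutes r _
  | add x y _ _ hx hy => rw [mul_add, add_mul, hx, hy]
  | mul x y _ _ hx hy => rw [mul_assoc, hy, ← mul_assoc, hx, mul_assoc]

lemma KAlg.central_mem (hn : 1 ≤ n) (c) : KAlg.central c ∈ Subalgebra.center ℂ (KAlg n) := by
  have := (KAlg.presentation hn).mem_center (genOmega_central c)
  rcases c with _ | c <;> exact this

lemma FAlg.central_mem (hn : 1 ≤ n) (c) : FAlg.central c ∈ Subalgebra.center ℂ (FAlg n) := by
  have := (FAlg.presentation hn).mem_center (genOmega_central c)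
  rcases c with _ | c <;> exact this

lemma KAlg.algebraicIndependent (hn : 1 ≤ n) : AlgebraicIndependent ℂ
    fun c => (⟨KAlg.central c, KAlg.central_mem hn c⟩ : Subalgebra.center ℂ (KAlg n)) :=
  (KAlg.presentation hn).algebraicIndependent_central centralIndex_injective
    (fun j i => genOmega_central j i) (Subalgebra.val _) _ fun c => by rcases c with _ | c <;> rfl

lemma FAlg.algebraicIndependent (hn : 1 ≤ n) : AlgebraicIndependent ℂ
    fun c => (⟨FAlg.central c, FAlg.central_mem hn c⟩ : Subalgebra.center ℂ (FAlg n)) :=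
  (FAlg.presentation hn).algebraicIndependent_central centralIndex_injective
    (fun j i => genOmega_central j i) (Subalgebra.val _) _ fun c => by rcases c with _ | c <;> rfl

/-- The extensions to the skew field below use this criterion: only the images of the parameters
have to be inspected, and they must be algebraically independent. -/
lemma KAlg.hom_injective (hn : 1 ≤ n) {B : Type*} [Ring B] [Algebra ℂ B] (g : KAlg n →ₐ[ℂ] B)
    {R : Type*} [CommRing R] [Algebra ℂ R] (θ : R →ₐ[ℂ] B) (hθ : Function.Injective θ)
    (η : Option (ZMod (2 * n + 2)) → R) (hg : ∀ c, g (KAlg.central c) = θ (η c))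
    (hη : AlgebraicIndependent ℂ η) : Function.Injective g :=
  (KAlg.presentation hn).injective_of_central centralIndex_injective
    (fun j i => genOmega_central j i) (genOmega_nondeg hn) g θ hθ η
    (fun c => by rw [← hg]; rcases c with _ | c <;> rfl) hη

lemma FAlg.hom_injective (hn : 1 ≤ n) {B : Type*} [Ring B] [Algebra ℂ B] (g : FAlg n →ₐ[ℂ] B)
    {R : Type*} [CommRing R] [Algebra ℂ R] (θ : R →ₐ[ℂ] B) (hθ : Function.Injective θ)
    (η : Option (ZMod (2 * n + 2)) → R) (hg : ∀ c, g (FAlg.central c) = θ (η c))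
    (hη : AlgebraicIndependent ℂ η) : Function.Injective g :=
  (FAlg.presentation hn).injective_of_central centralIndex_injective
    (fun j i => genOmega_central j i) (genOmega_nondeg hn) g θ hθ η
    (fun c => by rw [← hg]; rcases c with _ | c <;> rfl) hη

end SkewFields

end QPainleve
end

noncomputable section
namespace QPainleve

open MvPolynomial

variable {n : ℕ}

/-! ### The automorphisms of `K` -/

section Lift

variable {B : Type*} [Ring B] [Algebra ℂ B] {p b : ZMod (2 * n + 2) → B} {h₀ : B}
  (H : CoreRel p b h₀) (hs : SumRel p 1) (hu : ∀ a, a ≠ 0 → IsUnit (KAlg.lift H hs a))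

/-- The homomorphism from `K` with given values on the generators. -/
def K.lift : K n →ₐ[ℂ] B := SkewFrac.lift (KAlg.lift H hs) hu

lemma K.lift_f (i : ZMod (2 * n + 2)) : K.lift H hs hu (f i) = p i :=
  (SkewFrac.lift_of _ _ _).trans (KAlg.lift_f H hs i)

lemma K.lift_α (i : ZMod (2 * n + 2)) : K.lift H hs hu (α i) = b i :=
  (SkewFrac.lift_of _ _ _).trans (KAlg.lift_α H hs i)

lemma K.lift_h : K.lift H hs hu h = h₀ :=
  (SkewFrac.lift_of _ _ _).trans (KAlg.lift_h H hs)

end Lift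

lemma K.h_ne_zero (hn : 1 ≤ n) : (h : K n) ≠ 0 := by
  intro h0
  have h1 : KAlg.gen (n := n) .h = 0 := K.ofHom_injective hn (h0.trans (map_zero _).symm)
  exact (KAlg.algebraicIndependent hn).ne_zero none (Subtype.ext h1)

lemma K.f_ne_zero (hn : 1 ≤ n) (i : ZMod (2 * n + 2)) : (f i : K n) ≠ 0 := by
  intro h0
  have := (K.coreRel hn).comm i (i + 1)
  rw [h0, zero_mul, mul_zero, sub_zero, orient_succ, one_smul] at this
  exact K.h_ne_zero hn this.symm

lemma K.isUnit_f (hn : 1 ≤ n) (i : ZMod (2 * n + 2)) : IsUnit (f i : K n) :=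
  K.isUnit_of_ne_zero hn _ (K.f_ne_zero hn i)

lemma sum_orient_even' (hn : 1 ≤ n) (j : ZMod (2 * n + 2)) :
    ∑ m ∈ Finset.range (n + 1), orient j ((2 * m : ℕ) : ZMod (2 * n + 2)) = 0 := by
  rw [← neg_eq_zero, ← sum_orient_even hn j, ← Finset.sum_neg_distrib]
  exact Finset.sum_congr rfl fun m _ => (orient_antisymm hn _ _).symm

lemma sum_orient_odd' (hn : 1 ≤ n) (j : ZMod (2 * n + 2)) :
    ∑ m ∈ Finset.range (n + 1), orient j ((2 * m + 1 : ℕ) : ZMod (2 * n + 2)) = 0 := by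
  rw [← neg_eq_zero, ← sum_orient_odd hn j, ← Finset.sum_neg_distrib]
  exact Finset.sum_congr rfl fun m _ => (orient_antisymm hn _ _).symm

section Reflection

variable {R : Type*} [Ring R] {p b : ZMod (2 * n + 2) → R} {h₀ : R} {i : ZMod (2 * n + 2)} {g : R}

/-- The elementary Bäcklund transformations preserve the relations. -/
lemma CoreRel.reflect (H : CoreRel p b h₀) (h1 : p i * g = 1) (h2 : g * p i = 1) :
    CoreRel (fun j => p j + orient i j • (b i * g)) (fun j => b j - cartan i j • b i) h₀ := by
  have inv_comm : ∀ x, p i * x = x * p i → g * x = x * g := by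
    intro x hx
    calc g * x = g * (x * p i) * g := by rw [mul_assoc, mul_assoc, h1, mul_one]
      _ = x * g := by rw [← hx, ← mul_assoc, h2, one_mul]
  have hgb : ∀ j, g * b j = b j * g := fun j => inv_comm _ (H.p_b i j)
  have hgh : g * h₀ = h₀ * g := inv_comm _ (H.p_h i).symm
  -- Conjugating the relation by `g = (p i)⁻¹` gives `[p j, g] = g [p i, p j] g`.
  have key : ∀ j, p j * (b i * g) - b i * g * p j = orient i j • (b i * (h₀ * g * g)) := by
    intro j
    have h3 : p j * g - g * p j = orient i j • (h₀ * g * g) := by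
      calc p j * g - g * p j = g * (p i * p j - p j * p i) * g := by
            rw [mul_sub, sub_mul, ← mul_assoc, h2, one_mul]
            simp only [mul_assoc, h1, mul_one]
        _ = orient i j • (h₀ * g * g) := by
            rw [H.comm, mul_smul_comm, smul_mul_assoc, hgh]
    rw [← mul_assoc, H.p_b, mul_assoc, mul_assoc, ← mul_sub, h3, mul_smul_comm]
  have hbb : ∀ j k, (b j - cartan i j • b i) * b k = b k * (b j - cartan i j • b i) := by
    intro j k
    rw [sub_mul, mul_sub, smul_mul_assoc, mul_smul_comm, H.b_b j k, H.b_b i k]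
  have hpb : ∀ j k, (p j + orient i j • (b i * g)) * b k = b k * (p j + orient i j • (b i * g)) := by
    intro j k
    rw [add_mul, mul_add, smul_mul_assoc, mul_smul_comm, H.p_b j k, mul_assoc, hgb, ← mul_assoc,
      H.b_b, mul_assoc]
  refine ⟨fun j k => ?_, fun j k => ?_, fun j k => ?_, fun j => ?_, fun j => ?_⟩
  · have e : (p j + orient i j • (b i * g)) * (p k + orient i k • (b i * g)) -
        (p k + orient i k • (b i * g)) * (p j + orient i j • (b i * g)) =
        (p j * p k - p k * p j) + orient i k • (p j * (b i * g) - b i * g * p j)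
          - orient i j • (p k * (b i * g) - b i * g * p k) := by
      simp only [add_mul, mul_add, smul_mul_assoc, mul_smul_comm, smul_sub,
        smul_add, smul_smul, mul_comm (orient i k) (orient i j)]
      abel
    -- Both corrections are `orient i j * orient i k` times the same element, with opposite signs.
    rw [e, H.comm, key, key, smul_comm (orient i k), add_sub_cancel_right]
  · rw [mul_sub, sub_mul, hpb, mul_smul_comm, smul_mul_assoc, hpb]
  · rw [mul_sub, mul_smul_comm, hbb, hbb, ← smul_mul_assoc, ← sub_mul]
  · rw [add_mul, mul_add, smul_mul_assoc, mul_smul_comm, H.p_h, ← mul_assoc, H.b_h, mul_assoc,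
      ← hgh, mul_assoc]
  · rw [sub_mul, mul_sub, smul_mul_assoc, mul_smul_comm, H.b_h, H.b_h]

lemma SumRel.reflect (hn : 1 ≤ n) {c : R} (hs : SumRel p c) (i : ZMod (2 * n + 2)) (x : R) :
    SumRel (fun j => p j + orient i j • x) c := by
  constructor
  · rw [Finset.sum_add_distrib, hs.even, ← Finset.sum_smul, sum_orient_even' hn, zero_smul, add_zero]
  · rw [Finset.sum_add_distrib, hs.odd, ← Finset.sum_smul, sum_orient_odd' hn, zero_smul, add_zero]

lemma CoreRel.rotate (H : CoreRel p b h₀) : CoreRel (fun j => p (j + 1)) (fun j => b (j + 1)) h₀ := by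
  refine ⟨fun i j => ?_, fun i j => H.p_b _ _, fun i j => H.b_b _ _, fun i => H.p_h _,
    fun i => H.b_h _⟩
  rw [H.comm]
  congr 1
  simp only [orient, add_left_inj, add_sub_right_comm]

lemma SumRel.rotate {c : R} (hs : SumRel p c) : SumRel (fun j => p (j + 1)) c := by
  constructor
  · rw [← hs.odd]
    exact Finset.sum_congr rfl fun m _ => by rw [Nat.cast_succ]
  · rw [← hs.even, Finset.sum_range_succ]
    conv_rhs => rw [Finset.sum_range_succ']
    congr 1
    · refine Finset.sum_congr rfl fun m _ => ?_
      rw [← Nat.cast_succ]; rfl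
    · rw [← Nat.cast_succ, mul_zero, Nat.cast_zero]
      exact congrArg p two_mul_add_two_eq_zero

end Reflection

lemma cartan_self {N : ℕ} (i : ZMod N) : cartan i i = 2 := by simp [cartan]

lemma algebraicIndependent_aeval {ι R : Type*} [CommRing R] [Algebra ℂ R] {η : ι → R}
    (hη : AlgebraicIndependent ℂ η) (L : MvPolynomial ι ℂ →ₐ[ℂ] MvPolynomial ι ℂ)
    (hL : Function.Injective L) : AlgebraicIndependent ℂ fun c => aeval η (L (X c)) := by
  have : (aeval fun c => aeval η (L (X c))) = (aeval η).comp L := by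
    ext c; simp
  rw [AlgebraicIndependent, this, AlgHom.coe_comp]
  exact Function.Injective.comp hη hL

/-- The linear substitution of a reflection. -/
def reflectPoly {N : ℕ} (i : ZMod N) :
    MvPolynomial (Option (ZMod N)) ℂ →ₐ[ℂ] MvPolynomial (Option (ZMod N)) ℂ :=
  aeval fun c => match c with
    | none => X none
    | some j => X (some j) - cartan i j • X (some i)

/-- The substitution is an involution because the diagonal Cartan entry is `2`. -/
lemma reflectPoly_injective {N : ℕ} (i : ZMod N) : Function.Injective (reflectPoly i) := by
  have : (reflectPoly i).comp (reflectPoly i) = AlgHom.id ℂ _ := by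
    ext1 c
    rcases c with _ | j
    · simp [reflectPoly]
    · simp only [reflectPoly, AlgHom.comp_apply, aeval_X, map_sub, map_zsmul, cartan_self,
        AlgHom.id_apply]
      rw [smul_sub, smul_smul, mul_comm, mul_smul, two_smul]
      abel
  exact Function.LeftInverse.injective (g := reflectPoly i) fun x => congrArg (fun g => g x) this

/-- The inclusion of the center of `KAlg n` in `K n`. -/
def K.centerHom (n : ℕ) : Subalgebra.center ℂ (KAlg n) →ₐ[ℂ] K n :=
  (SkewFrac.ofHom (KAlg n)).comp (Subalgebra.val _)

lemma K.centerHom_injective (hn : 1 ≤ n) : Function.Injective (K.centerHom n) :=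
  (K.ofHom_injective hn).comp Subtype.val_injective

lemma isUnit_of_injective {A B : Type*} [Ring A] [Ring B] [Algebra ℂ A] [Algebra ℂ B]
    (hB : ∀ x : B, x ≠ 0 → IsUnit x) {g : A →ₐ[ℂ] B} (hg : Function.Injective g) (a : A)
    (ha : a ≠ 0) : IsUnit (g a) :=
  hB _ fun h => ha (hg (h.trans (map_zero g).symm))

lemma K.f_mul_inverse (hn : 1 ≤ n) (i : ZMod (2 * n + 2)) : (f i : K n) * Ring.inverse (f i) = 1 :=
  Ring.mul_inverse_cancel _ (K.isUnit_f hn i)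

lemma K.inverse_mul_f (hn : 1 ≤ n) (i : ZMod (2 * n + 2)) : Ring.inverse (f i) * (f i : K n) = 1 :=
  Ring.inverse_mul_cancel _ (K.isUnit_f hn i)

/-- The reflection `s i` as a homomorphism. -/
def K.reflect (hn : 1 ≤ n) (i : ZMod (2 * n + 2)) : K n →ₐ[ℂ] K n :=
  K.lift ((K.coreRel hn).reflect (i := i) (K.f_mul_inverse hn i) (K.inverse_mul_f hn i))
    (K.sumRel.reflect hn i _) <| by
    refine isUnit_of_injective (K.isUnit_of_ne_zero hn) ?_
    refine KAlg.hom_injective hn _ (K.centerHom n) (K.centerHom_injective hn) _ (fun c => ?_)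
      (algebraicIndependent_aeval (KAlg.algebraicIndependent hn) (reflectPoly i)
        (reflectPoly_injective i))
    rcases c with _ | j
    · rw [reflectPoly, aeval_X, aeval_X]
      exact KAlg.lift_h _ _
    · rw [reflectPoly, aeval_X, map_sub, map_zsmul, aeval_X, aeval_X, map_sub, map_zsmul]
      exact KAlg.lift_α _ _ j

lemma map_ringInverse {A B : Type*} [Ring A] [Ring B] [Algebra ℂ A] [Algebra ℂ B] (g : A →ₐ[ℂ] B)
    {x : A} (hx : IsUnit x) : g (Ring.inverse x) = Ring.inverse (g x) := by
  obtain ⟨u, rfl⟩ := hx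
  rw [Ring.inverse_unit]
  exact (Ring.inverse_unit (Units.map (g : A →* B) u)).symm

/-- The reflection fixes `f i` and negates `α i`, so the correction term is undone by the second
application. This supplies the inverse of `s i`. -/
lemma K.reflect_reflect (hn : 1 ≤ n) (i : ZMod (2 * n + 2)) :
    (K.reflect hn i).comp (K.reflect hn i) = AlgHom.id ℂ (K n) := by
  have hf : ∀ j, K.reflect hn i (f j) = f j + orient i j • (α i * Ring.inverse (f i)) :=
    K.lift_f _ _ _
  have hα : ∀ j, K.reflect hn i (α j) = α j - cartan i j • α i := K.lift_α _ _ _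
  have hα' : K.reflect hn i (α i) = - α i := by
    rw [hα, cartan_self, two_smul]; abel
  refine K.hom_ext (fun j => ?_) (fun j => ?_) ?_
  · rw [AlgHom.comp_apply, hf, map_add, map_zsmul, map_mul, hα', map_ringInverse _ (K.isUnit_f hn i),
      hf, hf, orient_self hn, zero_smul, add_zero, neg_mul, smul_neg, add_neg_cancel_right]
    rfl
  · rw [AlgHom.comp_apply, hα, map_sub, map_zsmul, hα', hα, smul_neg, sub_neg_eq_add,
      sub_add_cancel]
    rfl
  · have hh : K.reflect hn i h = h := K.lift_h _ _ _
    rw [AlgHom.comp_apply, hh, hh]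
    rfl

/-- The rotation `π` as a homomorphism. -/
def K.rotate (hn : 1 ≤ n) : K n →ₐ[ℂ] K n :=
  K.lift (K.coreRel hn).rotate K.sumRel.rotate <| by
    refine isUnit_of_injective (K.isUnit_of_ne_zero hn) ?_
    refine KAlg.hom_injective hn _ (K.centerHom n) (K.centerHom_injective hn) _ (fun c => ?_)
      ((KAlg.algebraicIndependent hn).comp (Option.map (· + 1))
        (Option.map_injective (add_left_injective 1)))
    rcases c with _ | j
    · exact KAlg.lift_h _ _
    · exact KAlg.lift_α _ _ j

/-- The inverse of the rotation is its power with exponent `2 n + 1`. -/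
lemma K.rotate_pow (hn : 1 ≤ n) : (K.rotate hn) ^ (2 * n + 2) = 1 := by
  have hf : ∀ (k : ℕ) j, ((K.rotate hn) ^ k) (f j) = f (j + (k : ZMod (2 * n + 2))) := by
    intro k
    induction k with
    | zero => intro j; simp
    | succ k ih =>
      intro j
      rw [pow_succ, AlgHom.mul_apply, show K.rotate hn (f j) = f (j + 1) from K.lift_f _ _ _ j, ih]
      congr 1
      push_cast; ring
  have hα : ∀ (k : ℕ) j, ((K.rotate hn) ^ k) (α j) = α (j + (k : ZMod (2 * n + 2))) := by
    intro k
    induction k with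
    | zero => intro j; simp
    | succ k ih =>
      intro j
      rw [pow_succ, AlgHom.mul_apply, show K.rotate hn (α j) = α (j + 1) from K.lift_α _ _ _ j, ih]
      congr 1
      push_cast; ring
  have hh : ∀ k : ℕ, ((K.rotate hn) ^ k) h = h := by
    intro k
    induction k with
    | zero => simp
    | succ k ih =>
      rw [pow_succ, AlgHom.mul_apply, show K.rotate hn h = h from K.lift_h _ _ _, ih]
  refine K.hom_ext (fun j => ?_) (fun j => ?_) (hh (2 * n + 2))
  · rw [hf, two_mul_add_two_eq_zero, add_zero]; rfl
  · rw [hα, two_mul_add_two_eq_zero, add_zero]; rfl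

/-- The action of the generators of the extended affine Weyl group on `K`. -/
def weylAction (hn : 1 ≤ n) : WeylAction n where
  s i := AlgEquiv.ofAlgHom (K.reflect hn i) (K.reflect hn i) (K.reflect_reflect hn i)
    (K.reflect_reflect hn i)
  π := AlgEquiv.ofAlgHom (K.rotate hn) ((K.rotate hn) ^ (2 * n + 1))
    ((pow_succ' (K.rotate hn) (2 * n + 1)).symm.trans (K.rotate_pow hn))
    ((pow_succ (K.rotate hn) (2 * n + 1)).symm.trans (K.rotate_pow hn))
  s_f _ j := K.lift_f _ _ _ j
  s_α _ j := K.lift_α _ _ _ j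
  s_h _ := K.lift_h _ _ _
  π_f j := K.lift_f _ _ _ j
  π_α j := K.lift_α _ _ _ j
  π_h := K.lift_h _ _ _

end QPainleve
end

noncomputable section
namespace QPainleve

open MvPolynomial

variable {n : ℕ}

/-! ### The homomorphism `Ψ` -/

/-! ### Central elements of `F` and of its power series. -/

section CentralElements

lemma F.central_comm {c : F n} (hφ : ∀ i, c * φ i = φ i * c) (hβ : ∀ i, c * β i = β i * c)
    (ht : c * t = t * c) (hh : c * h' = h' * c) (x : F n) : c * x = x * c := by
  induction x using F.induction with
  | hscal r => exact (Algebra.commutes r c).symm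
  | hφ i => exact hφ i
  | hβ i => exact hβ i
  | ht => exact ht
  | hh => exact hh
  | hadd x y hx hy => rw [mul_add, add_mul, hx, hy]
  | hmul x y hx hy => rw [← mul_assoc, hx, mul_assoc, hy, mul_assoc]
  | hinv x y hxy hyx hx =>
    calc c * y = y * (x * c) * y := by rw [← mul_assoc, hyx, one_mul]
      _ = y * c := by rw [← hx, mul_assoc, mul_assoc, hxy, mul_one]

lemma F.β_comm (hn : 1 ≤ n) (i : ZMod (2 * n + 2)) (x : F n) : β i * x = x * β i :=
  F.central_comm (fun j => ((F.coreRel hn).p_b j i).symm) (fun j => (F.coreRel hn).b_b i j)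
    (F.timeRel.b_t i) ((F.coreRel hn).b_h i).symm x

lemma F.γ_comm (hn : 1 ≤ n) (i : ZMod (2 * n + 1)) (x : F n) : γ i * x = x * γ i := by
  unfold γ
  split_ifs
  · rw [add_mul, mul_add, F.β_comm hn, F.β_comm hn 1]
  · exact F.β_comm hn _ x

lemma F.t_comm (x : F n) : t * x = x * t :=
  F.central_comm (fun j => (F.timeRel.p_t j).symm) (fun j => (F.timeRel.b_t j).symm)
    rfl F.timeRel.t_h x

lemma F.h'_comm (hn : 1 ≤ n) (x : F n) : h' * x = x * h' :=
  F.central_comm (fun j => (F.coreRel hn).p_h j) (fun j => (F.coreRel hn).b_h j)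
    F.timeRel.t_h.symm rfl x

lemma C_comm {A : Type*} [Semiring A] {c : A} (hc : ∀ x, c * x = x * c) (s : PowerSeries A) :
    PowerSeries.C c * s = s * PowerSeries.C c := by
  ext m
  rw [PowerSeries.coeff_C_mul, PowerSeries.coeff_mul_C, hc]

lemma X_comm {A : Type*} [Semiring A] (s : PowerSeries A) :
    PowerSeries.X * s = s * PowerSeries.X := PowerSeries.commute_X s |>.symm

lemma X_mul_cancel {A : Type*} [Semiring A] {s u : PowerSeries A}
    (h : PowerSeries.X * s = PowerSeries.X * u) : s = u := by
  ext m
  have := congrArg (PowerSeries.coeff (m + 1)) h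
  rwa [PowerSeries.coeff_succ_X_mul, PowerSeries.coeff_succ_X_mul] at this

end CentralElements

/-- The constant term of the image of `f j`. -/
def delta (j : ZMod (2 * n + 2)) : ℤ := if j = 0 ∨ j = 1 then 1 else 0

lemma delta_zero : delta (0 : ZMod (2 * n + 2)) = 1 := by simp [delta]

lemma delta_one : delta (1 : ZMod (2 * n + 2)) = 1 := by simp [delta]

lemma delta_of_ne {j : ZMod (2 * n + 2)} (h0 : j ≠ 0) (h1 : j ≠ 1) : delta j = 0 := by
  simp [delta, h0, h1]

lemma delta_sumRel {R : Type*} [Ring R] :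
    SumRel (fun j : ZMod (2 * n + 2) => ((delta j : ℤ) : R)) 1 := by
  refine sumRel_of_eq ?_ ?_
  · rw [delta_zero, Finset.sum_eq_zero, sub_zero, Int.cast_one]
    intro m hm
    rw [Finset.mem_range] at hm
    rw [delta_of_ne (natCast_ne_zero_zmod (by omega) (by omega))
      (natCast_ne_one_zmod (by omega) (by omega)), Int.cast_zero]
  · rw [delta_one, Finset.sum_eq_zero, sub_zero, Int.cast_one]
    intro m hm
    rw [Finset.mem_range] at hm
    rw [delta_of_ne (natCast_ne_zero_zmod (by omega) (by omega))
      (natCast_ne_one_zmod (by omega) (by omega)), Int.cast_zero]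

/-- The power series with image `Ψ (f j)`. -/
def fSeries (j : ZMod (2 * n + 2)) : PowerSeries (F n) :=
  ((delta j : ℤ) : PowerSeries (F n)) + PowerSeries.X * PowerSeries.C (φ j)

/-- The constant and linear terms of `Ψ (α j)`, as multiples of `1` and `t`. -/
def αLow {R : Type*} [Ring R] (x t : R) (j : ZMod (2 * n + 2)) : R :=
  if j = 0 then -1 + x * t else if j = 1 then 1 - x * t else 0

/-- The power series with image `Ψ (α j)`. -/
def αSeries (j : ZMod (2 * n + 2)) : PowerSeries (F n) :=
  αLow PowerSeries.X (PowerSeries.C t) j + PowerSeries.X ^ 2 * PowerSeries.C (β j)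

lemma αSeries_comm (hn : 1 ≤ n) (j : ZMod (2 * n + 2)) (s : PowerSeries (F n)) :
    αSeries j * s = s * αSeries j := by
  have h1 : Commute PowerSeries.X s := X_comm s
  have h2 : Commute (PowerSeries.C t) s := C_comm F.t_comm s
  have h3 : Commute (PowerSeries.C (β j)) s := C_comm (F.β_comm hn j) s
  have h4 : Commute (αLow PowerSeries.X (PowerSeries.C t) j) s := by
    unfold αLow
    split_ifs
    · exact ((Commute.one_left s).neg_left).add_left (h1.mul_left h2)
    · exact (Commute.one_left s).sub_left (h1.mul_left h2)
    · exact Commute.zero_left s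
  exact h4.add_left ((h1.pow_left 2).mul_left h3)

lemma hSeries_comm (hn : 1 ≤ n) (s : PowerSeries (F n)) :
    (PowerSeries.X ^ 2 * PowerSeries.C h') * s = s * (PowerSeries.X ^ 2 * PowerSeries.C h') := by
  have h1 : Commute PowerSeries.X s := X_comm s
  have h2 : Commute (PowerSeries.C h') s := C_comm (F.h'_comm hn) s
  exact (h1.pow_left 2).mul_left h2

/-- Integers and `X` are central and drop out of the commutator. This explains the scaling `h ↦ ε²
h'`, and read backwards it recovers relations of `a, b` from those of the affine expressions. -/
lemma affine_commutator {A : Type*} [Ring A] (c d : ℤ) (a b : PowerSeries A) :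
    ((c : PowerSeries A) + PowerSeries.X * a) * ((d : PowerSeries A) + PowerSeries.X * b) -
      ((d : PowerSeries A) + PowerSeries.X * b) * ((c : PowerSeries A) + PowerSeries.X * a) =
      PowerSeries.X ^ 2 * (a * b - b * a) := by
  have h1 : ∀ s : PowerSeries A, s * PowerSeries.X = PowerSeries.X * s := fun s => (X_comm s).symm
  have hc : ∀ (c : ℤ) (s : PowerSeries A), (c : PowerSeries A) * s = s * c := Int.cast_comm
  have e1 : PowerSeries.X * a * (PowerSeries.X * b) = PowerSeries.X ^ 2 * (a * b) := by
    rw [mul_assoc, ← mul_assoc a, h1, pow_two]; simp only [mul_assoc]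
  have e2 : PowerSeries.X * b * (PowerSeries.X * a) = PowerSeries.X ^ 2 * (b * a) := by
    rw [mul_assoc, ← mul_assoc b, h1, pow_two]; simp only [mul_assoc]
  rw [add_mul, mul_add, mul_add, add_mul, mul_add, mul_add, e1, e2, hc c, hc c, hc d (_ * _),
    mul_sub]
  abel

lemma series_coreRel (hn : 1 ≤ n) : CoreRel (n := n) fSeries αSeries
    (PowerSeries.X ^ 2 * PowerSeries.C h') := by
  refine ⟨fun i j => ?_, fun i j => (αSeries_comm hn j _).symm, fun i j => αSeries_comm hn i _,
    fun i => hSeries_comm hn _, fun i => hSeries_comm hn _⟩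
  rw [fSeries, fSeries, affine_commutator, ← map_mul, ← map_mul, ← map_sub, (F.coreRel hn).comm,
    map_zsmul, mul_smul_comm]

lemma fSeries_sumRel : SumRel (n := n) fSeries 1 := by
  have h1 := delta_sumRel (n := n) (R := PowerSeries (F n))
  have h2 := (F.sumRel (n := n)).map (PowerSeries.C : F n →+* PowerSeries (F n))
  rw [map_zero] at h2
  constructor
  · simp only [fSeries]
    rw [Finset.sum_add_distrib, h1.even, ← Finset.mul_sum, h2.even, mul_zero, add_zero]
  · simp only [fSeries]
    rw [Finset.sum_add_distrib, h1.odd, ← Finset.mul_sum, h2.odd, mul_zero, add_zero]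

/-- The inclusion of power series in Laurent series as a `ℂ`-algebra homomorphism. -/
abbrev toLaurent (n : ℕ) : PowerSeries (F n) →ₐ[ℂ] LaurentSeries (F n) :=
  HahnSeries.ofPowerSeriesAlg ℤ ℂ

lemma toLaurent_apply (s : PowerSeries (F n)) :
    toLaurent n s = HahnSeries.ofPowerSeries ℤ (F n) s := rfl

lemma toLaurent_injective : Function.Injective (toLaurent n) :=
  HahnSeries.ofPowerSeries_injective

lemma toLaurent_X_pow (m : ℕ) : toLaurent n (PowerSeries.X ^ m) = epow n m := by
  rw [toLaurent_apply, HahnSeries.ofPowerSeries_X_pow]; rfl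

lemma toLaurent_X : toLaurent n PowerSeries.X = epow n 1 := by
  rw [← pow_one PowerSeries.X, toLaurent_X_pow]; rfl

lemma toLaurent_C (x : F n) : toLaurent n (PowerSeries.C x) = const x := by
  rw [toLaurent_apply, HahnSeries.ofPowerSeries_C]; rfl

lemma IsPsi.f_eq {Ψ : K n →ₐ[ℂ] LaurentSeries (F n)} (hΨ : IsPsi Ψ) (j : ZMod (2 * n + 2)) :
    Ψ (f j) = toLaurent n (fSeries j) := by
  rw [fSeries, map_add, map_intCast, map_mul, toLaurent_X, toLaurent_C]
  by_cases h0 : j = 0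
  · rw [h0, hΨ.f_zero, delta_zero, Int.cast_one]
  · by_cases h1 : j = 1
    · rw [h1, hΨ.f_one, delta_one, Int.cast_one]
    · rw [hΨ.f_other j h0 h1, delta_of_ne h0 h1, Int.cast_zero, zero_add]

lemma IsPsi.α_eq {Ψ : K n →ₐ[ℂ] LaurentSeries (F n)} (hΨ : IsPsi Ψ) (j : ZMod (2 * n + 2)) :
    Ψ (α j) = toLaurent n (αSeries j) := by
  rw [αSeries, αLow, map_add, map_mul, toLaurent_X_pow, toLaurent_C]
  by_cases h0 : j = 0
  · rw [h0, hΨ.α_zero, if_pos rfl, map_add, map_neg, map_one, map_mul, toLaurent_X, toLaurent_C]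
    rfl
  · by_cases h1 : j = 1
    · rw [h1, hΨ.α_one, if_neg one_ne_zero_zmod, if_pos rfl, map_sub, map_one, map_mul, toLaurent_X,
        toLaurent_C]
      rfl
    · rw [hΨ.α_other j h0 h1, if_neg h0, if_neg h1, map_zero, zero_add]
      rfl

lemma IsPsi.h_eq {Ψ : K n →ₐ[ℂ] LaurentSeries (F n)} (hΨ : IsPsi Ψ) :
    Ψ h = toLaurent n (PowerSeries.X ^ 2 * PowerSeries.C h') := by
  rw [hΨ.map_h, map_mul, toLaurent_X_pow, toLaurent_C]
  rfl

/-! ### Algebraic independence of the images of the parameters under `Ψ`. -/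

section Parameters

/-- The polynomial form of the substitution of parameters. -/
def paramPoly (n : ℕ) : Option (ZMod (2 * n + 2)) →
    Polynomial (MvPolynomial (Option (ZMod (2 * n + 2))) ℂ)
  | none => Polynomial.X ^ 2 * Polynomial.C (X none)
  | some j => (αLow Polynomial.X (Polynomial.C (X (some 0))) j :
        Polynomial (MvPolynomial (Option (ZMod (2 * n + 2))) ℂ)) +
      Polynomial.X ^ 2 * Polynomial.C (if j = 0 then 1 - ∑ k ∈ Finset.univ.erase 0, X (some k) else X (some j))

/-- Evaluation of the parameters. -/
def paramEval (e : ℂ) (b : Option (ZMod (2 * n + 2)) → ℂ) :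
    Polynomial (MvPolynomial (Option (ZMod (2 * n + 2))) ℂ) →ₐ[ℂ] ℂ :=
  Polynomial.eval₂AlgHom (aeval b) e fun _ => Commute.all _ _

lemma paramEval_X (e : ℂ) (b : Option (ZMod (2 * n + 2)) → ℂ) : paramEval e b Polynomial.X = e := by
  simp [paramEval]

lemma paramEval_C (e : ℂ) (b : Option (ZMod (2 * n + 2)) → ℂ)
    (p : MvPolynomial (Option (ZMod (2 * n + 2))) ℂ) :
    paramEval e b (Polynomial.C p) = aeval b p := by
  simp [paramEval]

/-- Every point with nonzero sum of coordinates is a value of the substitution. -/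
lemma exists_paramEval (a : Option (ZMod (2 * n + 2)) → ℂ) (ha : ∑ j, a (some j) ≠ 0) :
    ∃ e b, ∀ c, paramEval e b (paramPoly n c) = a c := by
  -- In the sum of all `Ψ (α j)` the terms `-1 + ε t` and `1 - ε t` cancel and the `β j` add up to
  -- `1`, so the sum is `ε²`. Hence `e` must be a square root.
  obtain ⟨e, he⟩ := IsAlgClosed.exists_pow_nat_eq (∑ j, a (some j)) two_pos
  have he0 : e ≠ 0 := by
    rintro rfl
    exact ha (by rw [← he]; simp)
  -- There is one degree of freedom too many, so `β 1` is put to zero. Then `t`, stored at `some 0`,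
  -- solves the equation of `α 1`, and the equation of `α 0` follows from the sum.
  let b : Option (ZMod (2 * n + 2)) → ℂ := fun c => match c with
    | none => a none / e ^ 2
    | some j => if j = 0 then (1 - a (some 1)) / e else if j = 1 then 0 else a (some j) / e ^ 2
  refine ⟨e, b, fun c => ?_⟩
  rcases c with _ | j
  · simp only [paramPoly, map_mul, map_pow, paramEval_X, paramEval_C, aeval_X, b]
    field_simp
  · simp only [paramPoly, map_add, map_mul, map_pow, paramEval_X, paramEval_C]
    have hb0 : b (some 0) = (1 - a (some 1)) / e := by simp [b]
    have hb1 : b (some 1) = 0 := by simp [b, one_ne_zero_zmod]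
    have hb : ∀ k : ZMod (2 * n + 2), k ≠ 0 → k ≠ 1 → b (some k) = a (some k) / e ^ 2 := by
      intro k h0 h1; simp [b, h0, h1]
    by_cases h0 : j = 0
    · subst h0
      rw [αLow, if_pos rfl, if_pos rfl]
      simp only [map_add, map_neg, map_one, map_mul, map_sub, map_sum, paramEval_X, paramEval_C,
        aeval_X]
      have h1 : (1 : ZMod (2 * n + 2)) ∈ Finset.univ.erase 0 := by simp [one_ne_zero_zmod]
      rw [← Finset.add_sum_erase _ _ h1, hb0, hb1, zero_add]
      have h2 : ∑ k ∈ (Finset.univ.erase (0 : ZMod (2 * n + 2))).erase 1, b (some k) =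
          (∑ k ∈ (Finset.univ.erase (0 : ZMod (2 * n + 2))).erase 1, a (some k)) / e ^ 2 := by
        rw [Finset.sum_div]
        refine Finset.sum_congr rfl fun k hk => ?_
        simp only [Finset.mem_erase, Finset.mem_univ, and_true] at hk
        exact hb k hk.2 hk.1
      have h3 : e ^ 2 = a (some 0) + (a (some 1) +
          ∑ k ∈ (Finset.univ.erase (0 : ZMod (2 * n + 2))).erase 1, a (some k)) := by
        rw [he, Finset.add_sum_erase _ (fun k => a (some k)) h1,
          Finset.add_sum_erase _ (fun k => a (some k)) (Finset.mem_univ 0)]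
      rw [h2]
      field_simp
      linear_combination h3
    · by_cases h1 : j = 1
      · subst h1
        rw [αLow, if_neg h0, if_pos rfl, if_neg h0]
        simp only [map_one, map_mul, map_sub, paramEval_X, paramEval_C, aeval_X, hb0, hb1]
        field_simp
        ring
      · rw [αLow, if_neg h0, if_neg h1, if_neg h0]
        simp only [map_zero, aeval_X, hb j h0 h1]
        field_simp
        ring

/-- A relation vanishes at every point off the hyperplane where the coordinates sum to zero. Its
product with that linear form vanishes everywhere, so the relation is zero. -/
lemma paramPoly_algebraicIndependent : AlgebraicIndependent ℂ (paramPoly n) := by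
  rw [AlgebraicIndependent, injective_iff_map_eq_zero]
  intro q hq
  have key : ∀ a : Option (ZMod (2 * n + 2)) → ℂ, ∑ j, a (some j) ≠ 0 → eval a q = 0 := by
    intro a ha
    obtain ⟨e, b, heb⟩ := exists_paramEval a ha
    have : (paramEval e b).comp (aeval (paramPoly n)) = aeval a := by
      ext c; simp [heb]
    have := congrArg (fun g => g q) this
    simp only [AlgHom.comp_apply, hq, map_zero] at this
    rw [← coe_aeval_eq_eval]
    exact this.symm
  have hprod : q * ∑ j : ZMod (2 * n + 2), X (some j) = 0 := by
    refine MvPolynomial.funext fun a => ?_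
    rw [map_mul, map_zero, map_sum]
    simp only [eval_X]
    by_cases ha : ∑ j, a (some j) = 0
    · rw [ha, mul_zero]
    · rw [key a ha, zero_mul]
  refine (mul_eq_zero.mp hprod).resolve_right fun h0 => ?_
  have := congrArg (eval fun c => if c = some 0 then (1 : ℂ) else 0) h0
  simp at this

end Parameters

/-- The inclusion of the center of `FAlg n` in `F n`. -/
def F.centerHom (n : ℕ) : Subalgebra.center ℂ (FAlg n) →ₐ[ℂ] F n :=
  (SkewFrac.ofHom (FAlg n)).comp (Subalgebra.val _)

lemma F.centerHom_injective (hn : 1 ≤ n) : Function.Injective (F.centerHom n) :=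
  (F.ofHom_injective hn).comp Subtype.val_injective

/-- The polynomial ring in the central generators as a subalgebra of `F n`. -/
def F.paramHom (hn : 1 ≤ n) : MvPolynomial (Option (ZMod (2 * n + 2))) ℂ →ₐ[ℂ] F n :=
  (F.centerHom n).comp (aeval fun c =>
    (⟨FAlg.central c, FAlg.central_mem hn c⟩ : Subalgebra.center ℂ (FAlg n)))

lemma F.paramHom_injective (hn : 1 ≤ n) : Function.Injective (F.paramHom hn) :=
  (F.centerHom_injective hn).comp (FAlg.algebraicIndependent hn)

lemma F.paramHom_none (hn : 1 ≤ n) : F.paramHom hn (X none) = h' := by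
  rw [paramHom, AlgHom.comp_apply, aeval_X]; rfl

lemma F.paramHom_zero (hn : 1 ≤ n) : F.paramHom hn (X (some 0)) = t := by
  rw [paramHom, AlgHom.comp_apply, aeval_X]
  have : FAlg.central (n := n) (some 0) = FAlg.gen .t := by simp [FAlg.central]
  exact congrArg (SkewFrac.ofHom (FAlg n)) this

lemma F.paramHom_some (hn : 1 ≤ n) {j : ZMod (2 * n + 2)} (hj : j ≠ 0) :
    F.paramHom hn (X (some j)) = β j := by
  rw [paramHom, AlgHom.comp_apply, aeval_X]
  have : FAlg.central (n := n) (some j) = FAlg.gen (.β j) := by simp [FAlg.central, hj]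
  exact congrArg (SkewFrac.ofHom (FAlg n)) this

lemma sum_range_zmod {N : ℕ} [NeZero N] {M : Type*} [AddCommMonoid M] (b : ZMod N → M) :
    ∑ m ∈ Finset.range N, b (m : ZMod N) = ∑ j, b j := by
  refine Finset.sum_bij' (fun m _ => (m : ZMod N)) (fun j _ => j.val) (fun _ _ => Finset.mem_univ _)
    (fun j _ => Finset.mem_range.mpr (ZMod.val_lt j))
    (fun m hm => ZMod.val_cast_of_lt (Finset.mem_range.mp hm)) (fun j _ => ZMod.natCast_zmod_val j)
    (fun _ _ => rfl)

lemma F.sum_β : ∑ j, (β j : F n) = 1 := by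
  rw [← sum_range_zmod, F.timeRel.sum_b]

lemma F.paramHom_β (hn : 1 ≤ n) (j : ZMod (2 * n + 2)) : F.paramHom hn
    (if j = 0 then 1 - ∑ k ∈ Finset.univ.erase 0, X (some k) else X (some j)) = β j := by
  split_ifs with hj
  · subst hj
    rw [map_sub, map_one, map_sum, sub_eq_iff_eq_add, ← F.sum_β,
      ← Finset.add_sum_erase _ _ (Finset.mem_univ 0)]
    congr 1
    refine Finset.sum_congr rfl fun k hk => ?_
    rw [F.paramHom_some hn (Finset.ne_of_mem_erase hk)]
  · exact F.paramHom_some hn hj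

lemma coeff_map_coeToPowerSeries {A B : Type*} [CommSemiring A] [Semiring B] (g : A →+* B)
    (q : Polynomial A) (m : ℕ) : PowerSeries.coeff m ((PowerSeries.map g).comp
      Polynomial.coeToPowerSeries.ringHom q) = g (q.coeff m) := by
  simp

/-- Polynomials in the central generators and `ε` as power series. -/
def paramSeries (hn : 1 ≤ n) : Polynomial (MvPolynomial (Option (ZMod (2 * n + 2))) ℂ) →ₐ[ℂ]
    PowerSeries (F n) where
  toRingHom := (PowerSeries.map (F.paramHom hn : _ →+* F n)).comp
    Polynomial.coeToPowerSeries.ringHom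
  commutes' r := by
    ext m
    refine (coeff_map_coeToPowerSeries _ _ m).trans ?_
    rw [Polynomial.algebraMap_apply, PowerSeries.algebraMap_apply, Polynomial.coeff_C,
      PowerSeries.coeff_C]
    split_ifs
    · exact AlgHom.commutes (F.paramHom hn) r
    · exact map_zero _

lemma coeff_paramSeries (hn : 1 ≤ n)
    (q : Polynomial (MvPolynomial (Option (ZMod (2 * n + 2))) ℂ)) (m : ℕ) :
    PowerSeries.coeff m (paramSeries hn q) = F.paramHom hn (q.coeff m) :=
  coeff_map_coeToPowerSeries _ _ m

lemma paramSeries_injective (hn : 1 ≤ n) : Function.Injective (paramSeries hn) := by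
  intro p q hpq
  ext1 m
  apply F.paramHom_injective hn
  rw [← coeff_paramSeries, ← coeff_paramSeries, hpq]

lemma paramSeries_X (hn : 1 ≤ n) : paramSeries hn Polynomial.X = PowerSeries.X := by
  ext m
  rw [coeff_paramSeries, Polynomial.coeff_X, PowerSeries.coeff_X, apply_ite (F.paramHom hn), map_one,
    map_zero]
  simp only [eq_comm]

lemma paramSeries_C (hn : 1 ≤ n) (p) :
    paramSeries hn (Polynomial.C p) = PowerSeries.C (F.paramHom hn p) := by
  ext m
  rw [coeff_paramSeries, Polynomial.coeff_C, PowerSeries.coeff_C, apply_ite (F.paramHom hn),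
    map_zero]

lemma paramSeries_paramPoly (hn : 1 ≤ n) (j : ZMod (2 * n + 2)) :
    paramSeries hn (paramPoly n (some j)) = αSeries j := by
  rw [paramPoly, αSeries, map_add, map_mul, map_pow, paramSeries_X, paramSeries_C, F.paramHom_β]
  congr 1
  simp only [αLow]
  split_ifs
  · rw [map_add, map_neg, map_one, map_mul, paramSeries_X, paramSeries_C, F.paramHom_zero]
  · rw [map_sub, map_one, map_mul, paramSeries_X, paramSeries_C, F.paramHom_zero]
  · exact map_zero _

/-- Every nonzero Laurent series over `F` is a unit. -/
lemma laurent_isUnit (hn : 1 ≤ n) (x : LaurentSeries (F n)) (hx : x ≠ 0) : IsUnit x :=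
  laurentSeries_isUnit (F.isUnit_of_ne_zero hn) hx

lemma laurent_coreRel (hn : 1 ≤ n) : CoreRel (n := n) (fun j => toLaurent n (fSeries j))
    (fun j => toLaurent n (αSeries j))
    (toLaurent n (PowerSeries.X ^ 2 * PowerSeries.C h')) :=
  (series_coreRel hn).map (toLaurent n : PowerSeries (F n) →+* LaurentSeries (F n))

lemma laurent_sumRel : SumRel (n := n) (fun j => toLaurent n (fSeries j)) 1 := by
  have := (fSeries_sumRel (n := n)).map (toLaurent n : PowerSeries (F n) →+* LaurentSeries (F n))
  rwa [map_one] at this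

/-- The homomorphism `Ψ`. -/
def psi (hn : 1 ≤ n) : K n →ₐ[ℂ] LaurentSeries (F n) :=
  K.lift (laurent_coreRel hn) laurent_sumRel <| by
    refine isUnit_of_injective (laurent_isUnit hn) ?_
    refine KAlg.hom_injective hn _ ((toLaurent n).comp (paramSeries hn))
      (toLaurent_injective.comp (paramSeries_injective hn)) (paramPoly n) (fun c => ?_)
      paramPoly_algebraicIndependent
    rcases c with _ | j
    · refine (KAlg.lift_h _ _).trans ?_
      rw [AlgHom.comp_apply, paramPoly, map_mul (paramSeries hn), map_pow (paramSeries hn),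
        paramSeries_X, paramSeries_C, F.paramHom_none]
    · refine (KAlg.lift_α _ _ j).trans ?_
      rw [AlgHom.comp_apply, paramSeries_paramPoly]

lemma psi_isPsi (hn : 1 ≤ n) : IsPsi (psi hn) := by
  have hf : ∀ j, psi hn (f j) = toLaurent n (fSeries j) := fun j => K.lift_f _ _ _ j
  have hα : ∀ j, psi hn (α j) = toLaurent n (αSeries j) := fun j => K.lift_α _ _ _ j
  have hh : psi hn h = toLaurent n (PowerSeries.X ^ 2 * PowerSeries.C h') := K.lift_h _ _ _
  have e2 : toLaurent n (PowerSeries.X ^ 2) = epow n 2 := toLaurent_X_pow 2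
  refine ⟨?_, ?_, fun i h0 h1 => ?_, ?_, ?_, fun i h0 h1 => ?_, ?_⟩
  · rw [hf, fSeries, delta_zero, Int.cast_one, map_add, map_one, map_mul, toLaurent_X, toLaurent_C]
  · rw [hf, fSeries, delta_one, Int.cast_one, map_add, map_one, map_mul, toLaurent_X, toLaurent_C]
  · rw [hf, fSeries, delta_of_ne h0 h1, Int.cast_zero, zero_add, map_mul, toLaurent_X, toLaurent_C]
  · rw [hα, αSeries, αLow, if_pos rfl, map_add, map_add, map_neg, map_one, map_mul, map_mul,
      toLaurent_X, toLaurent_C, toLaurent_C, e2]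
  · rw [hα, αSeries, αLow, if_neg one_ne_zero_zmod, if_pos rfl, map_add, map_sub, map_one, map_mul,
      map_mul, toLaurent_X, toLaurent_C, toLaurent_C, e2]
  · rw [hα, αSeries, αLow, if_neg h0, if_neg h1, zero_add, map_mul, toLaurent_C, e2]
  · rw [hh, map_mul, toLaurent_C, e2]

end QPainleve
end

noncomputable section
namespace QPainleve

open MvPolynomial

variable {n : ℕ}

/-! ### The translation `T₁` -/

section PartialShift

/-- The index `l - k` in `ℤ/(l+1)ℤ`. -/
def revIndex (n k : ℕ) : ZMod (2 * n + 2) := -1 - (k : ZMod (2 * n + 2))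

lemma natCast_sub_eq_revIndex {k : ℕ} (hk : k ≤ 2 * n + 1) :
    ((2 * n + 1 - k : ℕ) : ZMod (2 * n + 2)) = revIndex n k := by
  have h := two_mul_add_two_eq_zero (n := n)
  rw [Nat.cast_sub hk, revIndex]
  push_cast at h ⊢
  linear_combination h

lemma revIndex_succ_add_one (k : ℕ) : revIndex n (k + 1) + 1 = revIndex n k := by
  rw [revIndex, revIndex]; push_cast; ring

lemma revIndex_sub_one (k : ℕ) : revIndex n k - 1 = revIndex n (k + 1) := by
  rw [revIndex, revIndex]; push_cast; ring

lemma revIndex_add_one (k : ℕ) : revIndex n k + 1 = -(k : ZMod (2 * n + 2)) := by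
  rw [revIndex]; ring

lemma neg_succ_eq_revIndex (k : ℕ) : -((k + 1 : ℕ) : ZMod (2 * n + 2)) = revIndex n k := by
  rw [revIndex]; push_cast; ring

lemma revIndex_zero_ne {k : ℕ} (hk : k < 2 * n + 1) : revIndex n k ≠ 0 := by
  rw [← natCast_sub_eq_revIndex (by omega)]
  exact natCast_ne_zero_zmod (by omega) (by omega)

lemma revIndex_one_ne {k : ℕ} (hk : k < 2 * n) : revIndex n k ≠ 1 := by
  rw [← natCast_sub_eq_revIndex (by omega)]
  exact natCast_ne_one_zmod (by omega) (by omega)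

lemma revIndex_nonadjacent {k m : ℕ} (hkm : k + 2 ≤ m) (hm : m ≤ k + 2 * n) :
    revIndex n m ≠ revIndex n k ∧ revIndex n m ≠ revIndex n k + 1 ∧
      revIndex n m ≠ revIndex n k - 1 := by
  have h : revIndex n k - revIndex n m = ((m - k : ℕ) : ZMod (2 * n + 2)) := by
    rw [Nat.cast_sub (by omega), revIndex, revIndex]; ring
  refine ⟨fun e => ?_, fun e => ?_, fun e => ?_⟩
  · refine natCast_ne_zero_zmod (n := n) (m := m - k) (by omega) (by omega) ?_
    rw [← h, e, sub_self]
  · refine natCast_ne_zero_zmod (n := n) (m := m - k + 1) (by omega) (by omega) ?_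
    rw [Nat.cast_succ, ← h, e]; ring
  · refine natCast_ne_one_zmod (n := n) (m := m - k) (by omega) (by omega) ?_
    rw [← h, e]; ring

lemma orient_revIndex_left {k m : ℕ} (hkm : k + 2 ≤ m) (hm : m ≤ k + 2 * n) :
    orient (revIndex n k) (revIndex n m) = 0 :=
  orient_of_ne (revIndex_nonadjacent hkm hm).2.1 (revIndex_nonadjacent hkm hm).2.2

lemma cartan_revIndex_left {k m : ℕ} (hkm : k + 2 ≤ m) (hm : m ≤ k + 2 * n) :
    cartan (revIndex n k) (revIndex n m) = 0 := by
  obtain ⟨h1, h2, h3⟩ := revIndex_nonadjacent hkm hm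
  simp [cartan, h1, h2, h3]

lemma orient_revIndex_right (hn : 1 ≤ n) {k m : ℕ} (hkm : k + 2 ≤ m) (hm : m ≤ k + 2 * n) :
    orient (revIndex n m) (revIndex n k) = 0 := by
  rw [orient_antisymm hn, orient_revIndex_left hkm hm, neg_zero]

lemma orient_revIndex_succ (hn : 1 ≤ n) (k : ℕ) :
    orient (revIndex n k) (revIndex n (k + 1)) = -1 := by
  rw [← revIndex_sub_one, orient_pred hn]

lemma orient_revIndex_pred (k : ℕ) : orient (revIndex n (k + 1)) (revIndex n k) = 1 := by
  have := orient_succ (revIndex n (k + 1))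
  rwa [revIndex_succ_add_one] at this

lemma cartan_revIndex_succ (k : ℕ) : cartan (revIndex n k) (revIndex n (k + 1)) = -1 := by
  have : revIndex n k - 1 ≠ revIndex n k := by
    rw [Ne, sub_eq_self]; exact one_ne_zero_zmod
  rw [← revIndex_sub_one]
  simp [cartan, this]

variable (W : WeylAction n) {B : Type*} [Ring B] [Algebra ℂ B] (Ψ : K n →ₐ[ℂ] B)

/-- The composite of `Ψ` with `π s_l s_{l-1} ⋯ s_{l-k+1}`. -/
def partialShift (k : ℕ) : K n →ₐ[ℂ] B :=
  Ψ.comp (W.π * ((List.range k).map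
    fun m => W.s ((2 * n + 1 - m : ℕ) : ZMod (2 * n + 2))).prod : K n ≃ₐ[ℂ] K n)

lemma partialShift_zero (x : K n) : partialShift W Ψ 0 x = Ψ (W.π x) := rfl

lemma partialShift_succ {k : ℕ} (hk : k ≤ 2 * n) (x : K n) :
    partialShift W Ψ (k + 1) x = partialShift W Ψ k (W.s (revIndex n k) x) := by
  rw [partialShift, List.range_succ, List.map_append, List.prod_append, List.map_singleton,
    List.prod_singleton, natCast_sub_eq_revIndex (by omega), ← mul_assoc]
  rfl

lemma partialShift_last (x : K n) : partialShift W Ψ (2 * n + 1) x = Ψ (W.T₁ x) := rfl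

lemma partialShift_eq_of_fixed {k m : ℕ} (hkm : k ≤ m) (hm : m ≤ 2 * n + 1) (x : K n)
    (hx : ∀ j, k ≤ j → j < m → W.s (revIndex n j) x = x) :
    partialShift W Ψ m x = partialShift W Ψ k x := by
  induction m, hkm using Nat.le_induction with
  | base => rfl
  | succ m hkm ih =>
    rw [partialShift_succ W Ψ (by omega), hx m hkm (by omega),
      ih (by omega) fun j h1 h2 => hx j h1 (by omega)]

lemma WeylAction.s_f_of_orient {i j : ZMod (2 * n + 2)} (h : orient i j = 0) :
    W.s i (f j) = f j := by
  rw [W.s_f, h, zero_smul, add_zero]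

lemma WeylAction.s_α_of_cartan {i j : ZMod (2 * n + 2)} (h : cartan i j = 0) :
    W.s i (α j) = α j := by
  rw [W.s_α, h, zero_smul, sub_zero]

lemma partialShift_f_zero : partialShift W Ψ 0 (f (revIndex n 0)) = Ψ (f 0) := by
  rw [partialShift_zero, W.π_f, revIndex_add_one, Nat.cast_zero, neg_zero]

/-- Among the reflections present, only the neighbour of index one higher moves `α (l - k)`, and it
adds its own root. The roots accumulate, and `π` raises every index by one. -/
lemma partialShift_α {k : ℕ} (hk : k ≤ 2 * n) : partialShift W Ψ k (α (revIndex n k)) =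
    ∑ m ∈ Finset.range (k + 1), Ψ (α (-(m : ZMod (2 * n + 2)))) := by
  induction k with
  | zero =>
    rw [partialShift_zero, W.π_α, revIndex_add_one, zero_add, Finset.sum_range_one]
  | succ k ih =>
    rw [partialShift_succ W Ψ (by omega), W.s_α, cartan_revIndex_succ, neg_smul, one_smul,
      sub_neg_eq_add, map_add, ih (by omega), partialShift_eq_of_fixed W Ψ (Nat.zero_le k)
        (by omega) _ fun j _ hj => W.s_α_of_cartan (cartan_revIndex_left (by omega) (by omega)),
      partialShift_zero, W.π_α, revIndex_add_one, Finset.sum_range_succ _ (k + 1), add_comm]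

/-- The only reflection present that moves `f (l - k - 1)` is `s (l - k)`, so the images satisfy a
continued-fraction recursion whose numerators are the accumulated roots. -/
lemma partialShift_f_succ (hn : 1 ≤ n) {k : ℕ} (hk : k + 1 ≤ 2 * n) :
    partialShift W Ψ (k + 1) (f (revIndex n (k + 1))) = Ψ (f (revIndex n k)) -
      (∑ m ∈ Finset.range (k + 1), Ψ (α (-(m : ZMod (2 * n + 2))))) *
        Ring.inverse (partialShift W Ψ k (f (revIndex n k))) := by
  rw [partialShift_succ W Ψ (by omega), W.s_f, orient_revIndex_succ hn, neg_smul, one_smul,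
    ← sub_eq_add_neg, map_sub, map_mul, map_ringInverse _ (K.isUnit_f hn _),
    partialShift_α W Ψ (by omega), partialShift_eq_of_fixed W Ψ (Nat.zero_le k)
      (by omega) _ fun j _ hj => W.s_f_of_orient (orient_revIndex_left (by omega) (by omega)),
    partialShift_zero, W.π_f, revIndex_succ_add_one]

/-- The reflections applied earlier have distant indices and fix `f (l - k)`. Then `s (l - k - 1)`
adds a quotient, `s (l - k)` fixes the numerator-free part, and the recursion takes over. The bound
on `k` keeps the index in `2, …, l`. -/
lemma map_T₁_f (hn : 1 ≤ n) {k : ℕ} (hk : k + 1 ≤ 2 * n) :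
    Ψ (W.T₁ (f (revIndex n k))) = partialShift W Ψ k (f (revIndex n k)) +
      (∑ m ∈ Finset.range (k + 2), Ψ (α (-(m : ZMod (2 * n + 2))))) *
        Ring.inverse (partialShift W Ψ (k + 1) (f (revIndex n (k + 1)))) := by
  rw [← partialShift_last, partialShift_eq_of_fixed W Ψ (show k + 2 ≤ 2 * n + 1 by omega) le_rfl _
      fun j h1 h2 => W.s_f_of_orient (orient_revIndex_right hn h1 (by omega)),
    partialShift_succ W Ψ (by omega), W.s_f, orient_revIndex_pred, one_smul, map_add, map_mul,
    map_ringInverse _ (K.isUnit_f hn _), partialShift_α W Ψ (by omega),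
    partialShift_succ W Ψ (by omega), W.s_f_of_orient (orient_self hn _)]

end PartialShift

/-! ### Expansion of `T₁` to second order in `ε`. -/

section Expansion

lemma coeff_one_mul {A : Type*} [Semiring A] (a b : PowerSeries A) : PowerSeries.coeff 1 (a * b) =
    PowerSeries.constantCoeff a * PowerSeries.coeff 1 b +
      PowerSeries.coeff 1 a * PowerSeries.constantCoeff b := by
  rw [PowerSeries.coeff_mul, Finset.Nat.antidiagonal_succ]
  simp

lemma coeff_two_mul {A : Type*} [Semiring A] (a b : PowerSeries A) : PowerSeries.coeff 2 (a * b) =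
    PowerSeries.constantCoeff a * PowerSeries.coeff 2 b +
      (PowerSeries.coeff 1 a * PowerSeries.coeff 1 b +
      PowerSeries.coeff 2 a * PowerSeries.constantCoeff b) := by
  simp [PowerSeries.coeff_mul, Finset.Nat.antidiagonal_succ]

lemma coeff_inverse_of_constantCoeff_one {A : Type} [Ring A] [Algebra ℂ A] {u : PowerSeries A}
    (h0 : PowerSeries.constantCoeff u = 1) : PowerSeries.constantCoeff (Ring.inverse u) = 1 ∧
    PowerSeries.coeff 1 (Ring.inverse u) = - PowerSeries.coeff 1 u ∧
    PowerSeries.coeff 2 (Ring.inverse u) =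
      PowerSeries.coeff 1 u * PowerSeries.coeff 1 u - PowerSeries.coeff 2 u := by
  have hu : IsUnit u := isUnit_of_constantCoeff (by rw [h0]; exact isUnit_one)
  have h := Ring.mul_inverse_cancel u hu
  have e0 := congrArg PowerSeries.constantCoeff h
  have e1 := congrArg (PowerSeries.coeff 1) h
  have e2 := congrArg (PowerSeries.coeff 2) h
  rw [map_mul, h0, one_mul, map_one] at e0
  rw [coeff_one_mul, h0, one_mul, e0, mul_one, PowerSeries.coeff_one, if_neg one_ne_zero] at e1
  have e1' := eq_neg_of_add_eq_zero_left e1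
  rw [coeff_two_mul, h0, one_mul, e0, mul_one, e1', PowerSeries.coeff_one, if_neg two_ne_zero,
    mul_neg] at e2
  refine ⟨e0, e1', ?_⟩
  rw [eq_neg_of_add_eq_zero_left e2]
  abel

/-- Partial sums of the series `αSeries`. -/
def αSum (n k : ℕ) : PowerSeries (F n) :=
  ∑ m ∈ Finset.range (k + 1), αSeries (-(m : ZMod (2 * n + 2)))

/-- Partial sums of the parameters. -/
def βSum (n k : ℕ) : F n := ∑ m ∈ Finset.range (k + 1), β (-(m : ZMod (2 * n + 2)))

lemma αSeries_zero : (αSeries 0 : PowerSeries (F n)) =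
    -1 + PowerSeries.X * PowerSeries.C t + PowerSeries.X ^ 2 * PowerSeries.C (β 0) := by
  rw [αSeries, αLow, if_pos rfl]

lemma αSeries_of_ne {j : ZMod (2 * n + 2)} (h0 : j ≠ 0) (h1 : j ≠ 1) :
    αSeries j = PowerSeries.X ^ 2 * PowerSeries.C (β j) := by
  rw [αSeries, αLow, if_neg h0, if_neg h1, zero_add]

/-- The indices run through `0, l, l - 1, …, 2` and stop before `1`, so the constant and linear
parts come from `α 0` alone. -/
lemma αSum_eq {k : ℕ} (hk : k ≤ 2 * n) : αSum n k =
    -1 + PowerSeries.X * PowerSeries.C t + PowerSeries.X ^ 2 * PowerSeries.C (βSum n k) := by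
  induction k with
  | zero => simp [αSum, βSum, αSeries_zero]
  | succ k ih =>
    have h1 : αSum n (k + 1) = αSum n k + αSeries (-((k + 1 : ℕ) : ZMod (2 * n + 2))) :=
      Finset.sum_range_succ _ _
    have h2 : βSum n (k + 1) = βSum n k + β (-((k + 1 : ℕ) : ZMod (2 * n + 2))) :=
      Finset.sum_range_succ _ _
    rw [h1, h2, neg_succ_eq_revIndex, ih (by omega),
      αSeries_of_ne (revIndex_zero_ne (by omega)) (revIndex_one_ne (by omega)), map_add, mul_add,
      ← add_assoc]

lemma coeff_quadratic {A : Type*} [Ring A] (a b c : A) :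
    PowerSeries.constantCoeff (PowerSeries.C a + PowerSeries.X * PowerSeries.C b +
      PowerSeries.X ^ 2 * PowerSeries.C c) = a ∧
    PowerSeries.coeff 1 (PowerSeries.C a + PowerSeries.X * PowerSeries.C b +
      PowerSeries.X ^ 2 * PowerSeries.C c) = b ∧
    PowerSeries.coeff 2 (PowerSeries.C a + PowerSeries.X * PowerSeries.C b +
      PowerSeries.X ^ 2 * PowerSeries.C c) = c := by
  refine ⟨by simp, ?_, ?_⟩
  · rw [map_add, map_add, pow_two, mul_assoc, PowerSeries.coeff_C, if_neg one_ne_zero,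
      coeff_one_mul, coeff_one_mul]
    simp
  · rw [map_add, map_add, pow_two, mul_assoc, PowerSeries.coeff_C, if_neg two_ne_zero,
      coeff_two_mul, coeff_two_mul, coeff_one_mul]
    simp [PowerSeries.coeff_X]

lemma coeff_αSum {k : ℕ} (hk : k ≤ 2 * n) : PowerSeries.constantCoeff (αSum n k) = -1 ∧
    PowerSeries.coeff 1 (αSum n k) = t ∧ PowerSeries.coeff 2 (αSum n k) = βSum n k := by
  have h := coeff_quadratic (-1) t (βSum n k)
  rwa [map_neg, map_one, ← αSum_eq hk] at h

lemma coeff_fSeries {j : ZMod (2 * n + 2)} : PowerSeries.constantCoeff (fSeries j) = (delta j : F n) ∧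
    PowerSeries.coeff 1 (fSeries j) = φ j ∧ PowerSeries.coeff 2 (fSeries j) = 0 := by
  have h := coeff_quadratic (delta j : F n) (φ j) 0
  rwa [map_intCast, map_zero, mul_zero, add_zero] at h

/-- The series of the partial images of `f (l - k)` under the factors of `T₁`. -/
def shiftSeries (n : ℕ) : ℕ → PowerSeries (F n)
  | 0 => fSeries 0
  | k + 1 => fSeries (revIndex n k) - αSum n k * Ring.inverse (shiftSeries n k)

/-- The linear terms of `shiftSeries`. -/
def shiftLinear (n : ℕ) : ℕ → F n
  | 0 => φ 0
  | k + 1 => φ (revIndex n k) - shiftLinear n k - t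

lemma delta_revIndex {k : ℕ} (hk : k < 2 * n) : delta (revIndex n k) = 0 :=
  delta_of_ne (revIndex_zero_ne (by omega)) (revIndex_one_ne hk)

lemma coeff_mul_inverse {B u : PowerSeries (F n)} {b g : F n}
    (hB : PowerSeries.constantCoeff B = -1 ∧ PowerSeries.coeff 1 B = t ∧ PowerSeries.coeff 2 B = b)
    (h0 : PowerSeries.constantCoeff u = 1) (h1 : PowerSeries.coeff 1 u = g) :
    PowerSeries.constantCoeff (B * Ring.inverse u) = -1 ∧
    PowerSeries.coeff 1 (B * Ring.inverse u) = g + t ∧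
    PowerSeries.coeff 2 (B * Ring.inverse u) = b - t * g - g * g + PowerSeries.coeff 2 u := by
  obtain ⟨b0, b1, b2⟩ := hB
  obtain ⟨u0, u1, u2⟩ := coeff_inverse_of_constantCoeff_one h0
  rw [map_mul, coeff_one_mul, coeff_two_mul, b0, b1, b2, u0, u1, u2, h1]
  refine ⟨by simp, by simp, ?_⟩
  rw [mul_one, mul_neg, neg_one_mul]
  abel

lemma coeff_shiftSeries {k : ℕ} (hk : k ≤ 2 * n) :
    PowerSeries.constantCoeff (shiftSeries n k) = 1 ∧
    PowerSeries.coeff 1 (shiftSeries n k) = shiftLinear n k := by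
  induction k with
  | zero =>
    obtain ⟨h0, h1, _⟩ := coeff_fSeries (n := n) (j := 0)
    rw [delta_zero, Int.cast_one] at h0
    exact ⟨h0, h1⟩
  | succ k ih =>
    obtain ⟨i0, i1⟩ := ih (by omega)
    obtain ⟨h0, h1, _⟩ := coeff_fSeries (n := n) (j := revIndex n k)
    obtain ⟨m0, m1, _⟩ := coeff_mul_inverse (coeff_αSum (by omega : k ≤ 2 * n)) i0 i1
    rw [delta_revIndex (by omega), Int.cast_zero] at h0
    rw [shiftSeries, shiftLinear, map_sub, map_sub, h0, h1, m0, m1]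
    exact ⟨by simp, by abel⟩

lemma isUnit_shiftSeries {k : ℕ} (hk : k ≤ 2 * n) : IsUnit (shiftSeries n k) :=
  isUnit_of_constantCoeff (by rw [(coeff_shiftSeries hk).1]; exact isUnit_one)

/-- The series of `T₁ (f (l - k))`. -/
def translateSeries (n k : ℕ) : PowerSeries (F n) :=
  shiftSeries n k + αSum n (k + 1) * Ring.inverse (shiftSeries n (k + 1))

lemma βSum_succ (k : ℕ) : βSum n (k + 1) = βSum n k + β (revIndex n k) := by
  rw [βSum, Finset.sum_range_succ, neg_succ_eq_revIndex]; rfl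

/-- The second coefficient of `shiftSeries n k` enters that of `shiftSeries n (k + 1)` with the
opposite sign and cancels in the sum. Only the linear terms need a closed form. -/
lemma coeff_translateSeries {k : ℕ} (hk : k + 1 ≤ 2 * n) :
    PowerSeries.constantCoeff (translateSeries n k) = 0 ∧
    PowerSeries.coeff 1 (translateSeries n k) = φ (revIndex n k) ∧
    PowerSeries.coeff 2 (translateSeries n k) = shiftLinear n k * φ (revIndex n k) -
      φ (revIndex n k) * shiftLinear n (k + 1) + β (revIndex n k) := by
  obtain ⟨i0, i1⟩ := coeff_shiftSeries (by omega : k ≤ 2 * n)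
  obtain ⟨j0, j1⟩ := coeff_shiftSeries hk
  obtain ⟨m0, m1, m2⟩ := coeff_mul_inverse (coeff_αSum hk) j0 j1
  have h2 : PowerSeries.coeff 2 (shiftSeries n (k + 1)) =
      -(βSum n k - t * shiftLinear n k - shiftLinear n k * shiftLinear n k +
        PowerSeries.coeff 2 (shiftSeries n k)) := by
    rw [shiftSeries, map_sub, coeff_fSeries.2.2,
      (coeff_mul_inverse (coeff_αSum (by omega : k ≤ 2 * n)) i0 i1).2.2, zero_sub]
  -- With this identity the quadratic remainder `c_k (c_k + t) - (c_{k+1} + t) c_{k+1}`, where `c`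
  -- is `shiftLinear`, becomes `c_k φ - φ c_{k+1}`.
  have h3 : φ (revIndex n k) = shiftLinear n k + shiftLinear n (k + 1) + t := by
    rw [shiftLinear]; abel
  rw [translateSeries, map_add, map_add, map_add, i0, i1, m0, m1, m2, h2, βSum_succ, h3]
  refine ⟨by simp, by abel, ?_⟩
  have ht : shiftLinear n k * t = t * shiftLinear n k := (F.t_comm _).symm
  simp only [mul_add, add_mul, ht]
  abel

variable {Ψ : K n →ₐ[ℂ] LaurentSeries (F n)}

lemma IsPsi.sum_α_eq (hΨ : IsPsi Ψ) (k : ℕ) :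
    ∑ m ∈ Finset.range (k + 1), Ψ (α (-(m : ZMod (2 * n + 2)))) = toLaurent n (αSum n k) := by
  rw [αSum, map_sum]
  exact Finset.sum_congr rfl fun m _ => hΨ.α_eq _

lemma IsPsi.partialShift_eq (hn : 1 ≤ n) (hΨ : IsPsi Ψ) (W : WeylAction n) {k : ℕ}
    (hk : k ≤ 2 * n) :
    partialShift W Ψ k (f (revIndex n k)) = toLaurent n (shiftSeries n k) := by
  induction k with
  | zero => rw [partialShift_f_zero, hΨ.f_eq]; rfl
  | succ k ih =>
    rw [partialShift_f_succ W Ψ hn hk, ih (by omega), hΨ.f_eq, hΨ.sum_α_eq,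
      ← map_ringInverse _ (isUnit_shiftSeries (by omega)), ← map_mul, ← map_sub]
    rfl

lemma IsPsi.map_T₁_f (hn : 1 ≤ n) (hΨ : IsPsi Ψ) (W : WeylAction n) {k : ℕ}
    (hk : k + 1 ≤ 2 * n) : Ψ (W.T₁ (f (revIndex n k))) = toLaurent n (translateSeries n k) := by
  rw [QPainleve.map_T₁_f W Ψ hn hk, hΨ.partialShift_eq hn W (by omega), hΨ.partialShift_eq hn W hk,
    hΨ.sum_α_eq, ← map_ringInverse _ (isUnit_shiftSeries hk), ← map_mul, ← map_add]
  rfl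

end Expansion

end QPainleve
end

noncomputable section
namespace QPainleve

open MvPolynomial

variable {n : ℕ}

/-! ### The reflections `r i` -/

section Folding

/-- The sum of a family indexed by `ℤ/(l+1)ℤ` over the fibres of the map `0, 1 ↦ 0`,
`j + 1 ↦ j`. -/
def fold {A : Type*} [Add A] (v : ZMod (2 * n + 2) → A) (i : ZMod (2 * n + 1)) : A :=
  if i = 0 then v 0 + v 1 else v (shift i)

lemma fold_zero {A : Type*} [Add A] (v : ZMod (2 * n + 2) → A) : fold v 0 = v 0 + v 1 := if_pos rfl

lemma fold_of_ne {A : Type*} [Add A] (v : ZMod (2 * n + 2) → A) {i : ZMod (2 * n + 1)}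
    (hi : i ≠ 0) : fold v i = v (shift i) := if_neg hi

lemma γ_eq_fold (i : ZMod (2 * n + 1)) : (γ i : F n) = fold β i := rfl

lemma ψ_eq_fold (i : ZMod (2 * n + 1)) : (ψ i : F n) = fold φ i + if i = 0 then t else 0 := by
  unfold ψ fold
  split_ifs <;> simp

lemma map_fold {A B : Type*} [AddMonoid A] [AddMonoid B] (g : A →+ B) (v : ZMod (2 * n + 2) → A)
    (i : ZMod (2 * n + 1)) : g (fold v i) = fold (fun j => g (v j)) i := by
  unfold fold
  split_ifs
  · exact map_add g _ _
  · rfl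

lemma fold_add_smul {A : Type*} [AddCommGroup A] (v : ZMod (2 * n + 2) → A)
    (m : ZMod (2 * n + 2) → ℤ) (x : A) (i : ZMod (2 * n + 1)) :
    fold (fun j => v j + m j • x) i = fold v i + fold m i • x := by
  unfold fold
  split_ifs
  · rw [add_smul]; exact add_add_add_comm _ _ _ _
  · rfl

lemma fold_sub_smul {A : Type*} [AddCommGroup A] (v : ZMod (2 * n + 2) → A)
    (m : ZMod (2 * n + 2) → ℤ) (x : A) (i : ZMod (2 * n + 1)) :
    fold (fun j => v j - m j • x) i = fold v i - fold m i • x := by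
  unfold fold
  split_ifs
  · rw [add_smul]; exact sub_add_sub_comm _ _ _ _
  · rfl

lemma natCast_eq_natCast_add_one {N a b : ℕ} (hN : 2 ≤ N) (ha : a < N) (hb : b < N) :
    (b : ZMod N) = (a : ZMod N) + 1 ↔ b = a + 1 ∨ a + 1 = N ∧ b = 0 := by
  have : NeZero N := ⟨by omega⟩
  rw [← Nat.cast_succ, ZMod.natCast_eq_natCast_iff', Nat.mod_eq_of_lt hb]
  rcases Nat.lt_or_ge (a + 1) N with h | h
  · rw [Nat.succ_eq_add_one, Nat.mod_eq_of_lt h]; omega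
  · have h2 : a + 1 = N := by omega
    rw [Nat.succ_eq_add_one, h2, Nat.mod_self]; omega

lemma natCast_eq_natCast_sub_one {N a b : ℕ} (hN : 2 ≤ N) (ha : a < N) (hb : b < N) :
    (b : ZMod N) = (a : ZMod N) - 1 ↔ a = b + 1 ∨ b + 1 = N ∧ a = 0 := by
  rw [← natCast_eq_natCast_add_one hN hb ha, eq_sub_iff_add_eq, eq_comm]

lemma natCast_eq_natCast_of_lt {N a b : ℕ} (ha : a < N) (hb : b < N) :
    (b : ZMod N) = (a : ZMod N) ↔ b = a := by
  rw [ZMod.natCast_eq_natCast_iff', Nat.mod_eq_of_lt ha, Nat.mod_eq_of_lt hb]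

lemma orient_natCast {N a b : ℕ} (hN : 2 ≤ N) (ha : a < N) (hb : b < N) :
    orient (a : ZMod N) b = if b = a + 1 ∨ a + 1 = N ∧ b = 0 then 1 else
      if a = b + 1 ∨ b + 1 = N ∧ a = 0 then -1 else 0 := by
  simp only [orient, natCast_eq_natCast_add_one hN ha hb, natCast_eq_natCast_sub_one hN ha hb]

lemma cartan_natCast {N a b : ℕ} (hN : 2 ≤ N) (ha : a < N) (hb : b < N) :
    cartan (a : ZMod N) b = if b = a then 2 else if (b = a + 1 ∨ a + 1 = N ∧ b = 0) ∨
      (a = b + 1 ∨ b + 1 = N ∧ a = 0) then -1 else 0 := by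
  simp only [cartan, natCast_eq_natCast_add_one hN ha hb, natCast_eq_natCast_sub_one hN ha hb,
    natCast_eq_natCast_of_lt ha hb]

lemma fold_natCast {A : Type*} [Add A] (v : ZMod (2 * n + 2) → A) {a : ℕ} (ha : a < 2 * n + 1) :
    fold v (a : ZMod (2 * n + 1)) = if a = 0 then v ((0 : ℕ) : ZMod (2 * n + 2)) +
      v ((1 : ℕ) : ZMod (2 * n + 2)) else v ((a + 1 : ℕ) : ZMod (2 * n + 2)) := by
  have h : (a : ZMod (2 * n + 1)) = 0 ↔ a = 0 := by
    rw [← Nat.cast_zero, natCast_eq_natCast_of_lt (by omega) ha]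
  unfold fold
  simp only [h, shift, ZMod.val_cast_of_lt ha, Nat.cast_zero, Nat.cast_one]

lemma exists_natCast_eq {N : ℕ} [NeZero N] (i : ZMod N) : ∃ a < N, (a : ZMod N) = i :=
  ⟨i.val, ZMod.val_lt i, ZMod.natCast_zmod_val i⟩

/-- Merging the nodes `0` and `1` shortens the oriented cycle by one. The edge between them
contributes `1` and `-1`. -/
lemma fold_fold_orient (hn : 1 ≤ n) (i j : ZMod (2 * n + 1)) :
    fold (fun b => fold (fun a => orient a b) i) j = orient i j := by
  obtain ⟨a, ha, rfl⟩ := exists_natCast_eq i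
  obtain ⟨b, hb, rfl⟩ := exists_natCast_eq j
  rw [orient_natCast (by omega) ha hb, fold_natCast _ hb, fold_natCast _ ha, fold_natCast _ ha,
    fold_natCast _ ha]
  rcases Nat.eq_zero_or_pos a with h | h <;> rcases Nat.eq_zero_or_pos b with h' | h'
  · rw [if_pos h', if_pos h, if_pos h, orient_natCast, orient_natCast, orient_natCast,
      orient_natCast] <;> omega
  · rw [if_neg h'.ne', if_pos h, orient_natCast, orient_natCast] <;> omega
  · rw [if_pos h', if_neg h.ne', if_neg h.ne', orient_natCast, orient_natCast] <;> omega
  · rw [if_neg h'.ne', if_neg h.ne', orient_natCast] <;> omega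

/-- At the merged node the entries give `2 + 2 - 1 - 1 = 2`, so the folded matrix is the Cartan
matrix of the cycle with one node less. -/
lemma fold_fold_cartan (hn : 1 ≤ n) (i j : ZMod (2 * n + 1)) :
    fold (fun b => fold (fun a => cartan a b) i) j = cartan i j := by
  obtain ⟨a, ha, rfl⟩ := exists_natCast_eq i
  obtain ⟨b, hb, rfl⟩ := exists_natCast_eq j
  rw [cartan_natCast (by omega) ha hb, fold_natCast _ hb, fold_natCast _ ha, fold_natCast _ ha,
    fold_natCast _ ha]
  rcases Nat.eq_zero_or_pos a with h | h <;> rcases Nat.eq_zero_or_pos b with h' | h'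
  · rw [if_pos h', if_pos h, if_pos h, cartan_natCast, cartan_natCast, cartan_natCast,
      cartan_natCast] <;> omega
  · rw [if_neg h'.ne', if_pos h, cartan_natCast, cartan_natCast] <;> omega
  · rw [if_pos h', if_neg h.ne', if_neg h.ne', cartan_natCast, cartan_natCast] <;> omega
  · rw [if_neg h'.ne', if_neg h.ne', cartan_natCast] <;> omega

lemma shift_ne {i : ZMod (2 * n + 1)} (hi : i ≠ 0) : shift i ≠ 0 ∧ shift i ≠ 1 := by
  have h1 : i.val ≠ 0 := fun h => hi ((ZMod.val_eq_zero i).mp h)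
  have h2 := ZMod.val_lt i
  exact ⟨natCast_ne_zero_zmod (by omega) (by omega), natCast_ne_one_zmod (by omega) (by omega)⟩

end Folding

/-! ### The reflections `r i` modulo `ε`. -/

section Reflections

lemma F.h'_ne_zero (hn : 1 ≤ n) : (h' : F n) ≠ 0 := by
  rw [← F.paramHom_none hn, Ne, map_eq_zero_iff _ (F.paramHom_injective hn)]
  exact X_ne_zero none

/-- Each `ψ i` has a partner with which its commutator is the nonzero element `h'`. -/
lemma F.ψ_ne_zero (hn : 1 ≤ n) (i : ZMod (2 * n + 1)) : (ψ i : F n) ≠ 0 := by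
  have key : ∀ x : F n, ∀ y, x * y - y * x = h' → x ≠ 0 := by
    rintro x y hxy rfl
    rw [zero_mul, mul_zero, sub_zero] at hxy
    exact F.h'_ne_zero hn hxy.symm
  by_cases hi : i = 0
  · refine key _ (φ 2) ?_
    have h1 := (F.coreRel hn).comm 0 2
    have h2 := (F.coreRel hn).comm 1 2
    have e1 : orient (0 : ZMod (2 * n + 2)) 2 = 0 := by
      have := orient_natCast (N := 2 * n + 2) (a := 0) (b := 2) (by omega) (by omega) (by omega)
      rw [if_neg (by omega), if_neg (by omega)] at this
      exact_mod_cast this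
    have e2 : orient (1 : ZMod (2 * n + 2)) 2 = 1 := by
      have := orient_succ (1 : ZMod (2 * n + 2))
      rwa [one_add_one_eq_two] at this
    rw [e1, zero_smul] at h1
    rw [e2, one_smul] at h2
    rw [ψ, if_pos hi, add_mul, add_mul, mul_add, mul_add, F.t_comm, add_sub_add_right_eq_sub,
      add_sub_add_comm, h1, h2, zero_add]
  · refine key _ (φ (shift i + 1)) ?_
    rw [ψ, if_neg hi, (F.coreRel hn).comm, orient_succ, one_smul]

lemma F.isUnit_ψ (hn : 1 ≤ n) (i : ZMod (2 * n + 1)) : IsUnit (ψ i : F n) :=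
  F.isUnit_of_ne_zero hn _ (F.ψ_ne_zero hn i)

lemma exists_eq_X_mul {A : Type} [Ring A] {s : PowerSeries A}
    (hs : PowerSeries.constantCoeff s = 0) :
    ∃ u, s = PowerSeries.X * u ∧ PowerSeries.constantCoeff u = PowerSeries.coeff 1 s := by
  obtain ⟨u, rfl⟩ := PowerSeries.X_dvd_iff.mpr hs
  exact ⟨u, rfl, by rw [coeff_one_mul]; simp⟩

lemma constantCoeff_ringInverse {A : Type} [Ring A] [Algebra ℂ A] {b : PowerSeries A}
    (hb : IsUnit (PowerSeries.constantCoeff b)) : PowerSeries.constantCoeff (Ring.inverse b) =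
      Ring.inverse (PowerSeries.constantCoeff b) := by
  have h := Ring.mul_inverse_cancel _ (isUnit_of_constantCoeff hb)
  have h2 := congrArg PowerSeries.constantCoeff h
  rw [map_mul, map_one] at h2
  calc _ = Ring.inverse (PowerSeries.constantCoeff b) * (PowerSeries.constantCoeff b *
        PowerSeries.constantCoeff (Ring.inverse b)) := by
        rw [← mul_assoc, Ring.inverse_mul_cancel _ hb, one_mul]
    _ = _ := by rw [h2, mul_one]

lemma toLaurent_X_sq_mul_inverse (hn : 1 ≤ n) (a : PowerSeries (F n)) {b : PowerSeries (F n)}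
    (hb : IsUnit b) : toLaurent n (PowerSeries.X ^ 2 * a) *
      Ring.inverse (toLaurent n (PowerSeries.X * b)) =
      toLaurent n (PowerSeries.X * (a * Ring.inverse b)) := by
  have := F.h'_ne_zero hn
  have : Nontrivial (F n) := ⟨⟨_, _, this⟩⟩
  have hu : IsUnit (toLaurent n (PowerSeries.X * b)) := by
    refine laurent_isUnit hn _ fun h => PowerSeries.X_ne_zero (R := F n) ?_
    rw [← map_zero (toLaurent n)] at h
    have h2 := toLaurent_injective h
    rw [← mul_one PowerSeries.X, ← Ring.mul_inverse_cancel b hb, ← mul_assoc, h2, zero_mul]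
  have e : PowerSeries.X * (a * Ring.inverse b) * (PowerSeries.X * b) = PowerSeries.X ^ 2 * a := by
    rw [mul_assoc PowerSeries.X, ← mul_assoc (a * _), ← X_comm, mul_assoc PowerSeries.X,
      mul_assoc a, Ring.inverse_mul_cancel b hb, mul_one, ← mul_assoc, pow_two]
  rw [← e, map_mul _ _ (PowerSeries.X * b), mul_assoc, Ring.mul_inverse_cancel _ hu, mul_one]

variable {Ψ : K n →ₐ[ℂ] LaurentSeries (F n)} (W : WeylAction n)

lemma WeylAction.r_zero_f (hn : 1 ≤ n) (j : ZMod (2 * n + 2)) : W.r 0 (f j) = f j +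
    orient 0 j • (α 0 * Ring.inverse (f 0)) +
    orient 1 j • ((α 0 + α 1) * Ring.inverse (f 1 + α 0 * Ring.inverse (f 0))) +
    orient 0 j • (α 1 * Ring.inverse
      (f 0 - (α 0 + α 1) * Ring.inverse (f 1 + α 0 * Ring.inverse (f 0)))) := by
  have hinv : ∀ (g : K n ≃ₐ[ℂ] K n) (i : ZMod (2 * n + 2)),
      g (Ring.inverse (f i)) = Ring.inverse (g (f i)) := fun g i =>
    map_ringInverse (g : K n →ₐ[ℂ] K n) (K.isUnit_f hn i)
  have hinv2 : W.s 0 (Ring.inverse (W.s 1 (f 0))) = Ring.inverse (W.s 0 (W.s 1 (f 0))) :=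
    map_ringInverse (W.s 0 : K n →ₐ[ℂ] K n) ((K.isUnit_f hn 0).map (W.s 1))
  have o01 : orient (0 : ZMod (2 * n + 2)) 1 = 1 := by
    have := orient_succ (0 : ZMod (2 * n + 2)); rwa [zero_add] at this
  have o10 : orient (1 : ZMod (2 * n + 2)) 0 = -1 := by rw [orient_antisymm hn, o01]
  have c01 : cartan (0 : ZMod (2 * n + 2)) 1 = -1 := by simp [cartan, one_ne_zero_zmod]
  have c10 : cartan (1 : ZMod (2 * n + 2)) 0 = -1 := by simp [cartan, one_ne_zero_zmod.symm]
  have a01 : W.s 0 (α 1) = α 0 + α 1 := by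
    rw [W.s_α, c01, neg_smul, one_smul, sub_neg_eq_add, add_comm]
  have a10 : W.s 1 (α 0) = α 0 + α 1 := by
    rw [W.s_α, c10, neg_smul, one_smul, sub_neg_eq_add]
  have a00 : W.s 0 (α 0 + α 1) = α 1 := by
    rw [map_add, a01, W.s_α, cartan_self, two_smul]; abel
  have f01 : W.s 0 (f 1) = f 1 + α 0 * Ring.inverse (f 0) := by rw [W.s_f, o01, one_smul]
  have f00 : W.s 0 (f 0) = f 0 := W.s_f_of_orient (orient_self hn 0)
  have f10 : W.s 0 (W.s 1 (f 0)) =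
      f 0 - (α 0 + α 1) * Ring.inverse (f 1 + α 0 * Ring.inverse (f 0)) := by
    rw [W.s_f 1, o10, neg_smul, one_smul, ← sub_eq_add_neg, map_sub, f00, map_mul, a01, hinv, f01]
  have e : W.r 0 (f j) = W.s 0 (W.s 1 (W.s 0 (f j))) := by
    rw [WeylAction.r, if_pos rfl]; rfl
  rw [e, W.s_f 0 j, map_add, map_zsmul, map_mul, a10, hinv, W.s_f 1 j, map_add, map_add, map_zsmul,
    map_zsmul, map_mul, map_mul, a00, a01, hinv2, f10, hinv, f01, W.s_f 0 j]

lemma WeylAction.r_of_ne {i : ZMod (2 * n + 1)} (hi : i ≠ 0) : W.r i = W.s (shift i) := if_neg hi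

lemma WeylAction.r_h (i : ZMod (2 * n + 1)) : W.r i h = h := by
  unfold WeylAction.r
  split_ifs
  · rw [AlgEquiv.mul_apply, AlgEquiv.mul_apply, W.s_h, W.s_h, W.s_h]
  · exact W.s_h _

/-- The reflections act on `F` modulo `ε` by the elementary Bäcklund transformations. -/
lemma IsPsi.exists_r_f (hn : 1 ≤ n) (hΨ : IsPsi Ψ) (i : ZMod (2 * n + 1)) (j : ZMod (2 * n + 2)) :
    ∃ p, Ψ (W.r i (f j)) = toLaurent n (((delta j : ℤ) : PowerSeries (F n)) + PowerSeries.X * p) ∧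
      PowerSeries.constantCoeff p =
        φ j + fold (fun a => orient a j) i • (γ i * Ring.inverse (ψ i)) := by
  by_cases hi : i = 0
  · subst hi
    obtain ⟨f0, f1, _⟩ := coeff_fSeries (n := n) (j := 0)
    obtain ⟨g0, g1, _⟩ := coeff_fSeries (n := n) (j := 1)
    have ha := coeff_αSum (n := n) (Nat.zero_le _)
    have ha0 : αSum n 0 = αSeries 0 := by simp [αSum]
    rw [ha0] at ha
    rw [delta_zero, Int.cast_one] at f0
    rw [delta_one, Int.cast_one] at g0
    have hf : IsUnit (fSeries (0 : ZMod (2 * n + 2))) :=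
      isUnit_of_constantCoeff (by rw [f0]; exact isUnit_one)
    obtain ⟨m0, m1, _⟩ := coeff_mul_inverse ha f0 f1
    -- The constants `1` of `f 1` and `-1` of `α 0 / f 0` cancel. After division by `ε` the constant
    -- term is `φ 0 + φ 1 + t`, which is the origin of `ψ 0`.
    obtain ⟨e, he, he0⟩ := exists_eq_X_mul
      (s := fSeries 1 + αSeries 0 * Ring.inverse (fSeries (0 : ZMod (2 * n + 2))))
      (by rw [map_add, g0, m0, add_neg_cancel])
    have he1 : PowerSeries.constantCoeff e = ψ 0 := by
      rw [he0, map_add, g1, m1, ψ, if_pos rfl]; abel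
    have heu : IsUnit (PowerSeries.constantCoeff e) := by rw [he1]; exact F.isUnit_ψ hn 0
    have heu' : IsUnit e := isUnit_of_constantCoeff heu
    have hα1 : (αSeries 1 : PowerSeries (F n)) =
        1 - PowerSeries.X * PowerSeries.C t + PowerSeries.X ^ 2 * PowerSeries.C (β 1) := by
      rw [αSeries, αLow, if_neg one_ne_zero_zmod, if_pos rfl]
    have hαα : (αSeries 0 : PowerSeries (F n)) + αSeries 1 =
        PowerSeries.X ^ 2 * PowerSeries.C (γ 0) := by
      rw [hα1, αSeries_zero, γ, if_pos rfl, map_add, mul_add]; abel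
    set y := PowerSeries.C (γ 0) * Ring.inverse e with hy
    have hy0 : PowerSeries.constantCoeff y = γ 0 * Ring.inverse (ψ 0) := by
      rw [hy, map_mul, constantCoeff_ringInverse heu, he1, PowerSeries.constantCoeff_C]
    set w := fSeries (0 : ZMod (2 * n + 2)) - PowerSeries.X * y with hw
    have w0 : PowerSeries.constantCoeff w = 1 := by rw [hw, map_sub, f0]; simp
    have w1 : PowerSeries.coeff 1 w = φ 0 - γ 0 * Ring.inverse (ψ 0) := by
      rw [hw, map_sub, f1, coeff_one_mul, hy0]; simp
    have hwu : IsUnit w := isUnit_of_constantCoeff (by rw [w0]; exact isUnit_one)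
    obtain ⟨b0, b1, _⟩ := coeff_quadratic 1 (-t) (β (1 : ZMod (2 * n + 2)))
    have hα1' : PowerSeries.C 1 + PowerSeries.X * PowerSeries.C (-t) +
        PowerSeries.X ^ 2 * PowerSeries.C (β (1 : ZMod (2 * n + 2))) = αSeries 1 := by
      rw [hα1, map_one, map_neg, mul_neg, ← sub_eq_add_neg]
    rw [hα1'] at b0 b1
    obtain ⟨v0, v1, _⟩ := coeff_inverse_of_constantCoeff_one w0
    -- The first and third corrections of `s 0 s 1 s 0` carry the same coefficient `orient 0 j`, and
    -- their constants `-1` and `1` cancel. In the linear term `φ 0 + t` cancels as well, and only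
    -- the contribution of `y` through the inverse of `w` survives.
    obtain ⟨z, hz, hz0⟩ := exists_eq_X_mul
      (s := αSeries 0 * Ring.inverse (fSeries (0 : ZMod (2 * n + 2))) +
        αSeries 1 * Ring.inverse w)
      (by rw [map_add, m0, map_mul, b0, v0]; simp)
    have hz1 : PowerSeries.constantCoeff z = γ 0 * Ring.inverse (ψ 0) := by
      rw [hz0, map_add, m1, coeff_one_mul, b0, b1, v0, v1, w1]
      rw [one_mul, mul_one]; abel
    have e1 : Ψ (α 0 * Ring.inverse (f 0)) =
        toLaurent n (αSeries 0 * Ring.inverse (fSeries 0)) := by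
      rw [map_mul, map_ringInverse _ (K.isUnit_f hn 0), hΨ.f_eq, hΨ.α_eq, map_mul,
        map_ringInverse _ hf]
    have e2 : Ψ (f 1 + α 0 * Ring.inverse (f 0)) = toLaurent n (PowerSeries.X * e) := by
      rw [map_add, e1, hΨ.f_eq, ← map_add, he]
    -- `Ring.inverse` is compatible with `Ψ` at units. In a skew field it suffices that the image
    -- under `Ψ` is nonzero.
    have unit_of : ∀ x : K n, (∃ s : PowerSeries (F n), s ≠ 0 ∧ Ψ x = toLaurent n s) → IsUnit x := by
      rintro x ⟨s, hs, hx⟩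
      refine K.isUnit_of_ne_zero hn x ?_
      rintro rfl
      rw [map_zero, ← map_zero (toLaurent n)] at hx
      exact hs (toLaurent_injective hx).symm
    have : Nontrivial (F n) := ⟨⟨_, _, F.h'_ne_zero hn⟩⟩
    have u2 : IsUnit (f 1 + α 0 * Ring.inverse (f 0) : K n) := by
      refine unit_of _ ⟨_, fun h => F.ψ_ne_zero hn 0 ?_, e2⟩
      rw [← he1, X_mul_cancel (h.trans (mul_zero _).symm), map_zero]
    have e3 : Ψ ((α 0 + α 1) * Ring.inverse (f 1 + α 0 * Ring.inverse (f 0))) =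
        toLaurent n (PowerSeries.X * y) := by
      rw [map_mul, map_ringInverse _ u2, e2, map_add, hΨ.α_eq, hΨ.α_eq, ← map_add, hαα,
        toLaurent_X_sq_mul_inverse hn _ heu']
    have e4 : Ψ (f 0 - (α 0 + α 1) * Ring.inverse (f 1 + α 0 * Ring.inverse (f 0))) =
        toLaurent n w := by
      rw [map_sub, e3, hΨ.f_eq, ← map_sub]
    have u4 : IsUnit (f 0 - (α 0 + α 1) * Ring.inverse (f 1 + α 0 * Ring.inverse (f 0)) : K n) :=
      unit_of _ ⟨w, fun h => by rw [h, map_zero] at w0; exact zero_ne_one w0, e4⟩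
    refine ⟨PowerSeries.C (φ j) + orient 0 j • z + orient 1 j • y, ?_, ?_⟩
    · have hz' := congrArg (fun s => orient 0 j • s) hz
      simp only [smul_add] at hz'
      rw [W.r_zero_f hn, map_add, map_add, map_add, map_zsmul, map_zsmul, map_zsmul, map_mul Ψ (α 1),
        map_ringInverse _ u4, e1, e3, e4, hΨ.f_eq, hΨ.α_eq, ← map_ringInverse _ hwu, ← map_mul,
        ← map_zsmul, ← map_zsmul, ← map_zsmul, ← map_add, ← map_add, ← map_add, add_right_comm _ _
        (orient 0 j • (αSeries 1 * _)), add_assoc (fSeries j), hz', fSeries, mul_add, mul_add,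
        mul_smul_comm, mul_smul_comm]
      simp only [add_assoc]
    · rw [map_add, map_add, map_zsmul, map_zsmul, hz1, hy0, PowerSeries.constantCoeff_C, fold_zero,
        add_smul, add_assoc]
  · obtain ⟨h0, h1⟩ := shift_ne hi
    have hψ : ψ i = (φ (shift i) : F n) := if_neg hi
    have hγ : γ i = (β (shift i) : F n) := if_neg hi
    refine ⟨PowerSeries.C (φ j + orient (shift i) j • (γ i * Ring.inverse (ψ i))), ?_, ?_⟩
    · have hu : IsUnit (PowerSeries.C (ψ i) : PowerSeries (F n)) :=
        (F.isUnit_ψ hn i).map PowerSeries.C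
      have hc : PowerSeries.C (Ring.inverse (ψ i)) = Ring.inverse (PowerSeries.C (ψ i : F n)) := by
        obtain ⟨u, hu⟩ := F.isUnit_ψ hn i
        rw [← hu, Ring.inverse_unit]
        exact (Ring.inverse_unit (Units.map (PowerSeries.C : F n →+* PowerSeries (F n)).toMonoidHom u)).symm
      have hf : fSeries (shift i) = PowerSeries.X * PowerSeries.C (ψ i) := by
        rw [fSeries, delta_of_ne h0 h1, Int.cast_zero, zero_add, hψ]
      have ha : αSeries (shift i) = PowerSeries.X ^ 2 * PowerSeries.C (γ i) := by
        rw [αSeries_of_ne h0 h1, hγ]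
      rw [W.r_of_ne hi, W.s_f, map_add, map_zsmul, map_mul, map_ringInverse _ (K.isUnit_f hn _),
        hΨ.f_eq, hΨ.f_eq, hΨ.α_eq, hf, ha, toLaurent_X_sq_mul_inverse hn _ hu, ← hc, ← map_mul,
        ← map_zsmul, ← map_add, fSeries, map_add PowerSeries.C, map_zsmul, mul_add, mul_smul_comm,
        add_assoc]
    · rw [PowerSeries.constantCoeff_C, fold_of_ne _ hi]

end Reflections

end QPainleve
end

noncomputable section
namespace QPainleve

open MvPolynomial

variable {n : ℕ}

/-! ### Existence of the automorphisms of `F[[ε]]` -/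

section Homs

/-- The constant term as a `ℂ`-algebra homomorphism. -/
def constantCoeffHom (A : Type) [Ring A] [Algebra ℂ A] : PowerSeries A →ₐ[ℂ] A :=
  { (PowerSeries.constantCoeff : PowerSeries A →+* A) with
    commutes' := fun r => by simp [PowerSeries.algebraMap_apply] }

lemma constantCoeffHom_apply {A : Type} [Ring A] [Algebra ℂ A] (s : PowerSeries A) :
    constantCoeffHom A s = PowerSeries.constantCoeff s := rfl

/-- The inclusion of constants as a `ℂ`-algebra homomorphism. -/
def constHom (A : Type) [Ring A] [Algebra ℂ A] : A →ₐ[ℂ] PowerSeries A :=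
  { (PowerSeries.C : A →+* PowerSeries A) with
    commutes' := fun r => by simp [PowerSeries.algebraMap_apply] }

lemma constHom_apply {A : Type} [Ring A] [Algebra ℂ A] (x : A) :
    constHom A x = PowerSeries.C x := rfl

/-- A power series is a unit when its constant term is, so only the composite with the constant term
must be injective on `FAlg n`. This is tested on the constant terms of the parameters. -/
lemma F.exists_hom (hn : 1 ≤ n) {p b : ZMod (2 * n + 2) → PowerSeries (F n)} {u : PowerSeries (F n)}
    (H : CoreRel p b (PowerSeries.C h')) (hs : SumRel p 0) (ht : TimeRel p b u (PowerSeries.C h'))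
    {η : Option (ZMod (2 * n + 2)) → MvPolynomial (Option (ZMod (2 * n + 2))) ℂ}
    (hη : AlgebraicIndependent ℂ η) (hh : h' = F.paramHom hn (η none))
    (hu : PowerSeries.constantCoeff u = F.paramHom hn (η (some 0)))
    (hb : ∀ j, j ≠ 0 → PowerSeries.constantCoeff (b j) = F.paramHom hn (η (some j))) :
    ∃ τ : F n →ₐ[ℂ] PowerSeries (F n), (∀ j, τ (φ j) = p j) ∧ (∀ j, τ (β j) = b j) ∧ τ t = u ∧
      τ h' = PowerSeries.C h' := by
  have hinj : Function.Injective ((constantCoeffHom (F n)).comp (FAlg.lift H hs ht)) := by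
    refine FAlg.hom_injective hn _ (F.paramHom hn) (F.paramHom_injective hn) η (fun c => ?_) hη
    rw [AlgHom.comp_apply, constantCoeffHom_apply]
    rcases c with _ | j
    · rw [FAlg.central, FAlg.lift_h', PowerSeries.constantCoeff_C, hh]
    · by_cases hj : j = 0
      · rw [FAlg.central, if_pos hj, FAlg.lift_t, hu, hj]
      · rw [FAlg.central, if_neg hj, FAlg.lift_β, hb j hj]
  refine ⟨SkewFrac.lift (FAlg.lift H hs ht) fun a ha => isUnit_of_constantCoeff
    (isUnit_of_injective (F.isUnit_of_ne_zero hn) hinj a ha), fun j => ?_, fun j => ?_, ?_, ?_⟩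
  · exact (SkewFrac.lift_of _ _ _).trans (FAlg.lift_φ H hs ht j)
  · exact (SkewFrac.lift_of _ _ _).trans (FAlg.lift_β H hs ht j)
  · exact (SkewFrac.lift_of _ _ _).trans (FAlg.lift_t H hs ht)
  · exact (SkewFrac.lift_of _ _ _).trans (FAlg.lift_h' H hs ht)

variable {Ψ' : K n →ₐ[ℂ] LaurentSeries (F n)} {p b : ZMod (2 * n + 2) → PowerSeries (F n)}

/-- The relations of `p` need no computation: they are those of `K` transported by a homomorphism,
with the common factor `X ^ 2` cancelled. -/
lemma affine_coreRel (hn : 1 ≤ n)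
    (hf : ∀ j, Ψ' (f j) = toLaurent n (((delta j : ℤ) : PowerSeries (F n)) + PowerSeries.X * p j))
    (hh : Ψ' h = toLaurent n (PowerSeries.X ^ 2 * PowerSeries.C h'))
    (hb : ∀ j s, b j * s = s * b j) : CoreRel p b (PowerSeries.C h') := by
  refine ⟨fun i j => ?_, fun i j => (hb j _).symm, fun i j => hb i _,
    fun i => C_comm (F.h'_comm hn) _, fun i => C_comm (F.h'_comm hn) _⟩
  have h1 := ((K.coreRel hn).map (Ψ' : K n →+* LaurentSeries (F n))).comm i j
  have h2 : ∀ x, (Ψ' : K n →+* LaurentSeries (F n)) x = Ψ' x := fun _ => rfl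
  rw [h2, h2, h2, hf, hf, hh, ← map_mul, ← map_mul, ← map_sub, ← map_zsmul, affine_commutator,
    ← mul_smul_comm, pow_two, mul_assoc, mul_assoc] at h1
  exact X_mul_cancel (X_mul_cancel (toLaurent_injective h1))

lemma affine_sumRel
    (hf : ∀ j, Ψ' (f j) = toLaurent n (((delta j : ℤ) : PowerSeries (F n)) + PowerSeries.X * p j)) :
    SumRel p 0 := by
  have h1 := (K.sumRel (n := n)).map (Ψ' : K n →+* LaurentSeries (F n))
  have h2 : ∀ x, (Ψ' : K n →+* LaurentSeries (F n)) x = Ψ' x := fun _ => rfl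
  have h3 := delta_sumRel (n := n) (R := PowerSeries (F n))
  simp only [h2, hf, map_one] at h1
  constructor
  · have h4 := h1.even
    rw [← map_sum, ← map_one (toLaurent n), Finset.sum_add_distrib, h3.even, ← Finset.mul_sum] at h4
    have h5 := toLaurent_injective h4
    rw [add_eq_left] at h5
    exact X_mul_cancel (h5.trans (mul_zero _).symm)
  · have h4 := h1.odd
    rw [← map_sum, ← map_one (toLaurent n), Finset.sum_add_distrib, h3.odd, ← Finset.mul_sum] at h4
    have h5 := toLaurent_injective h4
    rw [add_eq_left] at h5
    exact X_mul_cancel (h5.trans (mul_zero _).symm)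

lemma epow_neg_one_mul (s : PowerSeries (F n)) :
    epow n (-1) * toLaurent n (PowerSeries.X * s) = toLaurent n s := by
  rw [map_mul, toLaurent_X, ← mul_assoc, epow, epow, HahnSeries.single_mul_single]
  simp

end Homs

/-! ### The automorphism `T₁` of power series. -/

section Translation

variable {Ψ : K n →ₐ[ℂ] LaurentSeries (F n)} (W : WeylAction n)

lemma WeylAction.T₁_h : W.T₁ h = h := by
  have : ∀ l : List (K n ≃ₐ[ℂ] K n), (∀ g ∈ l, g h = h) → l.prod h = h := by
    intro l
    induction l with
    | nil => intro _; rfl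
    | cons g l ih =>
      intro hl
      rw [List.prod_cons, AlgEquiv.mul_apply, ih fun g hg => hl g (List.mem_cons_of_mem _ hg),
        hl g List.mem_cons_self]
  rw [WeylAction.T₁, AlgEquiv.mul_apply, this, W.π_h]
  intro g hg
  obtain ⟨m, -, rfl⟩ := List.mem_map.mp hg
  exact W.s_h _

lemma exists_revIndex {j : ZMod (2 * n + 2)} (h0 : j ≠ 0) (h1 : j ≠ 1) :
    ∃ k, k + 1 ≤ 2 * n ∧ revIndex n k = j := by
  have hj := ZMod.val_lt j
  have e0 : j.val ≠ 0 := fun h => h0 ((ZMod.val_eq_zero j).mp h)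
  have e1 : j.val ≠ 1 := by
    intro h
    apply h1
    rw [← ZMod.natCast_zmod_val j, h, Nat.cast_one]
  refine ⟨2 * n + 1 - j.val, by omega, ?_⟩
  rw [← natCast_sub_eq_revIndex (by omega),
    show 2 * n + 1 - (2 * n + 1 - j.val) = j.val by omega, ZMod.natCast_zmod_val]

lemma IsPsi.exists_T₁_f (hn : 1 ≤ n) (hΨ : IsPsi Ψ) (j : ZMod (2 * n + 2)) :
    ∃ p, Ψ (W.T₁ (f j)) = toLaurent n (((delta j : ℤ) : PowerSeries (F n)) + PowerSeries.X * p) ∧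
      PowerSeries.constantCoeff p = φ j := by
  -- Deviations from `Ψ (f j)` of the form `ε q` with `q` vanishing at `ε = 0`. The expansion
  -- settles the indices other than `0` and `1`, and the sum relations carry the property to these
  -- two.
  let S : AddSubgroup (LaurentSeries (F n)) :=
    { carrier := {x | ∃ q, x = toLaurent n (PowerSeries.X * q) ∧ PowerSeries.constantCoeff q = 0}
      zero_mem' := ⟨0, by simp, map_zero _⟩
      add_mem' := by
        rintro _ _ ⟨q, rfl, hq⟩ ⟨r, rfl, hr⟩
        exact ⟨q + r, by rw [mul_add, map_add], by rw [map_add, hq, hr, add_zero]⟩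
      neg_mem' := by
        rintro _ ⟨q, rfl, hq⟩
        exact ⟨-q, by rw [mul_neg, map_neg], by rw [map_neg, hq, neg_zero]⟩ }
  have h1 := ((K.sumRel (n := n)).map
    ((Ψ.comp (W.T₁ : K n →ₐ[ℂ] K n) : K n →ₐ[ℂ] _) : K n →+* LaurentSeries (F n)))
  rw [map_one] at h1
  have h2 := laurent_sumRel (n := n)
  have hs : SumRel (fun j => Ψ (W.T₁ (f j)) - toLaurent n (fSeries j)) 0 :=
    ⟨by rw [Finset.sum_sub_distrib, h2.even, sub_eq_zero]; exact h1.even,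
      by rw [Finset.sum_sub_distrib, h2.odd, sub_eq_zero]; exact h1.odd⟩
  obtain ⟨q, hq, hq0⟩ := noncentral_induction hs S S.zero_mem (fun j h0 h1 => by
    obtain ⟨k, hk, rfl⟩ := exists_revIndex h0 h1
    obtain ⟨c0, c1, -⟩ := coeff_translateSeries hk
    obtain ⟨u, hu, hu0⟩ := exists_eq_X_mul c0
    refine ⟨u - PowerSeries.C (φ (revIndex n k)), ?_, ?_⟩
    · rw [hΨ.map_T₁_f hn W hk, hu, fSeries, delta_of_ne h0 h1, Int.cast_zero, zero_add, ← map_sub,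
        mul_sub]
    · rw [map_sub, hu0, c1, PowerSeries.constantCoeff_C, sub_self]) j
  refine ⟨PowerSeries.C (φ j) + q, ?_, ?_⟩
  · rw [mul_add, ← add_assoc, map_add, ← hq]
    exact (add_sub_cancel (toLaurent n (fSeries j)) _).symm
  · rw [map_add, hq0, add_zero, PowerSeries.constantCoeff_C]

lemma IsPsi.exists_isShift (hn : 1 ≤ n) (hΨ : IsPsi Ψ) : ∃ T, IsShift W Ψ T := by
  choose p hp hp0 using hΨ.exists_T₁_f W hn
  have hh : (Ψ.comp (W.T₁ : K n →ₐ[ℂ] K n)) h = toLaurent n (PowerSeries.X ^ 2 * PowerSeries.C h') :=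
    (congrArg Ψ W.T₁_h).trans hΨ.h_eq
  have H : CoreRel p (fun j => PowerSeries.C (β j)) (PowerSeries.C h') :=
    affine_coreRel hn hp hh fun j s => C_comm (F.β_comm hn j) s
  have hu : ∀ s : PowerSeries (F n), s * (PowerSeries.C t + PowerSeries.X) =
      (PowerSeries.C t + PowerSeries.X) * s := fun s => by
    rw [mul_add, add_mul, C_comm F.t_comm, X_comm]
  have ht : TimeRel p (fun j => PowerSeries.C (β j)) (PowerSeries.C t + PowerSeries.X)
      (PowerSeries.C h') :=
    ⟨fun i => hu _, fun i => hu _, (hu _).symm,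
      (F.timeRel.map (PowerSeries.C : F n →+* PowerSeries (F n))).sum_b⟩
  obtain ⟨τ, τφ, τβ, τt, τh⟩ := F.exists_hom hn H (affine_sumRel (Ψ' := Ψ.comp (W.T₁ : K n →ₐ[ℂ] K n)) hp) ht
    (MvPolynomial.algebraicIndependent_X _ ℂ) (F.paramHom_none hn).symm
    (by simp [F.paramHom_zero hn]) (fun j hj => by
      rw [F.paramHom_some hn hj, PowerSeries.constantCoeff_C])
  -- The shift is the identity modulo `ε`, which gives the bijectivity required by `extendEquiv`.
  have hid : (constantCoeffHom (F n)).comp τ = AlgHom.id ℂ (F n) := by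
    refine F.hom_ext (fun j => ?_) (fun j => ?_) ?_ ?_ <;>
      rw [AlgHom.comp_apply, constantCoeffHom_apply]
    · rw [τφ, hp0]; rfl
    · rw [τβ, PowerSeries.constantCoeff_C]; rfl
    · rw [τt]; simp
    · rw [τh, PowerSeries.constantCoeff_C]; rfl
  have hbij : Function.Bijective fun a => PowerSeries.constantCoeff (τ a) := by
    have : (fun a => PowerSeries.constantCoeff (τ a)) = id :=
      funext fun a => congrArg (fun g => g a) hid
    rw [this]; exact Function.bijective_id
  have hC : ∀ x, extendEquiv τ hbij (PowerSeries.C x) = τ x := extend_C τ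
  refine ⟨extendEquiv τ hbij, extend_X τ, (hC _).trans τt, fun i => (hC _).trans (τβ i),
    (hC _).trans τh, fun i hi => ?_⟩
  rw [hC, ψ, if_neg hi, τφ, hp, delta_of_ne (shift_ne hi).1 (shift_ne hi).2, Int.cast_zero, zero_add,
    epow_neg_one_mul]
  rfl

end Translation

/-! ### The automorphisms of `F` induced by the reflections. -/

section ReflectionOn

/-- The values on generators of the automorphism of `F` induced by `r i`. -/
structure IsReflectionOn (i : ZMod (2 * n + 1)) (ρ : F n →ₐ[ℂ] F n) : Prop where
  map_φ : ∀ j, ρ (φ j) = φ j + fold (fun a => orient a j) i • (γ i * Ring.inverse (ψ i))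
  map_β : ∀ j, ρ (β j) = β j - fold (fun a => cartan a j) i • γ i
  map_t : ρ t = t
  map_h' : ρ h' = h'

lemma orient_self_odd (hn : 1 ≤ n) (i : ZMod (2 * n + 1)) : orient i i = 0 := by
  obtain ⟨a, ha, rfl⟩ := exists_natCast_eq i
  rw [orient_natCast (by omega) ha ha, if_neg (by omega), if_neg (by omega)]

variable {i : ZMod (2 * n + 1)} {ρ : F n →ₐ[ℂ] F n}

lemma IsReflectionOn.map_ψ (hn : 1 ≤ n) (hρ : IsReflectionOn i ρ) (j : ZMod (2 * n + 1)) :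
    ρ (ψ j) = ψ j + orient i j • (γ i * Ring.inverse (ψ i)) := by
  have h1 := map_fold (ρ : F n →+ F n) φ j
  have h2 : ∀ x, (ρ : F n →+ F n) x = ρ x := fun _ => rfl
  simp only [h2, hρ.map_φ, fold_add_smul, fold_fold_orient hn] at h1
  rw [ψ_eq_fold j, map_add, h1, apply_ite ρ, hρ.map_t, map_zero, add_right_comm]

lemma IsReflectionOn.map_γ (hn : 1 ≤ n) (hρ : IsReflectionOn i ρ) (j : ZMod (2 * n + 1)) :
    ρ (γ j) = γ j - cartan i j • γ i := by
  have h1 := map_fold (ρ : F n →+ F n) β j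
  have h2 : ∀ x, (ρ : F n →+ F n) x = ρ x := fun _ => rfl
  simp only [h2, hρ.map_β, fold_sub_smul, fold_fold_cartan hn] at h1
  exact h1

lemma IsReflectionOn.map_γ_self (hn : 1 ≤ n) (hρ : IsReflectionOn i ρ) : ρ (γ i) = -γ i := by
  rw [hρ.map_γ hn, cartan_self, two_smul]; abel

lemma IsReflectionOn.map_inverse (hn : 1 ≤ n) (hρ : IsReflectionOn i ρ) :
    ρ (γ i * Ring.inverse (ψ i)) = -(γ i * Ring.inverse (ψ i)) := by
  rw [map_mul, map_ringInverse _ (F.isUnit_ψ hn i), hρ.map_ψ hn, hρ.map_γ_self hn,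
    orient_self_odd hn, zero_smul, add_zero, neg_mul]

/-- The corrections on `φ` and `β` are integer multiples of `γ i (ψ i)⁻¹` and of `γ i`, and both of
these elements are negated. -/
lemma IsReflectionOn.comp_self (hn : 1 ≤ n) (hρ : IsReflectionOn i ρ) :
    ρ.comp ρ = AlgHom.id ℂ (F n) := by
  refine F.hom_ext (fun j => ?_) (fun j => ?_) ?_ ?_ <;> rw [AlgHom.comp_apply]
  · rw [hρ.map_φ, map_add, map_zsmul, hρ.map_inverse hn, hρ.map_φ, smul_neg, add_neg_cancel_right]
    rfl
  · rw [hρ.map_β, map_sub, map_zsmul, hρ.map_γ_self hn, hρ.map_β, smul_neg, sub_neg_eq_add,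
      sub_add_cancel]
    rfl
  · rw [hρ.map_t, hρ.map_t]; rfl
  · rw [hρ.map_h', hρ.map_h']; rfl

lemma sum_cartan (hn : 1 ≤ n) (a : ZMod (2 * n + 2)) : ∑ j, cartan a j = 0 := by
  have h1 : a + 1 ≠ a := by rw [Ne, add_eq_left]; exact one_ne_zero_zmod
  have h2 : a - 1 ≠ a := by rw [Ne, sub_eq_self]; exact one_ne_zero_zmod
  have h3 := add_one_ne_sub_one hn a
  have : ∀ j, cartan a j = (if j = a then 2 else 0) - (if j = a + 1 then 1 else 0) -
      (if j = a - 1 then 1 else 0) := by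
    intro j
    unfold cartan
    split_ifs <;> simp_all
  simp [this]

lemma sum_fold_cartan (hn : 1 ≤ n) (i : ZMod (2 * n + 1)) :
    ∑ j, fold (fun a => cartan a j) i = 0 := by
  unfold fold
  split_ifs
  · rw [Finset.sum_add_distrib, sum_cartan hn, sum_cartan hn, add_zero]
  · exact sum_cartan hn _

/-- The generators `β j` as polynomials in the independent parameters. -/
def βPoly (j : ZMod (2 * n + 2)) : MvPolynomial (Option (ZMod (2 * n + 2))) ℂ :=
  if j = 0 then 1 - ∑ k ∈ Finset.univ.erase 0, X (some k) else X (some j)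

lemma βPoly_of_ne {j : ZMod (2 * n + 2)} (hj : j ≠ 0) : βPoly j = X (some j) := if_neg hj

lemma paramHom_fold_βPoly (hn : 1 ≤ n) (i : ZMod (2 * n + 1)) :
    F.paramHom hn (fold βPoly i) = γ i := by
  have := map_fold (F.paramHom hn : MvPolynomial (Option (ZMod (2 * n + 2))) ℂ →+ F n) βPoly i
  refine this.trans (congrArg (fun v => fold v i) (funext fun j => F.paramHom_β hn j))

/-- The substitution of the parameters under `r i`. -/
def foldReflectPoly (i : ZMod (2 * n + 1)) : MvPolynomial (Option (ZMod (2 * n + 2))) ℂ →ₐ[ℂ]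
    MvPolynomial (Option (ZMod (2 * n + 2))) ℂ :=
  aeval fun c => match c with
    | none => X none
    | some j => if j = 0 then X (some 0) else βPoly j - fold (fun a => cartan a j) i • fold βPoly i

/-- The case `j = 0`, where `β 0` is expressed by the other parameters, works because the folded
Cartan entries sum to zero, so that the reflection respects `∑ β = 1`. -/
lemma foldReflectPoly_βPoly (hn : 1 ≤ n) (i : ZMod (2 * n + 1)) (j : ZMod (2 * n + 2)) :
    foldReflectPoly i (βPoly j) = βPoly j - fold (fun a => cartan a j) i • fold βPoly i := by
  by_cases hj : j = 0
  · have h1 : foldReflectPoly i (βPoly j) = 1 - ∑ k ∈ Finset.univ.erase 0,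
        (X (some k) - fold (fun a => cartan a k) i • fold βPoly i) := by
      rw [βPoly, if_pos hj, map_sub, map_one, map_sum]
      congr 1
      refine Finset.sum_congr rfl fun k hk => ?_
      rw [foldReflectPoly, aeval_X]
      simp only [Finset.ne_of_mem_erase hk, if_false, βPoly_of_ne (Finset.ne_of_mem_erase hk)]
    have h2 := sum_fold_cartan hn i
    rw [← Finset.add_sum_erase _ _ (Finset.mem_univ 0)] at h2
    rw [h1, Finset.sum_sub_distrib, ← Finset.sum_smul, eq_neg_of_add_eq_zero_right h2, hj, βPoly,
      if_pos rfl, neg_smul]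
    abel
  · rw [βPoly_of_ne hj, foldReflectPoly, aeval_X]
    simp only [hj, if_false, βPoly_of_ne hj]

lemma foldReflectPoly_injective (hn : 1 ≤ n) (i : ZMod (2 * n + 1)) :
    Function.Injective (foldReflectPoly i) := by
  have hB : foldReflectPoly i (fold βPoly i) = - fold βPoly i := by
    have h1 := map_fold (foldReflectPoly i : MvPolynomial (Option (ZMod (2 * n + 2))) ℂ →+
      MvPolynomial (Option (ZMod (2 * n + 2))) ℂ) βPoly i
    have h2 : ∀ x, (foldReflectPoly i : MvPolynomial (Option (ZMod (2 * n + 2))) ℂ →+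
      MvPolynomial (Option (ZMod (2 * n + 2))) ℂ) x = foldReflectPoly i x := fun _ => rfl
    simp only [h2, foldReflectPoly_βPoly hn, fold_sub_smul, fold_fold_cartan hn, cartan_self,
      two_smul] at h1
    rw [h1]; abel
  have : (foldReflectPoly i).comp (foldReflectPoly i) = AlgHom.id ℂ _ := by
    ext1 c
    rcases c with _ | j
    · simp [foldReflectPoly]
    · by_cases hj : j = 0
      · subst hj; simp [foldReflectPoly]
      · rw [AlgHom.comp_apply, ← βPoly_of_ne hj, foldReflectPoly_βPoly hn, map_sub, map_zsmul, hB,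
          foldReflectPoly_βPoly hn, smul_neg, sub_neg_eq_add, sub_add_cancel]
        rfl
  exact Function.LeftInverse.injective (g := foldReflectPoly i) fun x => congrArg (fun g => g x) this

end ReflectionOn

/-! ### Existence of the reflections on power series. -/

section ReflectionExistence

variable {Ψ : K n →ₐ[ℂ] LaurentSeries (F n)} (W : WeylAction n)

/-- The series of values of `r i` on the generators. -/
lemma IsPsi.exists_reflection_hom (hn : 1 ≤ n) (hΨ : IsPsi Ψ) (i : ZMod (2 * n + 1)) :
    ∃ τ : F n →ₐ[ℂ] PowerSeries (F n), IsReflectionOn i ((constantCoeffHom (F n)).comp τ) ∧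
      (∀ j, τ (β j) = PowerSeries.C (β j - fold (fun a => cartan a j) i • γ i)) ∧
      τ t = PowerSeries.C t ∧ τ h' = PowerSeries.C h' ∧ ∀ j, Ψ (W.r i (f j)) =
        toLaurent n (((delta j : ℤ) : PowerSeries (F n)) + PowerSeries.X * τ (φ j)) := by
  choose p hp hp0 using hΨ.exists_r_f W hn i
  have hh : (Ψ.comp (W.r i : K n →ₐ[ℂ] K n)) h = toLaurent n (PowerSeries.X ^ 2 * PowerSeries.C h') :=
    (congrArg Ψ (W.r_h i)).trans hΨ.h_eq
  have hβ : ∀ j (x : F n), (β j - fold (fun a => cartan a j) i • γ i) * x =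
      x * (β j - fold (fun a => cartan a j) i • γ i) := by
    intro j x
    rw [sub_mul, mul_sub, smul_mul_assoc, mul_smul_comm, F.γ_comm hn, F.β_comm hn]
  have H : CoreRel p (fun j => PowerSeries.C (β j - fold (fun a => cartan a j) i • γ i))
      (PowerSeries.C h') :=
    affine_coreRel hn hp hh fun j s => C_comm (hβ j) s
  have ht : TimeRel p (fun j => PowerSeries.C (β j - fold (fun a => cartan a j) i • γ i))
      (PowerSeries.C t) (PowerSeries.C h') := by
    refine ⟨fun _ => (C_comm F.t_comm _).symm, fun _ => (C_comm F.t_comm _).symm,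
      C_comm F.t_comm _, ?_⟩
    rw [sum_range_zmod fun j => PowerSeries.C (β j - fold (fun a => cartan a j) i • γ i), ← map_sum,
      Finset.sum_sub_distrib, ← Finset.sum_smul, sum_fold_cartan hn, zero_smul, sub_zero, F.sum_β,
      map_one]
  obtain ⟨τ, τφ, τβ, τt, τh⟩ := F.exists_hom hn H (affine_sumRel (Ψ' := Ψ.comp (W.r i : K n →ₐ[ℂ] K n)) hp) ht
    (algebraicIndependent_aeval (MvPolynomial.algebraicIndependent_X _ ℂ) (foldReflectPoly i)
      (foldReflectPoly_injective hn i))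
    (by simp [foldReflectPoly, F.paramHom_none hn]) (by simp [foldReflectPoly, F.paramHom_zero hn])
    (fun j hj => by
      rw [PowerSeries.constantCoeff_C, aeval_X_left, AlgHom.id_apply, ← βPoly_of_ne hj,
        foldReflectPoly_βPoly hn, map_sub, map_zsmul, paramHom_fold_βPoly, βPoly_of_ne hj,
        F.paramHom_some hn hj])
  refine ⟨τ, ⟨fun j => ?_, fun j => ?_, ?_, ?_⟩, τβ, τt, τh, fun j => ?_⟩
  · rw [AlgHom.comp_apply, τφ, constantCoeffHom_apply, hp0]
  · rw [AlgHom.comp_apply, τβ, constantCoeffHom_apply, PowerSeries.constantCoeff_C]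
  · rw [AlgHom.comp_apply, τt, constantCoeffHom_apply, PowerSeries.constantCoeff_C]
  · rw [AlgHom.comp_apply, τh, constantCoeffHom_apply, PowerSeries.constantCoeff_C]
  · rw [τφ, hp]

/-- This reconciles the uniform formula for the action on the `β j` with the three separate values
prescribed at `β 0`. -/
lemma fold_cartan_zero (hn : 1 ≤ n) (i : ZMod (2 * n + 1)) :
    (β 0 : F n) - fold (fun a => cartan a (0 : ZMod (2 * n + 2))) i • γ i =
      if i = 0 then -β 1 else if i = -1 then β 0 + β (-1) else β 0 := by
  have hm : (-1 : ZMod (2 * n + 1)) = ((2 * n : ℕ) : ZMod (2 * n + 1)) := by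
    have := ZMod.natCast_self (2 * n + 1)
    rw [Nat.cast_succ] at this
    exact neg_eq_of_add_eq_zero_left this
  have hm' : (-1 : ZMod (2 * n + 2)) = ((2 * n + 1 : ℕ) : ZMod (2 * n + 2)) := by
    have := ZMod.natCast_self (2 * n + 1 + 1)
    rw [Nat.cast_succ] at this
    exact neg_eq_of_add_eq_zero_left this
  obtain ⟨a, ha, rfl⟩ := exists_natCast_eq i
  have e0 : (a : ZMod (2 * n + 1)) = 0 ↔ a = 0 := by
    rw [← Nat.cast_zero, natCast_eq_natCast_of_lt (by omega) ha]
  have e1 : (a : ZMod (2 * n + 1)) = -1 ↔ a = 2 * n := by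
    rw [hm, natCast_eq_natCast_of_lt (by omega) ha]
  have e2 : (0 : ZMod (2 * n + 2)) = ((0 : ℕ) : ZMod (2 * n + 2)) := Nat.cast_zero.symm
  rw [γ_eq_fold, fold_natCast _ ha, fold_natCast _ ha]
  simp only [e0, e1]
  by_cases h0 : a = 0
  · rw [if_pos h0, if_pos h0, if_pos h0, e2, cartan_natCast, cartan_natCast] <;> try omega
    simp
  · rw [if_neg h0, if_neg h0, if_neg h0, e2, cartan_natCast] <;> try omega
    by_cases h1 : a = 2 * n
    · rw [if_pos h1, if_neg (by omega), if_pos (by omega), hm', h1, neg_smul, one_smul,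
        sub_neg_eq_add]
    · rw [if_neg h1, if_neg (by omega), if_neg (by omega), zero_smul, sub_zero]

lemma IsPsi.exists_isReflection (hn : 1 ≤ n) (hΨ : IsPsi Ψ) : ∃ R, IsReflection W Ψ R := by
  choose τ τr τβ τt τh τφ using hΨ.exists_reflection_hom W hn
  have hbij : ∀ i, Function.Bijective fun a => PowerSeries.constantCoeff (τ i a) := by
    intro i
    refine Function.Involutive.bijective fun a => ?_
    exact congrArg (fun g => g a) ((τr i).comp_self hn)
  have hC : ∀ i x, extendEquiv (τ i) (hbij i) (PowerSeries.C x) = τ i x := fun i => extend_C (τ i)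
  have τγ : ∀ i j, τ i (γ j) = PowerSeries.C (γ j - cartan i j • γ i) := by
    intro i j
    have h1 := map_fold (τ i : F n →+ PowerSeries (F n)) β j
    have h2 : ∀ x, (τ i : F n →+ PowerSeries (F n)) x = τ i x := fun _ => rfl
    simp only [h2, τβ] at h1
    have h3 := map_fold (PowerSeries.C.toAddMonoidHom : F n →+ PowerSeries (F n))
      (fun j => β j - fold (fun a => cartan a j) i • γ i) j
    rw [fold_sub_smul, fold_fold_cartan hn] at h3
    exact h1.trans h3.symm
  refine ⟨fun i => extendEquiv (τ i) (hbij i), fun i => extend_X (τ i), fun i => (hC i _).trans (τt i),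
    fun i j => (hC i _).trans (τγ i j), fun i => ?_, fun i => (hC i _).trans (τh i),
    fun i j hj => ?_⟩
  · rw [hC, τβ, fold_cartan_zero hn]
  · rw [hC, ψ, if_neg hj, τφ, delta_of_ne (shift_ne hj).1 (shift_ne hj).2, Int.cast_zero, zero_add,
      epow_neg_one_mul]
    rfl

end ReflectionExistence

lemma ContinuousLimit.nonempty (hn : 1 ≤ n) : Nonempty (ContinuousLimit n) := by
  obtain ⟨T, hT⟩ := (psi_isPsi hn).exists_isShift (weylAction hn) hn
  obtain ⟨R, hR⟩ := (psi_isPsi hn).exists_isReflection (weylAction hn) hn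
  exact ⟨⟨weylAction hn, psi hn, T, R, psi_isPsi hn, hT, hR⟩⟩

end QPainleve
end

noncomputable section
namespace QPainleve

open MvPolynomial

variable {n : ℕ}

/-! ### The continuous limit -/

/-! ### Sums of every second `ψ` around the odd cycle. -/

section OddSums

/-- The sum `ψ (i + 2) + ψ (i + 4) + ⋯ + ψ (i + 2 n)`. -/
def evenSum (i : ZMod (2 * n + 1)) : F n :=
  ∑ q ∈ Finset.Icc 1 n, ψ (i + 2 * (q : ZMod (2 * n + 1)))

lemma evenSum_sub_one (i : ZMod (2 * n + 1)) :
    ∑ q ∈ Finset.Icc 1 n, (ψ (i + 2 * (q : ZMod (2 * n + 1)) - 1) : F n) = evenSum (i - 1) :=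
  Finset.sum_congr rfl fun q _ => by rw [add_sub_right_comm]

lemma sum_range_two_mul {A : Type*} [AddCommMonoid A] (w : ℕ → A) (m : ℕ) :
    ∑ k ∈ Finset.range (2 * m), w k =
      ∑ k ∈ Finset.range m, w (2 * k) + ∑ k ∈ Finset.range m, w (2 * k + 1) := by
  rw [← Finset.sum_add_distrib]
  induction m with
  | zero => simp
  | succ m ih =>
    rw [mul_add, mul_one, Finset.sum_range_succ, Finset.sum_range_succ, ih, Finset.sum_range_succ,
      add_assoc]

lemma sum_Icc_one {A : Type*} [AddCommMonoid A] (u : ℕ → A) (m : ℕ) :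
    ∑ q ∈ Finset.Icc 1 m, u q = ∑ q ∈ Finset.range m, u (q + 1) := by
  induction m with
  | zero => simp
  | succ m ih => rw [Finset.sum_Icc_succ_top (by omega), ih, Finset.sum_range_succ]

lemma sum_range_odd {A : Type*} [AddCommMonoid A] (w : ℕ → A) (m : ℕ) :
    ∑ k ∈ Finset.range (2 * m + 1), w k = w 0 +
      (∑ q ∈ Finset.Icc 1 m, w (2 * q - 1) + ∑ q ∈ Finset.Icc 1 m, w (2 * q)) := by
  rw [Finset.sum_range_succ', add_comm, sum_range_two_mul, sum_Icc_one, sum_Icc_one]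
  rfl

lemma sum_fold {A : Type*} [AddCommMonoid A] (v : ZMod (2 * n + 2) → A) :
    ∑ i, fold v i = ∑ j, v j := by
  rw [← sum_range_zmod, ← sum_range_zmod, Finset.sum_range_succ', Finset.sum_range_succ',
    Finset.sum_range_succ', Nat.cast_zero, Nat.cast_zero, fold_zero, zero_add, Nat.cast_one,
    add_assoc, add_comm (v 1)]
  congr 1
  refine Finset.sum_congr rfl fun m hm => ?_
  rw [Finset.mem_range] at hm
  rw [fold_natCast _ (by omega), if_neg (by omega)]

lemma SumRel.sum_eq {R : Type*} [Ring R] {p : ZMod (2 * n + 2) → R} {c : R} (hs : SumRel p c) :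
    ∑ j, p j = c + c := by
  rw [← sum_range_zmod]
  have := sum_range_two_mul (fun k => p ((k : ℕ) : ZMod (2 * n + 2))) (n + 1)
  rw [hs.even, hs.odd] at this
  exact this

lemma F.sum_ψ : ∑ i, (ψ i : F n) = t := by
  simp only [ψ_eq_fold]
  rw [Finset.sum_add_distrib, sum_fold, F.sumRel.sum_eq]
  simp

lemma F.sum_γ : ∑ i, (γ i : F n) = 1 := by
  simp only [γ_eq_fold]
  rw [sum_fold, F.sum_β]

/-- The offsets `1, 3, …, 2 n - 1` and `2, 4, …, 2 n`, together with `0`, exhaust the cycle of odd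
length, and the sum of all `ψ` is `t`. -/
lemma evenSum_add (i : ZMod (2 * n + 1)) :
    evenSum (i - 1) + evenSum i + ψ i = (t : F n) := by
  rw [← F.sum_ψ, ← Equiv.sum_comp (Equiv.addLeft i), ← sum_range_zmod, sum_range_odd,
    ← evenSum_sub_one, evenSum, add_comm _ (ψ i)]
  simp only [Equiv.coe_addLeft]
  rw [Nat.cast_zero, add_zero]
  congr 2
  · refine Finset.sum_congr rfl fun q hq => ?_
    have := (Finset.mem_Icc.mp hq).1
    rw [Nat.cast_sub (by omega)]
    push_cast
    rw [add_sub_assoc]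
  · refine Finset.sum_congr rfl fun q _ => ?_
    push_cast
    rfl

lemma shift_neg_one_sub {k : ℕ} (hk : k < 2 * n) :
    (-1 - (k : ZMod (2 * n + 1))) ≠ 0 ∧ shift (-1 - (k : ZMod (2 * n + 1))) = revIndex n k := by
  have h : (-1 - (k : ZMod (2 * n + 1))) = ((2 * n - k : ℕ) : ZMod (2 * n + 1)) := by
    have := ZMod.natCast_self (2 * n + 1)
    rw [Nat.cast_sub (by omega)]
    push_cast at this ⊢
    linear_combination -this
  constructor
  · rw [h, ← Nat.cast_zero, Ne, natCast_eq_natCast_of_lt (by omega) (by omega)]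
    omega
  · rw [h, shift, ZMod.val_cast_of_lt (by omega), ← natCast_sub_eq_revIndex (by omega)]
    congr 1
    omega

lemma ψ_neg_one_sub {k : ℕ} (hk : k < 2 * n) :
    (ψ (-1 - (k : ZMod (2 * n + 1))) : F n) = φ (revIndex n k) := by
  rw [ψ, if_neg (shift_neg_one_sub hk).1, (shift_neg_one_sub hk).2]

lemma γ_neg_one_sub {k : ℕ} (hk : k < 2 * n) :
    (γ (-1 - (k : ZMod (2 * n + 1))) : F n) = β (revIndex n k) := by
  rw [γ, if_neg (shift_neg_one_sub hk).1, (shift_neg_one_sub hk).2]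

lemma exists_neg_one_sub {i : ZMod (2 * n + 1)} (hi : i ≠ 0) :
    ∃ k < 2 * n, i = -1 - (k : ZMod (2 * n + 1)) := by
  obtain ⟨k, hk, h⟩ := exists_natCast_eq (-1 - i)
  refine ⟨k, ?_, by rw [h]; ring⟩
  rcases Nat.lt_or_ge k (2 * n) with h1 | h1
  · exact h1
  · refine absurd ?_ hi
    have h2 : k = 2 * n := by omega
    have := ZMod.natCast_self (2 * n + 1)
    rw [h2] at h
    push_cast at this h
    linear_combination h - this

/-- By `evenSum_add` both sides obey the same recursion in `k`. They agree at `k = 0` by the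
normalization `φ 0 + φ 2 + ⋯ = 0`. -/
lemma evenSum_eq (k : ℕ) (hk : k ≤ 2 * n) :
    evenSum (-1 - (k : ZMod (2 * n + 1))) = - shiftLinear n k := by
  induction k with
  | zero =>
    have h0 := F.sumRel (n := n).zero_eq
    rw [shiftLinear, h0, zero_sub, neg_neg, evenSum,
      sum_Icc_one fun q => ψ (-1 - ((0 : ℕ) : ZMod (2 * n + 1)) + 2 * (q : ZMod (2 * n + 1)))]
    refine Finset.sum_congr rfl fun m hm => ?_
    rw [Finset.mem_range] at hm
    have h2 : -1 - ((0 : ℕ) : ZMod (2 * n + 1)) + 2 * ((m + 1 : ℕ) : ZMod (2 * n + 1)) =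
        ((2 * m + 1 : ℕ) : ZMod (2 * n + 1)) := by
      push_cast; ring
    rw [h2, ψ, if_neg, shift, ZMod.val_cast_of_lt (by omega)]
    rw [← Nat.cast_zero, natCast_eq_natCast_of_lt (by omega) (by omega)]
    omega
  | succ k ih =>
    have h := evenSum_add (-1 - (k : ZMod (2 * n + 1)))
    rw [ih (by omega), ψ_neg_one_sub (by omega)] at h
    have e : (-1 - ((k + 1 : ℕ) : ZMod (2 * n + 1))) = -1 - (k : ZMod (2 * n + 1)) - 1 := by
      push_cast; ring
    rw [e, shiftLinear, ← h]
    abel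

/-- The quadratic parts of the vector field sum to zero. -/
lemma sum_quadratic : ∑ i : ZMod (2 * n + 1), (ψ i * evenSum (i - 1) - evenSum i * ψ i : F n) = 0 := by
  rw [Finset.sum_sub_distrib, sub_eq_zero]
  simp only [← evenSum_sub_one]
  simp only [evenSum, Finset.mul_sum, Finset.sum_mul]
  rw [Finset.sum_comm, Finset.sum_comm (s := Finset.univ)]
  -- With `j = i + 2 q - 1` one has `i = j + 2 (n + 1 - q)` modulo `2 n + 1`, so each product in one
  -- sum occurs in the other in the same order of factors.
  refine Finset.sum_bij' (fun q _ => n + 1 - q) (fun q _ => n + 1 - q) ?_ ?_ ?_ ?_ ?_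
  · intro q hq; rw [Finset.mem_Icc] at hq ⊢; omega
  · intro q hq; rw [Finset.mem_Icc] at hq ⊢; omega
  · intro q hq; rw [Finset.mem_Icc] at hq; omega
  · intro q hq; rw [Finset.mem_Icc] at hq; omega
  · intro q hq
    rw [Finset.mem_Icc] at hq
    refine Eq.trans (Finset.sum_congr rfl fun i _ => ?_)
      (Equiv.sum_comp (Equiv.addRight (2 * (q : ZMod (2 * n + 1)) - 1)) _)
    have h := ZMod.natCast_self (2 * n + 1)
    have e : i + (2 * (q : ZMod (2 * n + 1)) - 1) +
        2 * ((n + 1 - q : ℕ) : ZMod (2 * n + 1)) = i := by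
      rw [Nat.cast_sub (by omega)]
      push_cast at h ⊢
      linear_combination h
    rw [Equiv.coe_addRight, e, add_sub_assoc]

end OddSums

/-! ### The derivation `∂` on generators. -/

section TimeDerivation

/-- The values of the continuous limit of `T₁` on the generators. -/
structure IsTimeDerivation (D : F n →ₗ[ℂ] F n) : Prop where
  leibniz : IsDerivation D
  map_t : D t = 1
  map_β : ∀ j, D (β j) = 0
  map_h' : D h' = 0
  map_ψ : ∀ i, D (ψ i) = ψ i * evenSum (i - 1) - evenSum i * ψ i + γ i

variable {D : F n →ₗ[ℂ] F n}

lemma IsDerivation.map_one {A : Type} [Ring A] [Algebra ℂ A] {D : A →ₗ[ℂ] A}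
    (hD : IsDerivation D) : D 1 = 0 := by
  have := hD 1 1
  rwa [mul_one, mul_one, one_mul, left_eq_add] at this

lemma IsDerivation.map_inv {A : Type} [Ring A] [Algebra ℂ A] {D : A →ₗ[ℂ] A}
    (hD : IsDerivation D) {x y : A} (hxy : x * y = 1) (hyx : y * x = 1) :
    D y = -(y * D x * y) := by
  have h := hD x y
  rw [hxy, hD.map_one] at h
  have h2 : y * (D x * y) + y * (x * D y) = 0 := by rw [← mul_add, ← h, mul_zero]
  rw [← mul_assoc y x, hyx, one_mul] at h2
  rw [mul_assoc]
  exact eq_neg_of_add_eq_zero_right h2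

/-- A limit of `T₁` is determined by the values on `ψ i`, `i ≠ 0`. -/
lemma IsTimeDerivation.of_ne_zero (hD : IsDerivation D) (ht : D t = 1) (hβ : ∀ j, D (β j) = 0)
    (hh : D h' = 0)
    (hψ : ∀ i, i ≠ 0 → D (ψ i) = ψ i * evenSum (i - 1) - evenSum i * ψ i + γ i) :
    IsTimeDerivation D := by
  refine ⟨hD, ht, hβ, hh, fun i => ?_⟩
  by_cases hi : i = 0
  · subst hi
    -- Summed over all indices the formula is known: `∑ ψ = t` has derivative `1 = ∑ γ`, and the
    -- quadratic parts cancel. Subtracting the nonzero indices leaves the formula at `0`.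
    have h1 : ∑ i, D (ψ i) =
        ∑ i : ZMod (2 * n + 1), (ψ i * evenSum (i - 1) - evenSum i * ψ i + γ i) := by
      rw [Finset.sum_add_distrib, sum_quadratic, F.sum_γ, zero_add, ← map_sum, F.sum_ψ, ht]
    rw [← Finset.add_sum_erase _ _ (Finset.mem_univ 0),
      ← Finset.add_sum_erase Finset.univ (fun i : ZMod (2 * n + 1) =>
        (ψ i * evenSum (i - 1) - evenSum i * ψ i + γ i : F n)) (Finset.mem_univ 0),
      Finset.sum_congr rfl fun i hi => hψ i (Finset.ne_of_mem_erase hi)] at h1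
    exact add_right_cancel h1
  · exact hψ i hi

end TimeDerivation

/-! ### Commutation of the reflections with `∂`. -/

section Symmetry

lemma add_one_ne_sub_one_odd (hn : 1 ≤ n) (i : ZMod (2 * n + 1)) : i + 1 ≠ i - 1 := by
  obtain ⟨a, ha, rfl⟩ := exists_natCast_eq i
  intro h
  have h2 : ((2 : ℕ) : ZMod (2 * n + 1)) = ((0 : ℕ) : ZMod (2 * n + 1)) := by
    push_cast
    linear_combination h
  rw [natCast_eq_natCast_of_lt (by omega) (by omega)] at h2
  omega

lemma orient_odd_eq (hn : 1 ≤ n) (i j : ZMod (2 * n + 1)) :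
    orient i j = (if j = i + 1 then 1 else 0) - (if j = i - 1 then 1 else 0) := by
  unfold orient
  have := add_one_ne_sub_one_odd hn i
  split_ifs <;> simp_all

/-- In steps of two the index `i - 1` is followed by `i + 1`, so the sum telescopes and only the two
ends of the walk remain. -/
lemma sum_orient_add_two_mul (hn : 1 ≤ n) (i j : ZMod (2 * n + 1)) :
    ∑ q ∈ Finset.Icc 1 n, orient i (j + 2 * (q : ZMod (2 * n + 1))) =
      (if j = i - 1 then 1 else 0) - (if j = i then 1 else 0) := by
  let w : ℕ → ℤ := fun q => if j + 2 * (q : ZMod (2 * n + 1)) = i + 1 then 1 else 0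
  have h1 : ∀ q : ℕ, orient i (j + 2 * (q : ZMod (2 * n + 1))) = w q - w (q + 1) := by
    intro q
    have : j + 2 * (q : ZMod (2 * n + 1)) = i - 1 ↔
        j + 2 * ((q + 1 : ℕ) : ZMod (2 * n + 1)) = i + 1 := by
      push_cast
      constructor <;> intro h <;> linear_combination h
    rw [orient_odd_eq hn]
    simp only [w, this]
  have h2 : ∀ m : ℕ, ∑ q ∈ Finset.Icc 1 m, (w q - w (q + 1)) = w 1 - w (m + 1) := by
    intro m
    induction m with
    | zero => simp
    | succ m ih => rw [Finset.sum_Icc_succ_top (by omega), ih]; ring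
  have e1 : j + 2 * ((1 : ℕ) : ZMod (2 * n + 1)) = i + 1 ↔ j = i - 1 := by
    push_cast
    constructor <;> intro h <;> linear_combination h
  have e2 : j + 2 * ((n + 1 : ℕ) : ZMod (2 * n + 1)) = i + 1 ↔ j = i := by
    have := ZMod.natCast_self (2 * n + 1)
    push_cast at this ⊢
    constructor <;> intro h
    · linear_combination h - this
    · linear_combination h + this
  simp only [h1, h2, w, e1, e2]

variable {D : F n →ₗ[ℂ] F n} {i : ZMod (2 * n + 1)} {ρ : F n →ₐ[ℂ] F n}

lemma IsReflectionOn.map_evenSum (hn : 1 ≤ n) (hρ : IsReflectionOn i ρ) (j : ZMod (2 * n + 1)) :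
    ρ (evenSum j) = evenSum j + ((if j = i - 1 then 1 else 0) - (if j = i then 1 else 0) : ℤ) •
      (γ i * Ring.inverse (ψ i)) := by
  rw [evenSum, map_sum, ← sum_orient_add_two_mul hn, Finset.sum_smul, ← Finset.sum_add_distrib]
  exact Finset.sum_congr rfl fun q _ => hρ.map_ψ hn _

lemma IsTimeDerivation.map_γ (hD : IsTimeDerivation D) (i : ZMod (2 * n + 1)) : D (γ i) = 0 := by
  unfold γ
  split_ifs
  · rw [map_add, hD.map_β, hD.map_β, add_zero]
  · exact hD.map_β _

/-- This is a noncommutative Riccati equation for `κ = γ i (ψ i)⁻¹`. It comes from differentiating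
the inverse, using that `γ i` is central and constant. -/
lemma IsTimeDerivation.map_γ_mul_inverse (hn : 1 ≤ n) (hD : IsTimeDerivation D)
    (i : ZMod (2 * n + 1)) : D (γ i * Ring.inverse (ψ i)) =
      γ i * Ring.inverse (ψ i) * evenSum i - evenSum (i - 1) * (γ i * Ring.inverse (ψ i)) -
        γ i * Ring.inverse (ψ i) * (γ i * Ring.inverse (ψ i)) := by
  have h1 := Ring.mul_inverse_cancel _ (F.isUnit_ψ hn i)
  have h2 := Ring.inverse_mul_cancel _ (F.isUnit_ψ hn i)
  have hg := F.γ_comm hn i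
  rw [hD.leibniz, hD.map_γ, zero_mul, zero_add, hD.leibniz.map_inv h1 h2, hD.map_ψ]
  set u := Ring.inverse (ψ i) with hu
  have h3 : u * (ψ i * evenSum (i - 1) - evenSum i * ψ i + γ i) * u =
      evenSum (i - 1) * u - u * evenSum i + u * γ i * u := by
    rw [mul_add, add_mul, mul_sub, sub_mul, ← mul_assoc u (ψ i), h2, one_mul, ← mul_assoc u,
      mul_assoc _ (ψ i), h1, mul_one]
  rw [h3, mul_neg, mul_add, mul_sub, ← mul_assoc, hg (evenSum (i - 1)), mul_assoc (γ i) u (γ i * u),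
    ← mul_assoc u, mul_assoc (evenSum (i - 1)), mul_assoc (γ i) u (evenSum i)]
  abel

/-- Only `j = i, i ± 1` are affected. At `j = i` the identities `ψ i κ = κ ψ i = γ i` suffice; at
the neighbours `γ i` is rewritten as a combination of products with `κ`, to match the Riccati
equation. -/
lemma IsReflectionOn.comm_ψ (hn : 1 ≤ n) (hρ : IsReflectionOn i ρ) (hD : IsTimeDerivation D)
    (j : ZMod (2 * n + 1)) : ρ (D (ψ j)) = D (ρ (ψ j)) := by
  have h1 := Ring.mul_inverse_cancel _ (F.isUnit_ψ hn i)
  have h2 := Ring.inverse_mul_cancel _ (F.isUnit_ψ hn i)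
  have hg := F.γ_comm hn i
  have hκ := hD.map_γ_mul_inverse hn i
  have hne := add_one_ne_sub_one_odd hn i
  have hne1 : i + 1 ≠ i := by
    rw [Ne, add_eq_left]
    intro h
    exact hne (by rw [h, add_zero, sub_zero])
  have hne2 : i - 1 ≠ i := by
    intro h
    exact hne1 (by conv_lhs => rw [← h, sub_add_cancel])
  rw [hD.map_ψ, map_add, map_sub, map_mul, map_mul, hρ.map_evenSum hn, hρ.map_evenSum hn, hρ.map_ψ hn,
    hρ.map_γ hn, map_add, map_zsmul, hκ, hD.map_ψ]
  have k1 : ψ i * (γ i * Ring.inverse (ψ i)) = γ i := by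
    rw [← mul_assoc, ← hg, mul_assoc, h1, mul_one]
  have k2 : γ i * Ring.inverse (ψ i) * ψ i = γ i := by rw [mul_assoc, h2, mul_one]
  set κ := γ i * Ring.inverse (ψ i) with hκdef
  have s0 := evenSum_add i
  have e1 : j - 1 = i - 1 ↔ j = i := sub_left_inj
  have e2 : j - 1 = i ↔ j = i + 1 := sub_eq_iff_eq_add
  simp only [e1, e2]
  by_cases c0 : j = i
  · subst c0
    have o : orient j j = 0 := orient_self_odd hn j
    simp only [o, if_true, hne1.symm, hne2.symm, if_false, cartan_self, sub_zero, zero_sub,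
      zero_smul, add_zero, neg_smul, one_smul, two_smul]
    rw [mul_add, add_mul, neg_mul, k1, k2]
    abel
  · by_cases c1 : j = i + 1
    · subst c1
      have o : orient i (i + 1) = 1 := by simp [orient]
      have ca : cartan i (i + 1) = -1 := by simp [cartan, hne1]
      have s1 := evenSum_add (i + 1)
      rw [add_sub_cancel_right] at s1
      -- Both instances of `evenSum_add` equal `t`. Comparing them expresses `ψ i`, and
      -- multiplication by `κ` on the right turns this into an expression for `γ i`.
      have s2 : ψ (i + 1) + evenSum (i + 1) - evenSum (i - 1) = (ψ i : F n) := by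
        have := s1.trans s0.symm
        calc _ = evenSum i + evenSum (i + 1) + ψ (i + 1) - evenSum i - evenSum (i - 1) := by abel
          _ = _ := by rw [this]; abel
      have s3 : γ i = ψ (i + 1) * κ + evenSum (i + 1) * κ - evenSum (i - 1) * κ := by
        rw [← add_mul, ← sub_mul, s2, k1]
      simp only [o, ca, hne, hne1, if_true, if_false, zero_sub, sub_zero, zero_smul, add_zero,
        neg_smul, one_smul, add_sub_cancel_right]
      conv_lhs => rw [s3]
      simp only [mul_add, add_mul, mul_neg]
      abel
    · by_cases c2 : j = i - 1
      · subst c2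
        have o : orient i (i - 1) = -1 := by simp [orient, hne.symm]
        have ca : cartan i (i - 1) = -1 := by simp [cartan, hne2]
        have s1 := evenSum_add (i - 1)
        -- This mirrors the previous case, with `κ` multiplied on the left.
        have s2 : evenSum (i - 1 - 1) + ψ (i - 1) - evenSum i = (ψ i : F n) := by
          have := s1.trans s0.symm
          calc _ = evenSum (i - 1 - 1) + evenSum (i - 1) + ψ (i - 1) - evenSum (i - 1) -
                evenSum i := by abel
            _ = _ := by rw [this]; abel
        have s3 : γ i = κ * evenSum (i - 1 - 1) + κ * ψ (i - 1) - κ * evenSum i := by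
          rw [← mul_add, ← mul_sub, s2, k2]
        simp only [o, ca, c0, c1, if_true, if_false, sub_zero, zero_smul, add_zero,
          neg_smul, one_smul]
        conv_lhs => rw [s3]
        simp only [mul_add, add_mul, mul_neg, neg_mul]
        abel
      · have o : orient i j = 0 := by simp [orient, c1, c2]
        have ca : cartan i j = 0 := by simp [cartan, c0, c1, c2]
        simp only [o, ca, c0, c1, c2, if_false, sub_zero, zero_smul, add_zero]

/-- The reflections commute with the continuous limit of `T₁`. -/
lemma IsReflectionOn.comm (hn : 1 ≤ n) (hρ : IsReflectionOn i ρ) (hD : IsTimeDerivation D)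
    (x : F n) : ρ (D x) = D (ρ x) := by
  induction x using F.induction with
  | hscal c =>
    rw [Algebra.algebraMap_eq_smul_one, map_smul, map_smul, map_smul, map_smul, map_one ρ,
      hD.leibniz.map_one, map_zero]
  | hφ j =>
    let S : AddSubgroup (F n) :=
      { carrier := {x | ρ (D x) = D (ρ x)}
        zero_mem' := by simp
        add_mem' := fun {x y} (hx : _ = _) (hy : _ = _) => show _ = _ by
          rw [map_add, map_add, map_add, map_add, hx, hy]
        neg_mem' := fun {x} (hx : _ = _) => show _ = _ by
          rw [map_neg, map_neg, map_neg, map_neg, hx] }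
    refine noncentral_induction F.sumRel S S.zero_mem (fun j h0 h1 => ?_) j
    obtain ⟨k, hk, rfl⟩ := exists_revIndex h0 h1
    rw [← ψ_neg_one_sub (by omega)]
    exact hρ.comm_ψ hn hD _
  | hβ j => rw [hρ.map_β, map_sub, map_zsmul, hD.map_β, hD.map_γ, map_zero, smul_zero, sub_zero]
  | ht => rw [hρ.map_t, hD.map_t, map_one]
  | hh => rw [hρ.map_h', hD.map_h', map_zero]
  | hadd x y hx hy => rw [map_add, map_add, map_add, map_add, hx, hy]
  | hmul x y hx hy =>
    rw [hD.leibniz, map_add, map_mul, map_mul, map_mul, hD.leibniz, hx, hy]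
  | hinv x y hxy hyx hx =>
    have h1 : ρ x * ρ y = 1 := by rw [← map_mul, hxy, map_one]
    have h2 : ρ y * ρ x = 1 := by rw [← map_mul, hyx, map_one]
    rw [hD.leibniz.map_inv hxy hyx, hD.leibniz.map_inv h1 h2, map_neg, map_mul, map_mul, hx]

end Symmetry

/-! ### The limit for arbitrary data with the prescribed values. -/

section Limit

variable (L : ContinuousLimit n)

lemma ContinuousLimit.T_ψ (hn : 1 ≤ n) {k : ℕ} (hk : k < 2 * n) :
    translateSeries n k =
      PowerSeries.X * L.T (PowerSeries.C (ψ (-1 - (k : ZMod (2 * n + 1))))) := by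
  obtain ⟨c0, -, -⟩ := coeff_translateSeries hk
  obtain ⟨u, hu, -⟩ := exists_eq_X_mul c0
  have h := L.isShift.map_ψ _ (shift_neg_one_sub hk).1
  rw [(shift_neg_one_sub hk).2, L.isPsi.map_T₁_f hn L.W hk, hu, epow_neg_one_mul] at h
  rw [hu, toLaurent_injective h]

lemma ContinuousLimit.coeff_T_ψ (hn : 1 ≤ n) {k : ℕ} (hk : k < 2 * n) :
    PowerSeries.constantCoeff (L.T (PowerSeries.C (ψ (-1 - (k : ZMod (2 * n + 1)))))) =
      φ (revIndex n k) ∧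
    PowerSeries.coeff 1 (L.T (PowerSeries.C (ψ (-1 - (k : ZMod (2 * n + 1)))))) =
      shiftLinear n k * φ (revIndex n k) - φ (revIndex n k) * shiftLinear n (k + 1) +
        β (revIndex n k) := by
  obtain ⟨-, c1, c2⟩ := coeff_translateSeries hk
  rw [L.T_ψ hn hk] at c1 c2
  rw [PowerSeries.coeff_succ_X_mul] at c2
  refine ⟨?_, c2⟩
  rw [← PowerSeries.coeff_zero_eq_constantCoeff_apply]
  exact (PowerSeries.coeff_succ_X_mul 0 _).symm.trans c1

/-- The prescribed values give the identity at `φ j` for `j ≠ 0, 1`, and the sum relations extend it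
to `φ 0` and `φ 1`. A homomorphism of the skew field is determined by generators. -/
lemma ContinuousLimit.constantCoeff_T (hn : 1 ≤ n) (x : F n) :
    PowerSeries.constantCoeff (L.T (PowerSeries.C x)) = x := by
  let τ : F n →ₐ[ℂ] F n := (constantCoeffHom (F n)).comp
    ((L.T : PowerSeries (F n) →ₐ[ℂ] PowerSeries (F n)).comp (constHom (F n)))
  have hτ : ∀ x, τ x = PowerSeries.constantCoeff (L.T (PowerSeries.C x)) := fun _ => rfl
  have : τ = AlgHom.id ℂ (F n) := by
    refine F.hom_ext (fun j => ?_) (fun j => ?_) ?_ ?_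
    · have hs := F.sumRel (n := n)
      have hs' : SumRel (fun j => τ (φ j) - φ j) 0 := by
        have h1 := hs.map (τ : F n →+* F n)
        rw [map_zero] at h1
        exact ⟨by rw [Finset.sum_sub_distrib, hs.even, sub_zero]; exact h1.even,
          by rw [Finset.sum_sub_distrib, hs.odd, sub_zero]; exact h1.odd⟩
      refine sub_eq_zero.mp (noncentral_induction hs' ⊥ (AddSubgroup.zero_mem _)
        (fun j h0 h1 => AddSubgroup.mem_bot.mpr ?_) j)
      obtain ⟨k, hk, rfl⟩ := exists_revIndex h0 h1
      rw [← ψ_neg_one_sub hk, hτ, (L.coeff_T_ψ hn hk).1, ψ_neg_one_sub hk, sub_self]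
    · rw [hτ, L.isShift.map_β, PowerSeries.constantCoeff_C]; rfl
    · rw [hτ, L.isShift.map_t]; simp
    · rw [hτ, L.isShift.map_h', PowerSeries.constantCoeff_C]; rfl
  rw [← hτ, this]; rfl

/-- The continuous limit of `T₁`. -/
def ContinuousLimit.derivation : F n →ₗ[ℂ] F n where
  toFun x := PowerSeries.coeff 1 (L.T (PowerSeries.C x))
  map_add' x y := by rw [map_add, map_add, map_add]
  map_smul' c x := by
    rw [← constHom_apply, map_smul, map_smul, constHom_apply]
    rfl

lemma ContinuousLimit.derivation_apply (x : F n) :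
    L.derivation x = PowerSeries.coeff 1 (L.T (PowerSeries.C x)) := rfl

lemma ContinuousLimit.isLimit_derivation (hn : 1 ≤ n) : L.IsLimit L.derivation := by
  intro x
  obtain ⟨u, hu, hu0⟩ := exists_eq_X_mul (s := L.T (PowerSeries.C x) - PowerSeries.C x)
    (by rw [map_sub, L.constantCoeff_T hn, PowerSeries.constantCoeff_C, sub_self])
  refine ⟨u, hu, ?_⟩
  rw [hu0, map_sub, PowerSeries.coeff_C, if_neg one_ne_zero, sub_zero]
  rfl

lemma ContinuousLimit.isTimeDerivation (hn : 1 ≤ n) : IsTimeDerivation L.derivation := by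
  refine IsTimeDerivation.of_ne_zero (fun a b => ?_) ?_ (fun j => ?_) ?_ (fun i hi => ?_)
  · rw [L.derivation_apply, map_mul, map_mul, coeff_one_mul, L.constantCoeff_T hn,
      L.constantCoeff_T hn, add_comm]
    rfl
  · rw [L.derivation_apply, L.isShift.map_t, map_add, PowerSeries.coeff_C, if_neg one_ne_zero,
      PowerSeries.coeff_one_X, zero_add]
  · rw [L.derivation_apply, L.isShift.map_β, PowerSeries.coeff_C, if_neg one_ne_zero]
  · rw [L.derivation_apply, L.isShift.map_h', PowerSeries.coeff_C, if_neg one_ne_zero]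
  · obtain ⟨k, hk, rfl⟩ := exists_neg_one_sub hi
    have e : (-1 - ((k + 1 : ℕ) : ZMod (2 * n + 1))) = -1 - (k : ZMod (2 * n + 1)) - 1 := by
      push_cast; ring
    rw [L.derivation_apply, (L.coeff_T_ψ hn hk).2, ← e, evenSum_eq k hk.le, evenSum_eq (k + 1) hk,
      ψ_neg_one_sub hk, γ_neg_one_sub hk]
    rw [mul_neg, neg_mul]
    abel

/-- The homomorphism of `F` induced by `r i`. -/
def ContinuousLimit.reflection (i : ZMod (2 * n + 1)) : F n →ₐ[ℂ] F n :=
  (constantCoeffHom (F n)).comp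
    ((L.R i : PowerSeries (F n) →ₐ[ℂ] PowerSeries (F n)).comp (constHom (F n)))

lemma ContinuousLimit.reflection_apply (i : ZMod (2 * n + 1)) (x : F n) :
    L.reflection i x = PowerSeries.constantCoeff (L.R i (PowerSeries.C x)) := rfl

/-- The data prescribe `R i` only on `t`, `h'`, `β 0`, all `γ j` and the `ψ j` with `j ≠ 0`. The
remaining `β 1` equals `γ 0 - β 0`, and `φ 0, φ 1` are recovered from the sum relations, which the
expected values satisfy as well. -/
lemma ContinuousLimit.isReflectionOn (hn : 1 ≤ n) (i : ZMod (2 * n + 1)) :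
    IsReflectionOn i (L.reflection i) := by
  have hγ : ∀ j, L.reflection i (γ j) = γ j - cartan i j • γ i := fun j => by
    rw [L.reflection_apply, L.isReflection.map_γ, PowerSeries.constantCoeff_C]
  have hβ0 : L.reflection i (β 0) = β 0 - fold (fun a => cartan a (0 : ZMod (2 * n + 2))) i • γ i := by
    rw [L.reflection_apply, L.isReflection.map_β_zero, PowerSeries.constantCoeff_C,
      fold_cartan_zero hn]
  have hr : ∀ {j : ZMod (2 * n + 2)}, j ≠ 0 → j ≠ 1 → ∃ k : ZMod (2 * n + 1), k ≠ 0 ∧ shift k = j := by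
    intro j h0 h1
    obtain ⟨k, hk, rfl⟩ := exists_revIndex h0 h1
    exact ⟨_, shift_neg_one_sub hk⟩
  refine ⟨fun j => ?_, fun j => ?_, ?_, ?_⟩
  · have hs := F.sumRel (n := n)
    have h1 := hs.map (L.reflection i : F n →+* F n)
    rw [map_zero] at h1
    have h2 : SumRel (fun j => φ j + fold (fun a => orient a j) i • (γ i * Ring.inverse (ψ i)))
        (0 : F n) := by
      unfold fold
      split_ifs
      · simp only [add_smul, ← add_assoc]
        exact (hs.reflect hn 0 _).reflect hn 1 _
      · exact hs.reflect hn _ _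
    have h3 : SumRel (fun j => L.reflection i (φ j) -
        (φ j + fold (fun a => orient a j) i • (γ i * Ring.inverse (ψ i)))) 0 :=
      ⟨by rw [Finset.sum_sub_distrib, h2.even, sub_zero]; exact h1.even,
        by rw [Finset.sum_sub_distrib, h2.odd, sub_zero]; exact h1.odd⟩
    refine sub_eq_zero.mp (noncentral_induction h3 ⊥ (AddSubgroup.zero_mem _)
      (fun j j0 j1 => AddSubgroup.mem_bot.mpr (sub_eq_zero.mpr ?_)) j)
    obtain ⟨k, hk, rfl⟩ := hr j0 j1
    obtain ⟨p, hp, hp0⟩ := L.isPsi.exists_r_f L.W hn i (shift k)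
    have h4 := L.isReflection.map_ψ i k hk
    rw [hp, delta_of_ne j0 j1, Int.cast_zero, zero_add, epow_neg_one_mul] at h4
    have h5 : (φ (shift k) : F n) = ψ k := (if_neg hk).symm
    rw [← hp0, h5, L.reflection_apply, toLaurent_injective h4]
  · by_cases h0 : j = 0
    · rw [h0, hβ0]
    · by_cases h1 : j = 1
      · have h2 : (β 1 : F n) = γ 0 - β 0 := by rw [γ, if_pos rfl, add_sub_cancel_left]
        rw [h1, h2, map_sub, hγ, hβ0, ← fold_fold_cartan hn, fold_zero, add_smul]
        abel
      · obtain ⟨k, hk, rfl⟩ := hr h0 h1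
        have h2 : (β (shift k) : F n) = γ k := (if_neg hk).symm
        rw [h2, hγ, ← fold_fold_cartan hn, fold_of_ne _ hk]
  · rw [L.reflection_apply, L.isReflection.map_t, PowerSeries.constantCoeff_C]
  · rw [L.reflection_apply, L.isReflection.map_h', PowerSeries.constantCoeff_C]

/-- The automorphism of `F` induced by `r i`. -/
def ContinuousLimit.reflectionEquiv (hn : 1 ≤ n) (i : ZMod (2 * n + 1)) : F n ≃ₐ[ℂ] F n :=
  AlgEquiv.ofAlgHom (L.reflection i) (L.reflection i) ((L.isReflectionOn hn i).comp_self hn)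
    ((L.isReflectionOn hn i).comp_self hn)

/-- Since `R i` fixes `ε`, it preserves the ideal generated by `ε`, and the constant term of an
image depends only on the constant term of the argument. -/
lemma ContinuousLimit.isInduced_reflectionEquiv (hn : 1 ≤ n) :
    L.IsInduced (L.reflectionEquiv hn) := by
  intro i x
  conv_lhs => rw [eq_C_add_X_mul x]
  rw [map_add, map_mul, L.isReflection.map_ε, map_add, map_mul]
  simp only [PowerSeries.constantCoeff_X, zero_mul, add_zero]
  rfl

end Limit

end QPainleve
end

open QPainleve in
theorem theorem3p3 (n : ℕ) (hn : 1 ≤ n) :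
    Nonempty (ContinuousLimit n) ∧
    ∀ L : ContinuousLimit n,
      ∃ (D : F n →ₗ[ℂ] F n) (r : ZMod (2 * n + 1) → (F n ≃ₐ[ℂ] F n)),
        IsDerivation D ∧ L.IsLimit D ∧ L.IsInduced r ∧
        (∀ i : ZMod (2 * n + 1),
          D (ψ i) = ψ i * (∑ q ∈ Finset.Icc 1 n, ψ (i + 2 * (q : ZMod (2 * n + 1)) - 1))
            - (∑ q ∈ Finset.Icc 1 n, ψ (i + 2 * (q : ZMod (2 * n + 1)))) * ψ i + γ i) ∧
        (∀ (i : ZMod (2 * n + 1)) (x : F n), r i (D x) = D (r i x)) := by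
  refine ⟨ContinuousLimit.nonempty hn, fun L => ?_⟩
  have hD := L.isTimeDerivation hn
  refine ⟨L.derivation, L.reflectionEquiv hn, hD.leibniz, L.isLimit_derivation hn,
    L.isInduced_reflectionEquiv hn, fun i => ?_, fun i x => (L.isReflectionOn hn i).comm hn hD x⟩
  rw [evenSum_sub_one]
  exact hD.map_ψ i
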